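/- **Setting.** Let $n\ge 1$ and $k\ge 0$ be integers, let $R=\mathbb{C}[z^{\pm 1/n}]$ with $z^{1/n}$ a formal variable, and let $c\mapsto\overline{c}$ be the ring involution of $R$ that is complex conjugation on $\mathbb{C}$ and sends $z^{1/n}$ to $z^{-1/n}$. Let $\mathcal H$ be the free $R$-module on the tuples $m=(m_0,\dots,m_{n-1})\in\mathbb{Z}_{\ge0}^n$ (the affine weights $\sum_i m_i\hat\omega_i$), let $\mathcal H_k$ be the span of those with $\sum_i m_i=k$ (that is, $\mathcal H_k[z]$ with scalars extended to $R$), let $\emptyset\in\mathcal H_0$ be the basis vector $m=0$, and let $\langle\cdot,\cdot\rangle$ be the form on $\mathcal H$ that is antilinear in the first and linear in the second variable and for which these basis vectors are orthonormal. For $i\in\mathbb{Z}/n$ let $\varphi_i^*$ raise $m_i$ by one, and let $\varphi_i$ lower $m_i$ by one (giving $0$ if $m_i=0$). *Bethe vectors.* For $u\in R$ put $L_i(u)=\begin{pmatrix}1&u\varphi_i^*\\ \varphi_i&u\end{pmatrix}$ and let $B(u)$ be the upper right entry of $L_n(u)L_{n-1}(u)\cdots L_1(u)$, where $\varphi_n=\varphi_0$,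 $\varphi_n^*=\varphi_0^*$. For invertible $x_1,\dots,x_k\in R$ put $b(x)=B(x_1^{-1})\cdots B(x_k^{-1})\emptyset$. *Noncommutative symmetric functions.* Let $a_i=\varphi_{i+1}^*\varphi_i$ for $1\le i\le n-1$ and $a_0=z\varphi_1^*\varphi_0$. For $0\le r\le n-1$ let $e_r(\mathcal A)=\sum_{|I|=r}\prod^{\circlearrowleft}_{i\in I}a_i$, the sum over the $r$-element subsets $I\subset\mathbb{Z}/n$, where in the product $a_{i+1}$ stands to the left of $a_i$ whenever $i,i+1\in I$; let $e_n(\mathcal A)=z$, and $e_r(\mathcal A)=0$ for $r<0$ or $r>n$. For a partition $\lambda$ let $s_\lambda(\mathcal A)=\det(e_{\lambda^t_i-i+j}(\mathcal A))_{1\le i,j\le\lambda_1}$. The cyclic noncommutative symmetric functions are the elements of the algebra generated over $R$ by the $e_r(\mathcal A)$. Let $h_r(x)$ and $s_\lambda(x)$ be the ordinary complete symmetric and Schur polynomials. *Bethe roots.* Let $\mathfrak P_{\le r,c}$ be the set of partitions with at most $r$ rows and at most $c$ columns. Put $\zeta=e^{2\pi\iota/(k+n)}$ and $\zeta^q=e^{2\pi\iota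 q/(k+n)}$ for real $q$. For a partition $\mu$ with at most $m$ parts let $I(\mu)=(\tfrac{m+1}2+\mu_m-m,\dots,\tfrac{m+1}2+\mu_1-1)$. For $\sigma\in\mathfrak P_{\le n-1,k}$ let $$x_\sigma=z^{1/n}\zeta^{|\sigma|/n}(\zeta^{I_1(\sigma^t)},\dots,\zeta^{I_k(\sigma^t)}),\qquad b_\sigma=b(x_\sigma),\qquad \operatorname{Van}_\sigma=\prod_{1\le i<j\le n}(\zeta^{I_i(\sigma)}-\zeta^{I_j(\sigma)}),$$ where $I(\sigma^t)$ is formed with $m=k$ and $I(\sigma)$ with $m=n$. Let $\xi_\sigma\in\mathbb{Q}^n$ have the entries $(\xi_\sigma)_j=-\bigl(\sigma_j-\tfrac{|\sigma|}n+\tfrac{n+1}2-j\bigr)$, and for $\xi\in\mathbb{R}^n$ let $\chi_\lambda(\xi)=s_\lambda(\zeta^{\xi_1},\dots,\zeta^{\xi_n})$. **Theorem.** For all $n\ge1$ and $k\ge0$ the following hold. 1. The Bethe vectors $b_\sigma$, $\sigma\in\mathfrak P_{\le n-1,k}$, form an $R$-basis of $\mathcal H_k$, they are pairwise orthogonal,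 and each of them is an eigenvector of every cyclic noncommutative symmetric function. The eigenvalues are given as follows. * $e_r(\mathcal A)b_\sigma=h_r(x_\sigma)b_\sigma$ for $0\le r<n$, and $e_n(\mathcal A)b_\sigma=zb_\sigma$; if $k\ge1$, then $h_n(x_\sigma)=z$. * For every partition $\lambda$ whose number of rows plus number of columns is at most $n+k$ (in particular for every $\lambda\in\mathfrak P_{\le n,k}$), $$s_\lambda(\mathcal A)b_\sigma=s_{\lambda^t}(x_\sigma)b_\sigma,\qquad s_{\lambda^t}(x_\sigma)=z^{|\lambda|/n}\chi_\lambda(\xi_\sigma).$$ 2. For every $\sigma\in\mathfrak P_{\le n-1,k}$ one has $\operatorname{Van}_\sigma\ne0$ and $$\langle b_\sigma,b_\sigma\rangle=\frac{n(n+k)^{n-1}}{|\operatorname{Van}_\sigma|^2}.$$ -/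

import Mathlib

open scoped LaurentPolynomial

namespace PhaseModel

/-! ### Scalars -/

/-- The ring `ℂ[z^{±1/n}]`. The Laurent variable `T 1` is `z^{1/n}`, so `T n` is `z`. -/
abbrev Scalars : Type := ℂ[T;T⁻¹]

/-- The variable `z`, where `z^{1/n}` is the Laurent variable. -/
noncomputable def zVar (n : ℕ) : Scalars := LaurentPolynomial.T (n : ℤ)

/-- Complex conjugation extended to `ℂ[z^{±1/n}]` by `z^{1/n} ↦ z^{-1/n}`. -/
noncomputable def bar : Scalars →+* Scalars :=
  ((LaurentPolynomial.invert : Scalars ≃ₐ[ℂ] Scalars) : Scalars →+* Scalars).comp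
    (AddMonoidAlgebra.mapRingHom ℤ (starRingEnd ℂ))

/-! ### States and the phase algebra -/

/-- The state space `⊕_k 𝓗_k`, with scalars extended to `ℂ[z^{±1/n}]`. The basis vectors are the
affine weights `∑ m_i ω̂_i`, given by their Dynkin labels `m : Fin n → ℕ`. -/
abbrev States (n : ℕ) : Type := (Fin n → ℕ) →₀ Scalars

/-- The subspace `𝓗_k`, spanned by the weights of level `∑ m_i = k`. -/
noncomputable def level (n k : ℕ) : Submodule Scalars (States n) :=
  Finsupp.supported Scalars Scalars {m : Fin n → ℕ | ∑ i, m i = k}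

/-- The scalar product, antilinear in the first variable, for which the weights are
orthonormal. -/
noncomputable def scalarProd {n : ℕ} (f g : States n) : Scalars :=
  f.sum fun m c => bar c * g m

/-- The vacuum `∅`, the basis vector of `𝓗_0`. -/
noncomputable def vacuum (n : ℕ) : States n := Finsupp.single 0 1

/-- Creation of a particle at site `i`. -/
noncomputable def creation {n : ℕ} (i : Fin n) : Module.End Scalars (States n) :=
  Finsupp.linearCombination Scalars fun m => Finsupp.single (m + Pi.single i 1) 1

/-- Annihilation of a particle at site `i` (zero if the site is empty). -/
noncomputable def annihilation {n : ℕ} (i : Fin n) : Module.End Scalars (States n) :=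
  Finsupp.linearCombination Scalars fun m =>
    if 0 < m i then Finsupp.single (m - Pi.single i 1) 1 else 0

/-! ### Yang–Baxter algebra and Bethe vectors -/

/-- The Lax matrix `L_i(u)`. -/
noncomputable def lax {n : ℕ} (u : Scalars) (i : Fin n) :
    Matrix (Fin 2) (Fin 2) (Module.End Scalars (States n)) :=
  !![1, u • creation i; annihilation i, u • 1]

/-- The monodromy matrix `M(u) = L_n(u) ⋯ L_1(u)`, where site `n` is site `0`. -/
noncomputable def monodromy (n : ℕ) [NeZero n] (u : Scalars) :
    Matrix (Fin 2) (Fin 2) (Module.End Scalars (States n)) :=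
  (List.ofFn fun j : Fin n => lax u (j + 1)).reverse.prod

/-- The operator `B(u)`, the upper right entry of the monodromy matrix. -/
noncomputable def opB (n : ℕ) [NeZero n] (u : Scalars) : Module.End Scalars (States n) :=
  monodromy n u 0 1

/-- `b(x) = B(x_1⁻¹) ⋯ B(x_k⁻¹) ∅`. -/
noncomputable def betheVector (n : ℕ) [NeZero n] {k : ℕ} (x : Fin k → Scalarsˣ) : States n :=
  (List.ofFn fun j : Fin k => opB n (((x j)⁻¹ : Scalarsˣ) : Scalars)).prod (vacuum n)

/-! ### Cyclic noncommutative symmetric functions -/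

/-- The generators of the affine local plactic algebra acting on states:
`a_i = φ*_{i+1} φ_i` for `i ≠ 0` and `a_0 = z φ*_1 φ_0`. -/
noncomputable def hop {n : ℕ} [NeZero n] (i : Fin n) : Module.End Scalars (States n) :=
  if i = 0 then zVar n • (creation (i + 1) * annihilation i)
  else creation (i + 1) * annihilation i

/-- For a proper subset `I` of `ℤ/n`, the elements of `I` in anticlockwise cyclic order: start at
a point `p ∉ I` and list `p - 1, p - 2, …, p - n`, keeping the elements of `I`. If both `i` and
`i + 1` are in `I` then `i + 1` stands to the left of `i`. -/
def anticlockwise {n : ℕ} [NeZero n] (I : Finset (Fin n)) : List (Fin n) :=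
  if h : Iᶜ.Nonempty then
    (List.ofFn fun d : Fin n => Iᶜ.min' h - (d + 1)).filter (· ∈ I)
  else []

/-- The cyclic noncommutative elementary symmetric polynomials `e_r(𝒜)`, acting on states, with
`e_0 = 1`, `e_n = z`, and `e_r = 0` for `r < 0` and for `r > n`. -/
noncomputable def elemA (n : ℕ) [NeZero n] (r : ℤ) : Module.End Scalars (States n) :=
  if r < 0 then 0
  else if r = n then zVar n • 1
  else ∑ I ∈ (Finset.univ : Finset (Fin n)).powersetCard r.toNat,
    ((anticlockwise I).map hop).prod

/-- The algebra of cyclic noncommutative symmetric functions, generated by the `e_r(𝒜)`. -/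
noncomputable def symA (n : ℕ) [NeZero n] : Subalgebra Scalars (Module.End Scalars (States n)) :=
  Algebra.adjoin Scalars (Set.range fun r : Fin (n + 1) => elemA n (r : ℕ))

/-- The cyclic noncommutative Schur polynomials
`s_λ(𝒜) = det (e_{λᵗ_i - i + j}(𝒜))`, the determinant being expanded by the Leibniz formula. -/
noncomputable def schurA (n : ℕ) [NeZero n] (lam : YoungDiagram) :
    Module.End Scalars (States n) :=
  ∑ π : Equiv.Perm (Fin (lam.rowLen 0)), ((Equiv.Perm.sign π : ℤˣ) : ℤ) •
    (List.ofFn fun i => elemA n ((lam.colLen i : ℤ) - ((i : ℕ) : ℤ) + ((π i : ℕ) : ℤ))).prod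

/-! ### Commutative symmetric functions -/

/-- A filling is semistandard if it is weakly increasing along rows and strictly increasing down
columns. -/
def IsSemistandard {mu : YoungDiagram} {m : ℕ} (t : mu.cells → Fin m) : Prop :=
  ∀ c d : mu.cells,
    (c.1.1 = d.1.1 → c.1.2 < d.1.2 → t c ≤ t d) ∧ (c.1.2 = d.1.2 → c.1.1 < d.1.1 → t c < t d)

open Classical in
/-- The Schur polynomial `s_μ(x_1, …, x_m)`, the sum over semistandard tableaux. -/
noncomputable def schur {S : Type*} [CommRing S] (mu : YoungDiagram) {m : ℕ} (x : Fin m → S) : S :=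
  ∑ t : mu.cells → Fin m with IsSemistandard t, ∏ c, x (t c)

/-- The complete symmetric polynomial `h_r(x_1, …, x_m)`. -/
noncomputable def hSym {S : Type*} [CommRing S] (r : ℕ) {m : ℕ} (x : Fin m → S) : S :=
  MvPolynomial.eval x (MvPolynomial.hsymm (Fin m) S r)

/-! ### Bethe roots -/

/-- Partitions with at most `r` rows and at most `c` columns. -/
abbrev PartitionsIn (r c : ℕ) : Type :=
  {mu : YoungDiagram // mu.colLen 0 ≤ r ∧ mu.rowLen 0 ≤ c}

/-- `ζ^q = exp (2πi q / (k + n))` for real exponents `q`. -/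
noncomputable def zetaPow (n k : ℕ) (q : ℝ) : ℂ :=
  Complex.exp (2 * Real.pi * Complex.I * q / (k + n))

/-- `I(μ) = ((m+1)/2 + μ_m - m, …, (m+1)/2 + μ_1 - 1)` for a partition `μ` with at most `m`
parts. -/
noncomputable def indexI (m : ℕ) (mu : YoungDiagram) (j : Fin m) : ℝ :=
  ((m : ℝ) + 1) / 2 + mu.rowLen j.rev - (((j.rev : ℕ) : ℝ) + 1)

/-- The unit `c z^{1/n}` of `ℂ[z^{±1/n}]`. -/
noncomputable def monomialUnit (c : ℂˣ) : Scalarsˣ where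
  val := LaurentPolynomial.C (c : ℂ) * LaurentPolynomial.T 1
  inv := LaurentPolynomial.C ((c⁻¹ : ℂˣ) : ℂ) * LaurentPolynomial.T (-1)
  val_inv := by
    rw [mul_mul_mul_comm, ← map_mul, ← LaurentPolynomial.T_add]; simp
  inv_val := by
    rw [mul_mul_mul_comm, ← map_mul, ← LaurentPolynomial.T_add]; simp

/-- `x_σ = z^{1/n} ζ^{|σ|/n} (ζ^{I_1}, …, ζ^{I_k})` with `I = I(σᵗ)`. -/
noncomputable def betheRoot (n k : ℕ) (σ : YoungDiagram) (j : Fin k) : Scalarsˣ :=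
  monomialUnit
    (Units.mk0 (zetaPow n k ((σ.card : ℝ) / n) * zetaPow n k (indexI k σ.transpose j))
      (mul_ne_zero (Complex.exp_ne_zero _) (Complex.exp_ne_zero _)))

/-- `x_σ` as a tuple in `ℂ[z^{±1/n}]`. -/
noncomputable def betheRootVal (n k : ℕ) (σ : YoungDiagram) (j : Fin k) : Scalars :=
  (betheRoot n k σ j : Scalars)

/-- The Bethe vector `b_σ = b(x_σ)`. -/
noncomputable def betheState (n k : ℕ) [NeZero n] (σ : YoungDiagram) : States n :=
  betheVector n (betheRoot n k σ)

/-- The character value `χ_λ(ξ) = s_λ(e^{2πi ξ_1/(k+n)}, …, e^{2πi ξ_n/(k+n)})`. -/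
noncomputable def chi (n k : ℕ) (lam : YoungDiagram) (ξ : Fin n → ℝ) : ℂ :=
  schur lam fun j => zetaPow n k (ξ j)

/-- `ξ_σ = -(σ + ρ)`, where `σ` stands for the finite weight `∑_j (σ_j - |σ|/n) ε_j` and
`ρ = ∑_j ((n+1)/2 - j) ε_j`. -/
noncomputable def xi (n : ℕ) (σ : YoungDiagram) (j : Fin n) : ℝ :=
  -(((σ.rowLen j : ℝ) - (σ.card : ℝ) / n) + (((n : ℝ) + 1) / 2 - (((j : ℕ) : ℝ) + 1)))

/-- The Vandermonde determinant `∏_{i<j} (ζ^{I_i(σ)} - ζ^{I_j(σ)})`, `1 ≤ i < j ≤ n`. -/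
noncomputable def vandermonde (n k : ℕ) (σ : YoungDiagram) : ℂ :=
  ∏ i : Fin n, ∏ j ∈ Finset.Ioi i,
    (zetaPow n k (indexI n σ i) - zetaPow n k (indexI n σ j))

end PhaseModel

open PhaseModel

/-! The `k` Bethe roots `x` are traded for `n` dual roots `w_j = z^{1/n} ζ^{ξ_j}`. By the
complementarity of row and column beta numbers of `σ`, the `x_a` and the `-w_j` together are one
common factor times all `(n+k)`-th roots of unity. Hence `∏ (1 - x_a u) ∏ (1 + w_j u)` is `1` minus
a single term of degree `n + k`, so `h_r(x) = e_r(w)` and likewise `e_r(x⁻¹) = h_r(w⁻¹)` for `r < n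
+ k` (`zcoeff_genH_betheRoot`, `zcoeff_genE_betheRoot_inv`).

The coefficient of a Bethe vector at `m` is `det (e_{c_i - i + j}(x⁻¹))`, where `c_i` counts the
particles at sites `i + 1, …, n` (`hasDetCoeff_betheVector`). After the exchange it is a bialternant
in `t = w⁻¹`: up to the Vandermonde determinant, `det (t_j ^ p_i)` with exponents `p_i = c_i + n - 1
- i` (`extCoeff_betheState_mul`). Bethe vectors are thus Slater determinants of `n` free fermions
with `n + k` possible exponents.

On such determinants `e_r(𝒜)` lowers the exponents of `r` rows, a hop across the boundary costing a
factor `z = ∏ w_j`. Configurations with a negative occupation drop out because two rows become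
proportional, by `t_j^{n+k} = const`. The Pieri rule then gives the eigenvalue `e_r(w)`
(`elemA_natCast_betheState`). The Schur eigenvalues follow from the two Jacobi–Trudi formulas.

For the norm, the exponent sets at level `k` are the `n`-subsets of `{0, …, n+k-1}` that contain
`n+k-1`. Cauchy–Binet turns the sum over them into a difference of two Gram determinants, `N^n -
(N^n - n N^{n-1})` with `N = n + k` (`sum_alternant_mul_alternant`).

For orthogonality, `e_r(𝒜)` has adjoint `z⁻¹ e_{n-r}(𝒜)`, and the values `e_r(w)` determine `σ`
(`scalarProd_betheState_ne`, `eq_of_genE_dualRoot_eq`). The norms are units of the scalar ring, and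
there are as many diagrams as configurations, so the vectors form a basis over that ring and not
only over its fraction field. -/

namespace PhaseModel

/-! ### Generating series of symmetric polynomials. -/

section SymmetricFunctions

variable {S : Type*} [CommRing S]

/-- The coefficients of a power series, extended by zero to negative indices. -/
noncomputable def zcoeff (P : PowerSeries S) (r : ℤ) : S :=
  if 0 ≤ r then PowerSeries.coeff r.toNat P else 0

/-- The generating function `∏ (1 + x_i u)` of the elementary symmetric polynomials. -/
noncomputable def genE {ι : Type*} [Fintype ι] (x : ι → S) : PowerSeries S :=
  ∏ i, (1 + PowerSeries.C (x i) * PowerSeries.X)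

/-- The geometric series `1 / (1 - y u)`. -/
noncomputable def geomSeries (y : S) : PowerSeries S := PowerSeries.mk fun r => y ^ r

/-- The generating function `∏ 1 / (1 - x_i u)` of the complete symmetric polynomials. -/
noncomputable def genH {ι : Type*} [Fintype ι] (x : ι → S) : PowerSeries S :=
  ∏ i, geomSeries (x i)

/-- The matrix with entries `P_{a_i + j}`. -/
noncomputable def toeplitz (P : PowerSeries S) {l : ℕ} (a : Fin l → ℤ) :
    Matrix (Fin l) (Fin l) S :=
  Matrix.of fun i j => zcoeff P (a i + (j : ℕ))

lemma zcoeff_of_neg (P : PowerSeries S) {r : ℤ} (h : r < 0) : zcoeff P r = 0 := by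
  simp [zcoeff, not_le.mpr h]

lemma zcoeff_natCast (P : PowerSeries S) (r : ℕ) : zcoeff P r = PowerSeries.coeff r P := by
  simp [zcoeff]

lemma zcoeff_mul_one_add (P : PowerSeries S) (y : S) (r : ℤ) :
    zcoeff (P * (1 + PowerSeries.C y * PowerSeries.X)) r = zcoeff P r + y * zcoeff P (r - 1) := by
  rcases lt_or_ge r 0 with h | h
  · rw [zcoeff_of_neg _ h, zcoeff_of_neg _ h, zcoeff_of_neg _ (by omega)]; simp
  · obtain ⟨s, rfl⟩ := Int.eq_ofNat_of_zero_le h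
    rw [mul_add, mul_one, ← mul_assoc, zcoeff_natCast, zcoeff_natCast, map_add]
    cases s with
    | zero => simp [zcoeff]
    | succ s =>
      rw [PowerSeries.coeff_succ_mul_X, mul_comm P, PowerSeries.coeff_C_mul]
      have : ((s + 1 : ℕ) : ℤ) - 1 = (s : ℕ) := by push_cast; ring
      rw [this, zcoeff_natCast]

lemma geomSeries_mul (y : S) :
    geomSeries y * (1 - PowerSeries.C y * PowerSeries.X) = 1 := by
  ext r
  rw [mul_sub, mul_one, ← mul_assoc, map_sub]
  cases r with
  | zero => simp [geomSeries]
  | succ s =>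
    rw [PowerSeries.coeff_succ_mul_X, mul_comm, PowerSeries.coeff_C_mul]
    simp [geomSeries, PowerSeries.coeff_one, pow_succ']

lemma zcoeff_mul_geomSeries (Q : PowerSeries S) (y : S) (r : ℤ) :
    zcoeff (Q * geomSeries y) r = zcoeff Q r + y * zcoeff (Q * geomSeries y) (r - 1) := by
  have h : Q = (Q * geomSeries y) * (1 + PowerSeries.C (-y) * PowerSeries.X) := by
    have := geomSeries_mul y
    rw [mul_assoc, map_neg, neg_mul, ← sub_eq_add_neg, this, mul_one]
  have h2 := zcoeff_mul_one_add (Q * geomSeries y) (-y) r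
  rw [← h] at h2
  rw [h2]; ring

lemma genE_castSucc {m : ℕ} (x : Fin (m + 1) → S) :
    genE x = genE (fun i : Fin m => x i.castSucc) *
      (1 + PowerSeries.C (x (Fin.last m)) * PowerSeries.X) := by
  simp [genE, Fin.prod_univ_castSucc]

lemma genH_castSucc {m : ℕ} (x : Fin (m + 1) → S) :
    genH x = genH (fun i : Fin m => x i.castSucc) * geomSeries (x (Fin.last m)) := by
  simp [genH, Fin.prod_univ_castSucc]

lemma genH_mul_prod {ι : Type*} [Fintype ι] (x : ι → S) :
    genH x * ∏ i, (1 - PowerSeries.C (x i) * PowerSeries.X) = 1 := by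
  rw [genH, ← Finset.prod_mul_distrib]
  exact Finset.prod_eq_one fun i _ => geomSeries_mul _

/-- Expanding the product of geometric series yields one monomial for each exponent vector of sum
`r`; `Sym.equivNatSum` matches these with the multisets in `hsymm`. -/
lemma hSym_eq_coeff (r : ℕ) {m : ℕ} (x : Fin m → S) :
    hSym r x = PowerSeries.coeff r (genH x) := by
  classical
  rw [hSym, MvPolynomial.hsymm, map_sum, genH, PowerSeries.coeff_prod]
  simp only [geomSeries, PowerSeries.coeff_mk]
  refine Finset.sum_bij' (fun s _ => (Sym.equivNatSum (Fin m) r s).1)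
    (fun l hl => (Sym.equivNatSum (Fin m) r).symm ⟨l, ?_⟩) ?_ ?_ ?_ ?_ ?_
  · simp only [Finset.mem_finsuppAntidiag] at hl
    rw [← hl.1]
    exact (Finsupp.sum_fintype _ _ (by simp))
  · intro s _
    simp only [Finset.mem_finsuppAntidiag, Finset.subset_univ, and_true]
    exact (Finsupp.sum_fintype _ _ (by simp)).symm.trans (Sym.equivNatSum (Fin m) r s).2
  · intros; exact Finset.mem_univ _
  · intro s _; simp
  · intro l hl; simp
  · intro s _
    rw [map_multiset_prod, Multiset.map_map]
    simp only [Function.comp_def, MvPolynomial.eval_X, Sym.coe_equivNatSum_apply_apply]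
    rw [Finset.prod_multiset_map_count]
    refine (Finset.prod_subset (Finset.subset_univ _) ?_)
    intro i _ hi
    rw [Multiset.count_eq_zero.mpr (by simpa using hi), pow_zero]

end SymmetricFunctions

/-! ### Toeplitz determinants when the series gains one factor. -/

section Determinants

variable {S : Type*} [CommRing S]

/-- Each row is an old row plus `y` times the same row with its index lowered by one. Multilinearity
then chooses the set `s` of lowered rows. -/
lemma det_toeplitz_mul_one_add (P : PowerSeries S) (y : S) {l : ℕ} (a : Fin l → ℤ) :
    (toeplitz (P * (1 + PowerSeries.C y * PowerSeries.X)) a).det =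
      ∑ s : Finset (Fin l), y ^ s.card *
        (toeplitz P fun i => a i - if i ∈ s then 1 else 0).det := by
  classical
  have h : toeplitz (P * (1 + PowerSeries.C y * PowerSeries.X)) a =
      (fun i (j : Fin l) => y * zcoeff P (a i - 1 + (j : ℕ))) +
        (fun i (j : Fin l) => zcoeff P (a i + (j : ℕ))) := by
    ext i j
    simp only [toeplitz, Matrix.of_apply, Pi.add_apply]
    rw [zcoeff_mul_one_add, add_comm, add_sub_right_comm]
  change Matrix.detRowAlternating _ = _
  rw [h, AlternatingMap.map_add_univ]
  refine Finset.sum_congr rfl fun s _ => ?_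
  have h2 : (s.piecewise (fun i (j : Fin l) => y * zcoeff P (a i - 1 + (j : ℕ)))
      (fun i (j : Fin l) => zcoeff P (a i + (j : ℕ))) : Fin l → Fin l → S) =
      Matrix.of fun i j => (if i ∈ s then y else 1) *
        toeplitz P (fun i => a i - if i ∈ s then 1 else 0) i j := by
    ext i j
    by_cases hi : i ∈ s <;> simp [hi, toeplitz]
  rw [h2]
  refine (Matrix.det_mul_column _ _).trans ?_
  rw [Finset.prod_ite_mem, Finset.univ_inter, Finset.prod_const]

/-- Subtracting a set of rows that does not leave a partition makes the determinant vanish. -/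
lemma det_toeplitz_sub_eq_zero (P : PowerSeries S) {l : ℕ} (c : ℕ → ℕ) (hc : c l = 0)
    (s : Finset (Fin l)) (j : Fin l) (hj : j ∈ s) (hcj : c j = c (j + 1))
    (hs : ∀ j' ∈ s, (j' : ℕ) ≠ j + 1) :
    (toeplitz P fun i : Fin l => (c i : ℤ) - (i : ℕ) - if i ∈ s then 1 else 0).det = 0 := by
  rcases Nat.lt_or_ge ((j : ℕ) + 1) l with h | h
  -- Lowering row `j` makes its index `c j - j - 1 = c (j+1) - (j+1)`, that of the unlowered row
  -- below it. If `j` is the last row, `c j = 0` and all its indices become negative.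
  · have hne : (⟨j + 1, h⟩ : Fin l) ∉ s := fun h' => hs _ h' rfl
    refine Matrix.det_zero_of_row_eq (i := j) (j := ⟨j + 1, h⟩) ?_ ?_
    · intro he; have := congrArg Fin.val he; simp at this
    · ext i
      simp only [toeplitz, Matrix.of_apply, hj, hne, if_true, if_false]
      congr 1
      rw [hcj]; push_cast; ring
  · have hl : l = j + 1 := by omega
    refine Matrix.det_eq_zero_of_row_eq_zero j fun i => ?_
    simp only [toeplitz, Matrix.of_apply, hj, if_true]
    apply zcoeff_of_neg
    rw [hcj, ← hl, hc]; push_cast; omega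

/-- `Q` is `1 - y u` times `Q * geomSeries y`, so the weighted sum telescopes to its two ends. -/
lemma sum_Icc_pow_mul_zcoeff (Q : PowerSeries S) (y : S) (a b : ℕ) (hab : b ≤ a) (s : ℤ) :
    ∑ v ∈ Finset.Icc b a, y ^ (a - v) * zcoeff Q (v + s) =
      zcoeff (Q * geomSeries y) (a + s) -
        y ^ (a - b + 1) * zcoeff (Q * geomSeries y) (b - 1 + s) := by
  induction a, hab using Nat.le_induction with
  | base =>
    simp only [Finset.Icc_self, Finset.sum_singleton, Nat.sub_self, pow_zero, one_mul, zero_add,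
      pow_one]
    rw [zcoeff_mul_geomSeries Q y (b + s), add_sub_right_comm]; ring_nf
  | succ a hab ih =>
    rw [Finset.sum_Icc_succ_top (by omega)]
    have : ∑ v ∈ Finset.Icc b a, y ^ (a + 1 - v) * zcoeff Q (v + s) =
        y * ∑ v ∈ Finset.Icc b a, y ^ (a - v) * zcoeff Q (v + s) := by
      rw [Finset.mul_sum]
      refine Finset.sum_congr rfl fun v hv => ?_
      rw [Nat.succ_sub (Finset.mem_Icc.mp hv).2, pow_succ']; ring
    rw [this, ih, zcoeff_mul_geomSeries Q y ((a + 1 : ℕ) + s),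
      show ((a + 1 : ℕ) : ℤ) + s - 1 = a + s by push_cast; ring,
      show a + 1 - b = a - b + 1 by omega]
    simp only [Nat.sub_self, pow_zero]
    ring

/-- Naive row expansion would let each index run down without bound. A unitriangular row operation
first cuts the range off at `c (i + 1)`, which leaves exactly the interlacing sequences `v`. -/
lemma det_toeplitz_mul_geomSeries (Q : PowerSeries S) (y : S) {l : ℕ} (c : ℕ → ℕ)
    (hc : Antitone c) (hl : c l = 0) :
    (toeplitz (Q * geomSeries y) fun i : Fin l => (c i : ℤ) - (i : ℕ)).det =
      ∑ v ∈ Fintype.piFinset fun i : Fin l => Finset.Icc (c (i + 1)) (c i),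
        y ^ (∑ i : Fin l, (c i - v i)) *
          (toeplitz Q fun i : Fin l => (v i : ℤ) - (i : ℕ)).det := by
  classical
  set M := toeplitz (Q * geomSeries y) fun i : Fin l => (c i : ℤ) - (i : ℕ) with hM
  -- The superdiagonal entry is the coefficient of the lower end in `sum_Icc_pow_mul_zcoeff`; that
  -- end is row `i + 1` of `M`. For the last row the lower end has negative index since `c l = 0`,
  -- and nothing needs to be subtracted.
  let U : Matrix (Fin l) (Fin l) S := Matrix.of fun i i' =>
    if i = i' then 1 else if (i' : ℕ) = i + 1 then - y ^ (c i - c (i + 1) + 1) else 0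
  have hU : U.det = 1 := by
    rw [Matrix.det_of_isUpperTriangular]
    · simp [U]
    · intro i i' h
      simp only [id] at h
      simp only [U, Matrix.of_apply]
      rw [if_neg h.ne', if_neg]
      have : (i' : ℕ) < i := h
      omega
  have hUM : U * M = fun i : Fin l => ∑ v ∈ Finset.Icc (c (i + 1)) (c i),
      fun j : Fin l => y ^ (c i - v) * zcoeff Q (v + (-(i : ℕ) + (j : ℕ))) := by
    ext i j
    rw [Finset.sum_apply, sum_Icc_pow_mul_zcoeff _ _ _ _ (hc (Nat.le_succ _)), Matrix.mul_apply]
    rw [← Finset.add_sum_erase _ _ (Finset.mem_univ i)]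
    rw [sub_eq_add_neg]
    congr 1
    · simp [U, hM, toeplitz, add_assoc, sub_eq_add_neg]
    · rcases Nat.lt_or_ge ((i : ℕ) + 1) l with h | h
      · rw [Finset.sum_eq_single (⟨i + 1, h⟩ : Fin l)]
        · have : i ≠ ⟨i + 1, h⟩ := fun he => by
            have := congrArg Fin.val he; simp at this
          simp only [U, Matrix.of_apply, if_neg this, if_true, hM, toeplitz]
          rw [neg_mul]
          congr 3
          push_cast; ring
        · intro i' h1 h2
          have h1' : i ≠ i' := (Finset.ne_of_mem_erase h1).symm
          have : (i' : ℕ) ≠ i + 1 := fun he => h2 (Fin.ext he)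
          simp [U, h1', this]
        · intro h1
          refine absurd (Finset.mem_erase.mpr ⟨?_, Finset.mem_univ _⟩) h1
          intro he; have := congrArg Fin.val he; simp at this
      · rw [Finset.sum_eq_zero, zcoeff_of_neg, mul_zero, neg_zero]
        · have : l = i + 1 := by omega
          rw [Nat.succ_eq_add_one, ← this, hl]; push_cast; omega
        · intro i' h1
          have h1' : i ≠ i' := (Finset.ne_of_mem_erase h1).symm
          have : (i' : ℕ) ≠ i + 1 := by omega
          simp [U, h1', this]
  have : M.det = (U * M).det := by rw [Matrix.det_mul, hU, one_mul]
  rw [this, hUM]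
  change Matrix.detRowAlternating _ = _
  refine (MultilinearMap.map_sum_finset (Matrix.detRowAlternating (R := S) (n := Fin l)).toMultilinearMap
    (fun (i : Fin l) (v : ℕ) => fun j : Fin l =>
      y ^ (c i - v) * zcoeff Q (v + (-(i : ℕ) + (j : ℕ))))
    (fun i : Fin l => Finset.Icc (c (i + 1)) (c i))).trans ?_
  refine Finset.sum_congr rfl fun v _ => ?_
  refine (Matrix.det_mul_column (fun i : Fin l => y ^ (c i - v i))
    (Matrix.of fun i j : Fin l => zcoeff Q (v i + (-(i : ℕ) + (j : ℕ))))).trans ?_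
  rw [Finset.prod_pow_eq_pow_sum]
  congr 2
  ext i j
  simp [toeplitz, sub_eq_add_neg, add_assoc]

end Determinants

/-! ### Semistandard tableaux and branching. -/

section Tableaux

lemma finite_setOf_le (mu : YoungDiagram) : {ν : YoungDiagram | ν ≤ mu}.Finite := by
  refine Set.Finite.of_finite_image (f := YoungDiagram.cells)
    ((mu.cells.powerset.finite_toSet).subset ?_) ?_
  · rintro _ ⟨ν, hν, rfl⟩
    simpa using hν
  · intro a _ b _ h
    exact YoungDiagram.ext h

/-- The diagrams `ν ⊆ μ` for which `μ / ν` is a horizontal strip. -/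
noncomputable def horizontalStrips (mu : YoungDiagram) : Finset YoungDiagram :=
  ((finite_setOf_le mu).subset (Set.inter_subset_left
    (t := {ν | ∀ i j, (i + 1, j) ∈ mu → (i, j) ∈ ν}))).toFinset

lemma mem_horizontalStrips {mu ν : YoungDiagram} :
    ν ∈ horizontalStrips mu ↔ ν ≤ mu ∧ ∀ i j, (i + 1, j) ∈ mu → (i, j) ∈ ν := by
  simp [horizontalStrips]

namespace IsSemistandard

variable {mu : YoungDiagram} {m : ℕ} {t : mu.cells → Fin m}

lemma mono (ht : IsSemistandard t) {c d : mu.cells} (h1 : c.1.1 ≤ d.1.1) (h2 : c.1.2 ≤ d.1.2) :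
    t c ≤ t d := by
  have hmem : (c.1.1, d.1.2) ∈ mu.cells :=
    mu.up_left_mem h1 le_rfl (YoungDiagram.mem_cells _ |>.mp d.2)
  have ha : t c ≤ t ⟨(c.1.1, d.1.2), hmem⟩ := by
    rcases h2.lt_or_eq with h | h
    · exact (ht c ⟨_, hmem⟩).1 rfl h
    · exact le_of_eq (congrArg t (Subtype.ext (Prod.ext rfl h)))
  have hb : t ⟨(c.1.1, d.1.2), hmem⟩ ≤ t d := by
    rcases h1.lt_or_eq with h | h
    · exact ((ht ⟨_, hmem⟩ d).2 rfl h).le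
    · exact le_of_eq (congrArg t (Subtype.ext (Prod.ext h rfl)))
  exact ha.trans hb

end IsSemistandard

open Classical in
/-- The cells of a semistandard tableau that do not hold the largest letter. -/
noncomputable def belowLast {mu : YoungDiagram} {m : ℕ} (t : mu.cells → Fin (m + 1))
    (ht : IsSemistandard t) : YoungDiagram where
  cells := mu.cells.filter fun c => ∃ h : c ∈ mu.cells, t ⟨c, h⟩ ≠ Fin.last m
  isLowerSet := by
    intro a b hab ha
    simp only [Finset.coe_filter, Set.mem_ofPred_eq] at ha ⊢
    obtain ⟨ha, _, hla⟩ := ha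
    have hb : b ∈ mu.cells := mu.isLowerSet hab ha
    refine ⟨hb, hb, fun h => hla ?_⟩
    have := ht.mono (c := ⟨b, hb⟩) (d := ⟨a, ha⟩) hab.1 hab.2
    rw [h] at this
    exact le_antisymm (Fin.le_last _) this

lemma mem_belowLast {mu : YoungDiagram} {m : ℕ} {t : mu.cells → Fin (m + 1)}
    {ht : IsSemistandard t} {c : ℕ × ℕ} :
    c ∈ belowLast t ht ↔ ∃ h : c ∈ mu.cells, t ⟨c, h⟩ ≠ Fin.last m := by
  rw [← YoungDiagram.mem_cells, belowLast, Finset.mem_filter]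
  exact ⟨fun h => h.2, fun h => ⟨h.1, h⟩⟩

lemma belowLast_mem_horizontalStrips {mu : YoungDiagram} {m : ℕ} (t : mu.cells → Fin (m + 1))
    (ht : IsSemistandard t) : belowLast t ht ∈ horizontalStrips mu := by
  rw [mem_horizontalStrips]
  refine ⟨fun c hc => (mem_belowLast.mp hc).1, fun i j h => mem_belowLast.mpr ?_⟩
  have h' : (i, j) ∈ mu.cells := mu.up_left_mem (Nat.le_succ i) le_rfl h
  refine ⟨h', ((ht ⟨(i, j), h'⟩ ⟨(i + 1, j), h⟩).2 rfl (Nat.lt_succ_self i)).trans_le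
    (Fin.le_last _) |>.ne⟩

/-- Fill the cells outside of `ν` with a new largest letter. -/
noncomputable def fillLast {mu ν : YoungDiagram} {m : ℕ} (t : ν.cells → Fin m) :
    mu.cells → Fin (m + 1) := fun c =>
  if h : c.1 ∈ ν.cells then (t ⟨c.1, h⟩).castSucc else Fin.last m

lemma isSemistandard_fillLast {mu ν : YoungDiagram} (hν : ν ∈ horizontalStrips mu) {m : ℕ}
    {t : ν.cells → Fin m} (ht : IsSemistandard t) :
    IsSemistandard (fillLast t : mu.cells → Fin (m + 1)) := by
  rw [mem_horizontalStrips] at hν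
  intro c d
  constructor
  · intro h1 h2
    by_cases hd : d.1 ∈ ν.cells
    · have hc : c.1 ∈ ν.cells := ν.isLowerSet (show c.1 ≤ d.1 from ⟨h1.le, h2.le⟩) hd
      simp only [fillLast, hd, hc, dif_pos]
      exact (ht ⟨_, hc⟩ ⟨_, hd⟩).1 h1 h2
    · simp only [fillLast, hd, dif_neg, not_false_iff]; exact Fin.le_last _
  · intro h1 h2
    have hc : c.1 ∈ ν.cells := hν.2 c.1.1 c.1.2
      (mu.isLowerSet (show (c.1.1 + 1, c.1.2) ≤ d.1 from ⟨h2, h1.le⟩) d.2)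
    by_cases hd : d.1 ∈ ν.cells
    · simp only [fillLast, hd, hc, dif_pos]
      exact (ht ⟨_, hc⟩ ⟨_, hd⟩).2 h1 h2
    · simp only [fillLast, hd, hc, dif_neg, not_false_iff, dif_pos]; exact Fin.castSucc_lt_last _

lemma belowLast_fillLast {mu ν : YoungDiagram} (hν : ν ∈ horizontalStrips mu) {m : ℕ}
    {t : ν.cells → Fin m} (ht : IsSemistandard t) :
    belowLast (fillLast t : mu.cells → Fin (m + 1)) (isSemistandard_fillLast hν ht) = ν := by
  apply SetLike.ext
  intro c
  rw [mem_belowLast]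
  by_cases hc : c ∈ ν.cells
  · refine ⟨fun _ => hc, fun _ => ⟨(mem_horizontalStrips.mp hν).1 hc, ?_⟩⟩
    simp only [fillLast, hc, dif_pos]
    exact (Fin.castSucc_lt_last _).ne
  · refine ⟨fun ⟨_, h⟩ => absurd ?_ h, fun h => absurd h hc⟩
    simp only [fillLast, hc, dif_neg, not_false_iff]

lemma prod_fillLast {S : Type*} [CommRing S] {mu ν : YoungDiagram} (hν : ν ≤ mu) {m : ℕ}
    (t : ν.cells → Fin m) (x : Fin (m + 1) → S) :
    ∏ c : mu.cells, x (fillLast t c) =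
      x (Fin.last m) ^ (mu.card - ν.card) * ∏ c : ν.cells, x (t c).castSucc := by
  classical
  let G : ℕ × ℕ → S := fun p =>
    if h : p ∈ ν.cells then x (t ⟨p, h⟩).castSucc else x (Fin.last m)
  have hsub : ν.cells ⊆ mu.cells := YoungDiagram.cells_subset_iff.mpr hν
  have h1 : ∏ c : mu.cells, x (fillLast t c) = ∏ p ∈ mu.cells, G p := by
    rw [← Finset.prod_coe_sort mu.cells G]
    refine Finset.prod_congr rfl fun c _ => ?_
    simp only [G, fillLast]
    split_ifs <;> rfl
  have h2 : ∏ c : ν.cells, x (t c).castSucc = ∏ p ∈ ν.cells, G p := by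
    rw [← Finset.prod_coe_sort ν.cells G]
    refine Finset.prod_congr rfl fun c _ => ?_
    simp only [G, c.2, dif_pos]
  rw [h1, h2, ← Finset.prod_sdiff hsub]
  congr 1
  rw [Finset.prod_congr rfl (g := fun _ => x (Fin.last m)), Finset.prod_const,
    Finset.card_sdiff_of_subset hsub]
  · intro p hp
    simp only [G, (Finset.mem_sdiff.mp hp).2, dif_neg, not_false_iff]

/-- The branching rule for Schur polynomials. -/
lemma schur_castSucc {S : Type*} [CommRing S] (mu : YoungDiagram) {m : ℕ} (x : Fin (m + 1) → S) :
    schur mu x = ∑ ν ∈ horizontalStrips mu,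
      x (Fin.last m) ^ (mu.card - ν.card) * schur ν fun i : Fin m => x i.castSucc := by
  classical
  unfold schur
  simp_rw [Finset.mul_sum]
  rw [Finset.sum_sigma']
  symm
  -- A tableau amounts to the subdiagram of cells without the largest letter, together with its
  -- restriction there; column strictness says that the removed cells form a horizontal strip.
  refine Finset.sum_bij (fun p _ => fillLast p.2) ?_ ?_ ?_ ?_
  · rintro ⟨ν, t⟩ h
    simp only [Finset.mem_sigma, Finset.mem_filter, Finset.mem_univ, true_and] at h ⊢
    exact isSemistandard_fillLast h.1 h.2
  · rintro ⟨ν, t⟩ h ⟨ν', t'⟩ h' heq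
    simp only [Finset.mem_sigma, Finset.mem_filter, Finset.mem_univ, true_and] at h h'
    have hν : ν = ν' := by
      rw [← belowLast_fillLast h.1 h.2, ← belowLast_fillLast h'.1 h'.2]
      congr 1
    subst hν
    congr 1
    funext c
    have hc : c.1 ∈ mu.cells := (mem_horizontalStrips.mp h.1).1 c.2
    have := congrFun heq ⟨c.1, hc⟩
    simp only [fillLast, c.2, dif_pos] at this
    exact Fin.castSucc_injective _ this
  · intro t ht
    simp only [Finset.mem_filter, Finset.mem_univ, true_and] at ht
    have hν := belowLast_mem_horizontalStrips t ht
    have hmem : ∀ c : (belowLast t ht).cells, ∃ h : c.1 ∈ mu.cells, t ⟨c.1, h⟩ ≠ Fin.last m :=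
      fun c => mem_belowLast.mp c.2
    refine ⟨⟨belowLast t ht, fun c => (t ⟨c.1, (hmem c).1⟩).castPred (hmem c).2⟩, ?_, ?_⟩
    · simp only [Finset.mem_sigma, Finset.mem_filter, Finset.mem_univ, true_and]
      refine ⟨hν, fun c d => ⟨fun h1 h2 => ?_, fun h1 h2 => ?_⟩⟩
      · exact (ht ⟨c.1, (hmem c).1⟩ ⟨d.1, (hmem d).1⟩).1 h1 h2
      · exact (ht ⟨c.1, (hmem c).1⟩ ⟨d.1, (hmem d).1⟩).2 h1 h2
    · funext c
      simp only [fillLast]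
      split_ifs with h
      · simp
      · by_contra hne
        exact h (mem_belowLast.mpr ⟨c.2, fun h' => hne h'.symm⟩)
  · rintro ⟨ν, t⟩ h
    simp only [Finset.mem_sigma, Finset.mem_filter, Finset.mem_univ, true_and] at h
    exact (prod_fillLast (mem_horizontalStrips.mp h.1).1 t x).symm

open Classical in
lemma schur_fin_zero {S : Type*} [CommRing S] (mu : YoungDiagram) (x : Fin 0 → S) :
    schur mu x = if mu = ⊥ then 1 else 0 := by
  classical
  unfold schur
  split_ifs with h
  · subst h
    have : IsEmpty (⊥ : YoungDiagram).cells := ⟨fun c => YoungDiagram.notMem_bot c.1 c.2⟩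
    rw [Finset.sum_eq_single (fun c => isEmptyElim c)]
    · simp
    · intro t _ ht; exact absurd (Subsingleton.elim _ _) ht
    · intro h; refine absurd ?_ h
      simp only [Finset.mem_filter, Finset.mem_univ, true_and]
      intro c; exact isEmptyElim c
  · apply Finset.sum_eq_zero
    intro t _
    exfalso
    apply h
    apply SetLike.ext
    intro c
    simp only [YoungDiagram.notMem_bot, iff_false]
    intro hc
    exact (t ⟨c, hc⟩).elim0

end Tableaux

/-! ### Both Jacobi–Trudi formulas, by induction on the number of variables. -/

section JacobiTrudi

variable {S : Type*} [CommRing S]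

lemma card_eq_sum_colLen (mu : YoungDiagram) {l : ℕ} (hl : mu.rowLen 0 ≤ l) :
    mu.card = ∑ j : Fin l, mu.colLen j := by
  classical
  rw [Fin.sum_univ_eq_sum_range (fun j => mu.colLen j) l, YoungDiagram.card,
    Finset.card_eq_sum_card_fiberwise (f := Prod.snd) (t := Finset.range l)]
  · refine Finset.sum_congr rfl fun j _ => ?_
    rw [YoungDiagram.colLen_eq_card]; rfl
  · rintro ⟨i, j⟩ hc
    have : (0, j) ∈ mu := mu.up_left_mem (Nat.zero_le i) le_rfl hc
    rw [YoungDiagram.mem_iff_lt_rowLen] at this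
    simp; omega

lemma card_eq_sum_rowLen (mu : YoungDiagram) {l : ℕ} (hl : mu.colLen 0 ≤ l) :
    mu.card = ∑ i : Fin l, mu.rowLen i := by
  have h := card_eq_sum_colLen mu.transpose (l := l) (by simpa using hl)
  simp only [YoungDiagram.colLen_transpose] at h
  rw [← h]
  simp [YoungDiagram.card, YoungDiagram.transpose]

lemma colLen_eq_zero (mu : YoungDiagram) {j : ℕ} (h : mu.rowLen 0 ≤ j) : mu.colLen j = 0 := by
  by_contra hne
  have : (0, j) ∈ mu := YoungDiagram.mem_iff_lt_colLen.mpr (Nat.pos_of_ne_zero hne)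
  rw [YoungDiagram.mem_iff_lt_rowLen] at this
  omega

lemma rowLen_eq_zero (mu : YoungDiagram) {i : ℕ} (h : mu.colLen 0 ≤ i) : mu.rowLen i = 0 := by
  rw [← YoungDiagram.colLen_transpose]
  exact colLen_eq_zero _ (by simpa using h)

lemma ext_colLen {mu ν : YoungDiagram} (h : ∀ j, mu.colLen j = ν.colLen j) : mu = ν := by
  apply SetLike.ext
  rintro ⟨i, j⟩
  rw [YoungDiagram.mem_iff_lt_colLen, YoungDiagram.mem_iff_lt_colLen, h]

lemma ext_rowLen {mu ν : YoungDiagram} (h : ∀ i, mu.rowLen i = ν.rowLen i) : mu = ν := by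
  apply SetLike.ext
  rintro ⟨i, j⟩
  rw [YoungDiagram.mem_iff_lt_rowLen, YoungDiagram.mem_iff_lt_rowLen, h]

lemma colLen_le_colLen {mu ν : YoungDiagram} (h : ν ≤ mu) (j : ℕ) : ν.colLen j ≤ mu.colLen j := by
  by_contra! hlt
  exact absurd (YoungDiagram.mem_iff_lt_colLen.mp (h (YoungDiagram.mem_iff_lt_colLen.mpr hlt)))
    (lt_irrefl _)

lemma rowLen_le_rowLen {mu ν : YoungDiagram} (h : ν ≤ mu) (i : ℕ) : ν.rowLen i ≤ mu.rowLen i := by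
  by_contra! hlt
  exact absurd (YoungDiagram.mem_iff_lt_rowLen.mp (h (YoungDiagram.mem_iff_lt_rowLen.mpr hlt)))
    (lt_irrefl _)

/-- The Young diagram with prescribed row lengths. -/
def ofRowLen (f : ℕ → ℕ) (hf : Antitone f) (l : ℕ) : YoungDiagram where
  cells := (Finset.range l ×ˢ Finset.range (f 0)).filter fun c => c.2 < f c.1
  isLowerSet := by
    rintro ⟨i, j⟩ ⟨i', j'⟩ hab ha
    simp only [Finset.coe_filter, Set.mem_ofPred_eq, Finset.mem_product, Finset.mem_range] at ha ⊢
    obtain ⟨h1, h2⟩ := hab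
    simp only at h1 h2
    have := hf h1
    omega

lemma rowLen_ofRowLen (f : ℕ → ℕ) (hf : Antitone f) (l : ℕ) (hl : f l = 0) (i : ℕ) :
    (ofRowLen f hf l).rowLen i = f i := by
  have key : ∀ j, j < (ofRowLen f hf l).rowLen i ↔ j < f i := by
    intro j
    rw [← YoungDiagram.mem_iff_lt_rowLen, ← YoungDiagram.mem_cells, ofRowLen]
    simp only [Finset.mem_filter, Finset.mem_product, Finset.mem_range]
    refine ⟨fun h => h.2, fun h => ⟨⟨?_, h.trans_le (hf (Nat.zero_le i))⟩, h⟩⟩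
    by_contra! hli
    have := hf hli
    omega
  exact eq_of_forall_lt_iff key

lemma exists_rowLen_eq (f : ℕ → ℕ) (hf : Antitone f) (l : ℕ) (hl : f l = 0) :
    ∃ ν : YoungDiagram, ∀ i, ν.rowLen i = f i :=
  ⟨ofRowLen f hf l, rowLen_ofRowLen f hf l hl⟩

lemma exists_colLen_eq (f : ℕ → ℕ) (hf : Antitone f) (l : ℕ) (hl : f l = 0) :
    ∃ ν : YoungDiagram, ∀ j, ν.colLen j = f j :=
  ⟨(ofRowLen f hf l).transpose, fun j => by
    rw [YoungDiagram.colLen_transpose, rowLen_ofRowLen f hf l hl]⟩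

/-- In this form a strip is a set of columns that lose one cell, to be matched with the sets `s` of
`det_toeplitz_mul_one_add`. -/
lemma mem_horizontalStrips_iff_colLen {mu ν : YoungDiagram} :
    ν ∈ horizontalStrips mu ↔
      ∀ j, ν.colLen j ≤ mu.colLen j ∧ mu.colLen j ≤ ν.colLen j + 1 := by
  rw [mem_horizontalStrips]
  constructor
  · rintro ⟨h1, h2⟩ j
    refine ⟨colLen_le_colLen h1 j, ?_⟩
    by_contra! hlt
    have := h2 (ν.colLen j) j (YoungDiagram.mem_iff_lt_colLen.mpr hlt)
    rw [YoungDiagram.mem_iff_lt_colLen] at this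
    omega
  · intro h
    refine ⟨?_, ?_⟩
    · rintro ⟨i, j⟩ hc
      have hc' := YoungDiagram.mem_iff_lt_colLen.mp hc
      exact YoungDiagram.mem_iff_lt_colLen.mpr (hc'.trans_le (h j).1)
    · intro i j hc
      rw [YoungDiagram.mem_iff_lt_colLen] at hc ⊢
      have := (h j).2
      omega

/-- Interlacing of rows is the index range in `det_toeplitz_mul_geomSeries`. -/
lemma mem_horizontalStrips_iff_rowLen {mu ν : YoungDiagram} :
    ν ∈ horizontalStrips mu ↔
      ∀ i, ν.rowLen i ≤ mu.rowLen i ∧ mu.rowLen (i + 1) ≤ ν.rowLen i := by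
  rw [mem_horizontalStrips]
  constructor
  · rintro ⟨h1, h2⟩ i
    refine ⟨rowLen_le_rowLen h1 i, ?_⟩
    by_contra! hlt
    have := h2 i (ν.rowLen i) (YoungDiagram.mem_iff_lt_rowLen.mpr hlt)
    rw [YoungDiagram.mem_iff_lt_rowLen] at this
    omega
  · intro h
    refine ⟨?_, ?_⟩
    · rintro ⟨i, j⟩ hc
      have hc' := YoungDiagram.mem_iff_lt_rowLen.mp hc
      exact YoungDiagram.mem_iff_lt_rowLen.mpr (hc'.trans_le (h i).1)
    · intro i j hc
      rw [YoungDiagram.mem_iff_lt_rowLen] at hc ⊢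
      have := (h i).2
      omega

lemma det_toeplitz_one {l : ℕ} (c : ℕ → ℕ) (hc : ∀ i, c i = 0) :
    (toeplitz (1 : PowerSeries S) fun i : Fin l => (c i : ℤ) - (i : ℕ)).det = 1 := by
  have : toeplitz (1 : PowerSeries S) (fun i : Fin l => (c i : ℤ) - (i : ℕ)) = 1 := by
    ext i j
    simp only [toeplitz, Matrix.of_apply, hc, Matrix.one_apply]
    split_ifs with h
    · subst h; simp [zcoeff]
    · have : (i : ℕ) ≠ j := fun h' => h (Fin.ext h')
      unfold zcoeff
      split_ifs with h2
      · rw [PowerSeries.coeff_one, if_neg (by omega)]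
      · rfl
  rw [this, Matrix.det_one]

lemma det_toeplitz_one_eq_zero {l : ℕ} (hl : 0 < l) (c : ℕ → ℕ) (hc : 0 < c 0) :
    (toeplitz (1 : PowerSeries S) fun i : Fin l => (c i : ℤ) - (i : ℕ)).det = 0 := by
  refine Matrix.det_eq_zero_of_row_eq_zero ⟨0, hl⟩ fun j => ?_
  simp only [toeplitz, Matrix.of_apply, zcoeff]
  rw [if_pos (by push_cast; omega), PowerSeries.coeff_one, if_neg (by push_cast; omega)]

/-- The dual Jacobi–Trudi formula. -/
lemma schur_eq_det_genE (mu : YoungDiagram) {m : ℕ} (x : Fin m → S) {l : ℕ}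
    (hl : mu.rowLen 0 ≤ l) :
    schur mu x = (toeplitz (genE x) fun i : Fin l => (mu.colLen i : ℤ) - (i : ℕ)).det := by
  classical
  induction m generalizing mu with
  | zero =>
    have hE : genE x = 1 := by simp [genE]
    rw [schur_fin_zero, hE]
    split_ifs with h
    · subst h
      rw [det_toeplitz_one (c := (⊥ : YoungDiagram).colLen)]
      intro i
      by_contra hne
      exact YoungDiagram.notMem_bot _
        (YoungDiagram.mem_iff_lt_colLen.mpr (Nat.pos_of_ne_zero hne))
    · have h0 : (0, 0) ∈ mu := by
        by_contra h0
        apply h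
        apply SetLike.ext
        rintro ⟨i, j⟩
        simp only [YoungDiagram.notMem_bot, iff_false]
        exact fun hc => h0 (mu.up_left_mem (Nat.zero_le i) (Nat.zero_le j) hc)
      rw [det_toeplitz_one_eq_zero _ mu.colLen (YoungDiagram.mem_iff_lt_colLen.mp h0)]
      have := YoungDiagram.mem_iff_lt_rowLen.mp h0
      omega
  | succ m ih =>
    rw [schur_castSucc, genE_castSucc, det_toeplitz_mul_one_add]
    refine Finset.sum_of_injOn
      (fun ν => Finset.univ.filter fun j : Fin l => ν.colLen j < mu.colLen j) ?_ ?_ ?_ ?_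
    · intro ν hν ν' hν' heq
      have hν := mem_horizontalStrips_iff_colLen.mp hν
      have hν' := mem_horizontalStrips_iff_colLen.mp hν'
      refine ext_colLen fun j => ?_
      rcases Nat.lt_or_ge j l with hj | hj
      · have := Finset.ext_iff.mp heq ⟨j, hj⟩
        simp only [Finset.mem_filter, Finset.mem_univ, true_and] at this
        have h1 := hν j
        have h2 := hν' j
        omega
      · have h1 := hν j
        have h2 := hν' j
        have := colLen_eq_zero mu (hl.trans hj)
        omega
    · intro ν _; simp
    · intro s _ hs
      -- A set of columns that does not come from a strip lowers some column but not the equally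
      -- long next one, and its determinant vanishes.
      by_cases hbad : ∃ j ∈ s, mu.colLen j = mu.colLen (j + 1) ∧ ∀ j' ∈ s, (j' : ℕ) ≠ j + 1
      · obtain ⟨j, hj, hcj, hsj⟩ := hbad
        rw [det_toeplitz_sub_eq_zero _ mu.colLen (colLen_eq_zero _ hl) s j hj hcj hsj, mul_zero]
      · exfalso
        apply hs
        push Not at hbad
        let T : Finset ℕ := s.map Fin.valEmbedding
        have hT : ∀ i : Fin l, (i : ℕ) ∈ T ↔ i ∈ s := fun i => by
          simp [T, Finset.mem_map, Fin.val_inj]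
        -- If an empty column were lowered, `hbad` would force all later columns, also empty, to be
        -- lowered too, beyond the `l` available.
        have hpos : ∀ j ∈ T, 0 < mu.colLen j := by
          by_contra! h
          obtain ⟨j, hj, h0⟩ := h
          obtain ⟨i, hi, rfl⟩ := Finset.mem_map.mp hj
          have key : ∀ d, ∃ i' ∈ s, (i' : ℕ) = i + d := by
            intro d
            induction d with
            | zero => exact ⟨i, hi, rfl⟩
            | succ d ihd =>
              obtain ⟨i', hi', he⟩ := ihd
              have ha := mu.colLen_anti i i' (by omega)
              have hb := mu.colLen_anti i' (i' + 1) (by omega)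
              simp only [Fin.valEmbedding_apply] at h0
              obtain ⟨i'', h1, h2⟩ := hbad i' hi' (by omega)
              exact ⟨i'', h1, by omega⟩
          obtain ⟨i', _, he⟩ := key l
          omega
        have hstep : ∀ j ∈ T, mu.colLen j = mu.colLen (j + 1) → j + 1 ∈ T := by
          intro j hj hc
          obtain ⟨i, hi, rfl⟩ := Finset.mem_map.mp hj
          obtain ⟨i', h1, h2⟩ := hbad i hi hc
          exact Finset.mem_map.mpr ⟨i', h1, by simpa using h2⟩
        obtain ⟨ν, hν⟩ := exists_colLen_eq (fun j => mu.colLen j - if j ∈ T then 1 else 0)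
          (by
            refine antitone_nat_of_succ_le fun j => ?_
            have h1 := mu.colLen_anti j (j + 1) (Nat.le_succ j)
            have h2 := hstep j
            split_ifs with h3 h4 h4
            · omega
            · omega
            · have : mu.colLen j ≠ mu.colLen (j + 1) := fun he => h3 (h2 h4 he)
              omega
            · omega) l (by simp [colLen_eq_zero _ hl])
        refine ⟨ν, mem_horizontalStrips_iff_colLen.mpr fun j => ?_, ?_⟩
        · rw [hν]; split_ifs <;> omega
        · ext i
          simp only [Finset.mem_filter, Finset.mem_univ, true_and]
          rw [hν, ← hT]
          split_ifs with h
          · have := hpos _ h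
            simp only [h, iff_true]; omega
          · simp only [h, iff_false]; omega
    · intro ν hν
      have hν' := mem_horizontalStrips_iff_colLen.mp hν
      have hle := (mem_horizontalStrips.mp hν).1
      have hlν : ν.rowLen 0 ≤ l := (rowLen_le_rowLen hle 0).trans hl
      rw [ih ν _ hlν]
      have hcol : ∀ j : Fin l, mu.colLen j = ν.colLen j +
          if j ∈ Finset.univ.filter (fun j : Fin l => ν.colLen j < mu.colLen j) then 1 else 0 := by
        intro j
        have := hν' j
        simp only [Finset.mem_filter, Finset.mem_univ, true_and]
        split_ifs <;> omega
      congr 2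
      · rw [card_eq_sum_colLen mu hl, card_eq_sum_colLen ν hlν,
          Finset.sum_congr rfl fun j _ => hcol j, Finset.sum_add_distrib]
        simp
      · congr 1
        funext j
        have := hcol j
        rw [this]
        push_cast
        ring

/-- The Jacobi–Trudi formula. -/
lemma schur_eq_det_genH (mu : YoungDiagram) {m : ℕ} (x : Fin m → S) {l : ℕ}
    (hl : mu.colLen 0 ≤ l) :
    schur mu x = (toeplitz (genH x) fun i : Fin l => (mu.rowLen i : ℤ) - (i : ℕ)).det := by
  classical
  induction m generalizing mu with
  | zero =>
    have hH : genH x = 1 := by simp [genH]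
    rw [schur_fin_zero, hH]
    split_ifs with h
    · subst h
      rw [det_toeplitz_one (c := (⊥ : YoungDiagram).rowLen)]
      intro i
      by_contra hne
      exact YoungDiagram.notMem_bot _
        (YoungDiagram.mem_iff_lt_rowLen.mpr (Nat.pos_of_ne_zero hne))
    · have h0 : (0, 0) ∈ mu := by
        by_contra h0
        apply h
        apply SetLike.ext
        rintro ⟨i, j⟩
        simp only [YoungDiagram.notMem_bot, iff_false]
        exact fun hc => h0 (mu.up_left_mem (Nat.zero_le i) (Nat.zero_le j) hc)
      rw [det_toeplitz_one_eq_zero _ mu.rowLen (YoungDiagram.mem_iff_lt_rowLen.mp h0)]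
      have := YoungDiagram.mem_iff_lt_colLen.mp h0
      omega
  | succ m ih =>
    rw [schur_castSucc, genH_castSucc, det_toeplitz_mul_geomSeries _ _ mu.rowLen
      (fun i j h => mu.rowLen_anti i j h) (rowLen_eq_zero _ hl)]
    -- Unlike in the dual formula, every term comes from a strip, so no vanishing determinants are
    -- needed.
    refine Finset.sum_of_injOn (fun ν => fun i : Fin l => ν.rowLen i) ?_ ?_ ?_ ?_
    · intro ν hν ν' hν' heq
      have hν := mem_horizontalStrips_iff_rowLen.mp hν
      have hν' := mem_horizontalStrips_iff_rowLen.mp hν'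
      refine ext_rowLen fun i => ?_
      rcases Nat.lt_or_ge i l with hi | hi
      · exact congrFun heq ⟨i, hi⟩
      · have h1 := hν i
        have h2 := hν' i
        have := rowLen_eq_zero mu (hl.trans hi)
        omega
    · intro ν hν
      have hν := mem_horizontalStrips_iff_rowLen.mp hν
      simp only [Finset.mem_coe, Fintype.mem_piFinset, Finset.mem_Icc]
      exact fun i => ⟨(hν i).2, (hν i).1⟩
    · intro v hv hs
      exfalso
      apply hs
      simp only [Fintype.mem_piFinset, Finset.mem_Icc] at hv
      obtain ⟨ν, hν⟩ := exists_rowLen_eq (fun i => if h : i < l then v ⟨i, h⟩ else 0)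
        (by
          refine antitone_nat_of_succ_le fun i => ?_
          split_ifs with h1 h2 h2
          · exact (hv ⟨i + 1, h1⟩).2.trans (hv ⟨i, h2⟩).1
          · omega
          · omega
          · omega) l (by simp)
      refine ⟨ν, mem_horizontalStrips_iff_rowLen.mpr fun i => ?_, ?_⟩
      · rw [hν]
        split_ifs with h
        · exact ⟨(hv ⟨i, h⟩).2, (hv ⟨i, h⟩).1⟩
        · have := rowLen_eq_zero mu (i := i + 1) (by omega)
          omega
      · funext i
        simp [hν]
    · intro ν hν
      have hν' := mem_horizontalStrips_iff_rowLen.mp hν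
      have hle := (mem_horizontalStrips.mp hν).1
      have hlν : ν.colLen 0 ≤ l := (colLen_le_colLen hle 0).trans hl
      rw [ih ν _ hlν]
      congr 2
      rw [card_eq_sum_rowLen mu hl, card_eq_sum_rowLen ν hlν, ← Finset.sum_tsub_distrib]
      exact fun i _ => (hν' i).1

end JacobiTrudi

/-! ### Hops and `e_r(𝒜)` acting on coefficients. -/

section Coefficients

variable {n : ℕ}

/-- The coefficients of a state, extended by zero to all integer tuples. -/
noncomputable def extCoeff (f : States n) (M : Fin n → ℤ) : Scalars :=
  if ∀ i, 0 ≤ M i then f (fun i => (M i).toNat) else 0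

lemma extCoeff_natCast (f : States n) (m : Fin n → ℕ) : extCoeff f (fun i => (m i : ℤ)) = f m := by
  simp [extCoeff]

lemma extCoeff_of_neg (f : States n) {M : Fin n → ℤ} {i : Fin n} (h : M i < 0) :
    extCoeff f M = 0 := by
  rw [extCoeff, if_neg]
  intro h'
  exact absurd (h' i) (not_le.mpr h)

lemma exists_natCast_eq {M : Fin n → ℤ} (h : ∀ i, 0 ≤ M i) :
    ∃ m : Fin n → ℕ, M = fun i => (m i : ℤ) :=
  ⟨fun i => (M i).toNat, funext fun i => (Int.toNat_of_nonneg (h i)).symm⟩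

lemma extCoeff_add (f g : States n) (M : Fin n → ℤ) :
    extCoeff (f + g) M = extCoeff f M + extCoeff g M := by
  unfold extCoeff; split_ifs <;> simp

lemma extCoeff_smul (c : Scalars) (f : States n) (M : Fin n → ℤ) :
    extCoeff (c • f) M = c * extCoeff f M := by
  unfold extCoeff; split_ifs <;> simp

lemma extCoeff_zero (M : Fin n → ℤ) : extCoeff (0 : States n) M = 0 := by
  unfold extCoeff; split_ifs <;> simp

lemma extCoeff_single (m : Fin n → ℕ) (c : Scalars) (M : Fin n → ℤ) :
    extCoeff (Finsupp.single m c) M = if M = fun i => (m i : ℤ) then c else 0 := by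
  classical
  unfold extCoeff
  split_ifs with h1 h2 h2
  · subst h2; simp
  · rw [Finsupp.single_apply, if_neg]
    rintro rfl
    exact h2 (funext fun i => (Int.toNat_of_nonneg (h1 i)).symm)
  · subst h2; exact absurd (fun i => Int.natCast_nonneg _) h1
  · rfl

lemma extCoeff_creation (i : Fin n) (f : States n) (M : Fin n → ℤ) :
    extCoeff (creation i f) M = extCoeff f (M - Pi.single i 1) := by
  induction f using Finsupp.induction_linear with
  | zero => simp [extCoeff_zero]
  | add f g hf hg => rw [map_add, extCoeff_add, extCoeff_add, hf, hg]
  | single m c =>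
    rw [creation, Finsupp.linearCombination_single, extCoeff_smul, extCoeff_single,
      extCoeff_single, mul_ite, mul_one, mul_zero]
    congr 1
    rw [eq_iff_iff, sub_eq_iff_eq_add]
    have : (fun j => ((m + Pi.single i 1 : Fin n → ℕ) j : ℤ) : Fin n → ℤ) =
        (fun j => (m j : ℤ)) + Pi.single i 1 := by
      funext j
      simp [Pi.single_apply]
    rw [this]

lemma annihilation_apply (i : Fin n) (f : States n) (m : Fin n → ℕ) :
    annihilation i f m = f (m + Pi.single i 1) := by
  classical
  induction f using Finsupp.induction_linear with
  | zero => simp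
  | add f g hf hg => rw [map_add, Finsupp.add_apply, Finsupp.add_apply, hf, hg]
  | single m' c =>
    rw [annihilation, Finsupp.linearCombination_single, Finsupp.single_apply]
    split_ifs with h1 h2 h2
    · subst h2
      simp
    · rw [Finsupp.smul_apply, Finsupp.single_apply, if_neg, smul_zero]
      rintro rfl
      apply h2
      funext j
      by_cases hj : j = i
      · subst hj; simp; omega
      · simp [hj]
    · subst h2; simp at h1
    · simp

lemma extCoeff_annihilation (i : Fin n) (f : States n) {M : Fin n → ℤ} (hM : ∀ j, 0 ≤ M j) :
    extCoeff (annihilation i f) M = extCoeff f (M + Pi.single i 1) := by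
  obtain ⟨m, rfl⟩ := exists_natCast_eq hM
  rw [extCoeff_natCast, annihilation_apply, ← extCoeff_natCast]
  congr 1
  funext j
  simp [Pi.single_apply]

variable [NeZero n]

/-- The weight of the hop from site `i`. -/
noncomputable def hopWeight (i : Fin n) : Scalars := if i = 0 then zVar n else 1

/-- Extension by zero absorbs the case of an empty target site. The hypothesis excludes `n = 1`,
where a hop kills the empty site although its shift is zero. -/
lemma hop_apply {i : Fin n} (hi : i + 1 ≠ i) (f : States n) (m : Fin n → ℕ) :
    hop i f m = hopWeight i *
      extCoeff f ((fun j => (m j : ℤ)) - (Pi.single (i + 1) 1 - Pi.single i 1)) := by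
  have key : (creation (i + 1) * annihilation i : Module.End Scalars (States n)) f m =
      extCoeff f ((fun j => (m j : ℤ)) - (Pi.single (i + 1) 1 - Pi.single i 1)) := by
    rw [Module.End.mul_apply, ← extCoeff_natCast, extCoeff_creation]
    rcases Nat.eq_zero_or_pos (m (i + 1)) with h | h
    · rw [extCoeff_of_neg (i := i + 1), extCoeff_of_neg (i := i + 1)]
      · simp [h, hi]
      · simp [h]
    · rw [extCoeff_annihilation, sub_sub_eq_add_sub, sub_add_eq_add_sub]
      intro j
      by_cases hj : j = i + 1
      · subst hj; simp; omega
      · simp [hj]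
  unfold hop hopWeight
  split_ifs with h
  · rw [← key, LinearMap.smul_apply, Finsupp.smul_apply, smul_eq_mul]
  · rw [← key, one_mul]

/-- Shifts compose freely once it is known that an intermediate tuple that is negative stays
negative. It can be negative only at `a + 1`, and by the order condition no remaining hop enters or
leaves that site. -/
lemma prod_hop_apply (l : List (Fin n)) (hl : l.Pairwise fun a b => a ≠ b ∧ b ≠ a + 1)
    (hl' : ∀ i ∈ l, i + 1 ≠ i) (f : States n) (m : Fin n → ℕ) :
    (l.map hop).prod f m = (l.map hopWeight).prod *
      extCoeff f ((fun j => (m j : ℤ)) -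
        (l.map fun i => (Pi.single (i + 1) 1 - Pi.single i 1 : Fin n → ℤ)).sum) := by
  induction l generalizing m with
  | nil => simp [extCoeff_natCast]
  | cons a l ih =>
    rw [List.pairwise_cons] at hl
    have ha : a + 1 ≠ a := hl' a (by simp)
    simp only [List.map_cons, List.prod_cons, List.sum_cons]
    rw [Module.End.mul_apply, hop_apply ha, mul_assoc]
    congr 1
    by_cases h0 : ∀ j, 0 ≤ ((fun j => (m j : ℤ)) -
        (Pi.single (a + 1) 1 - Pi.single a 1) : Fin n → ℤ) j
    · obtain ⟨m', hm'⟩ := exists_natCast_eq h0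
      rw [← sub_sub, hm', extCoeff_natCast, ih hl.2 (fun i hi => hl' i (by simp [hi]))]
    · have hsum : (l.map fun i => (Pi.single (i + 1) 1 - Pi.single i 1 : Fin n → ℤ)).sum (a + 1)
          = 0 := by
        refine (map_list_sum (Pi.evalAddMonoidHom (fun _ : Fin n => ℤ) (a + 1)) _).trans ?_
        rw [List.map_map]
        apply List.sum_eq_zero
        intro x hx
        obtain ⟨i, hi, rfl⟩ := List.mem_map.mp hx
        have h1 := hl.1 i hi
        have h2 : a + 1 ≠ i + 1 := fun h => h1.1 (add_right_cancel h)
        simp [h2, h1.2.symm]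
      have hneg : ((fun j => (m j : ℤ)) -
          (Pi.single (a + 1) 1 - Pi.single a 1) : Fin n → ℤ) (a + 1) < 0 := by
        push Not at h0
        obtain ⟨j, hj⟩ := h0
        by_cases hja : j = a + 1
        · rw [← hja]; rw [← hja] at hj; exact hj
        · exfalso
          simp only [Pi.sub_apply, Pi.single_apply, hja, if_false] at hj
          split_ifs at hj <;> omega
      rw [extCoeff_of_neg _ hneg, extCoeff_of_neg (i := a + 1), mul_zero]
      rw [← sub_sub, Pi.sub_apply, hsum, sub_zero]
      exact hneg

/-- The change of occupation numbers by the hops from the sites in `I`. -/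
def hopShift (I : Finset (Fin n)) : Fin n → ℤ :=
  ∑ i ∈ I, (Pi.single (i + 1) 1 - Pi.single i 1)

lemma hopShift_apply (I : Finset (Fin n)) (j : Fin n) :
    hopShift I (j + 1) = (if j ∈ I then 1 else 0) - (if j + 1 ∈ I then 1 else 0) := by
  simp [hopShift, Finset.sum_apply, Pi.single_apply]

lemma exists_add_one (j : Fin n) : ∃ i : Fin n, j = i + 1 := ⟨j - 1, by simp⟩

lemma hopShift_compl (I : Finset (Fin n)) : hopShift Iᶜ = - hopShift I := by
  funext j
  obtain ⟨j, rfl⟩ := exists_add_one j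
  rw [Pi.neg_apply, hopShift_apply, hopShift_apply]
  simp only [Finset.mem_compl]
  split_ifs <;> simp_all

lemma hopShift_univ : hopShift (Finset.univ : Finset (Fin n)) = 0 := by
  funext j
  obtain ⟨j, rfl⟩ := exists_add_one j
  rw [hopShift_apply]
  simp

lemma prod_anticlockwise_apply (I : Finset (Fin n)) (hI : Iᶜ.Nonempty) (f : States n)
    (m : Fin n → ℕ) :
    ((anticlockwise I).map hop).prod f m = (if 0 ∈ I then zVar n else 1) *
      extCoeff f ((fun j => (m j : ℤ)) - hopShift I) := by
  classical
  set p := Iᶜ.min' hI with hp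
  have hpI : p ∉ I := Finset.mem_compl.mp (Finset.min'_mem _ _)
  have hl : anticlockwise I = (List.ofFn fun d : Fin n => p - (d + 1)).filter (· ∈ I) := by
    rw [anticlockwise, dif_pos hI]
  have hmem : ∀ i, i ∈ anticlockwise I ↔ i ∈ I := by
    intro i
    rw [hl, List.mem_filter, List.mem_ofFn]
    simp only [decide_eq_true_eq, and_iff_right_iff_imp]
    intro _
    exact ⟨p - i - 1, by simp⟩
  have hpw : (anticlockwise I).Pairwise fun a b => a ≠ b ∧ b ≠ a + 1 := by
    rw [hl, List.pairwise_filter, List.pairwise_ofFn]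
    intro d d' hdd ha hb
    refine ⟨fun h => ?_, fun h => ?_⟩
    · have := add_right_cancel (sub_right_injective h)
      exact hdd.ne this
    · have h1 : d = d' + 1 := by
        have h2 : p - (d' + 1) = p - d := by rw [h]; abel
        exact (sub_right_injective h2).symm
      -- `d = d' + 1` with `d < d'` happens only by wrapping around, and then the second element
      -- would be `p` itself, which is not in `I`.
      have h3 : d = 0 := by
        by_contra hne
        have hlt : (d' : ℕ) + 1 < n ∨ (d' : ℕ) + 1 = n := by omega
        rcases hlt with hlt | heq
        · have : ((d' + 1 : Fin n) : ℕ) = d' + 1 := Fin.val_add_one_of_lt' hlt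
          rw [← h1] at this
          have : (d : ℕ) < d' := hdd
          omega
        · apply hne
          rw [h1]
          apply Fin.ext
          rw [Fin.val_add, Fin.val_one', Nat.add_mod_mod, heq, Nat.mod_self, Fin.val_zero]
      rw [← h1, h3, sub_zero] at hb
      exact hpI (by simpa using hb)
  have hne : ∀ i ∈ anticlockwise I, i + 1 ≠ i := by
    intro i hi h
    have h1 : (1 : Fin n) = 0 := by simpa using h
    have hsub : ∀ j : Fin n, j = 0 := fun j => by
      rw [← mul_one j, h1, mul_zero]
    apply hpI
    rw [hsub p, ← hsub i]
    exact (hmem i).mp hi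
  have hnd : (anticlockwise I).Nodup := hpw.imp fun h => h.1
  have hfin : (anticlockwise I).toFinset = I := by
    ext i; rw [List.mem_toFinset, hmem]
  rw [prod_hop_apply _ hpw hne, ← List.prod_toFinset _ hnd, ← List.sum_toFinset _ hnd, hfin,
    hopShift]
  congr 1
  unfold hopWeight
  rw [Finset.prod_ite_eq']

/-- The convention `e_n = z` fits the subset formula: the full set contains `0` and has shift zero.
For `r > n` there are no subsets. -/
lemma elemA_apply (r : ℕ) (f : States n) (m : Fin n → ℕ) :
    elemA n r f m = ∑ I ∈ (Finset.univ : Finset (Fin n)).powersetCard r,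
      (if 0 ∈ I then zVar n else 1) * extCoeff f ((fun j => (m j : ℤ)) - hopShift I) := by
  rw [elemA, if_neg (by omega)]
  split_ifs with h
  · have h' : r = n := by exact_mod_cast h
    have : (Finset.univ : Finset (Fin n)).powersetCard r = {Finset.univ} := by
      ext I
      rw [Finset.mem_powersetCard, Finset.mem_singleton, ← Finset.card_eq_iff_eq_univ,
        Fintype.card_fin, h']
      simp
    rw [this]
    simp [hopShift_univ, extCoeff_natCast]
  · rw [LinearMap.sum_apply, Finsupp.finsetSum_apply]
    refine Finset.sum_congr rfl fun I hI => prod_anticlockwise_apply I ?_ f m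
    rw [Finset.mem_powersetCard] at hI
    rw [Finset.nonempty_iff_ne_empty, Ne, Finset.compl_eq_empty_iff]
    rintro rfl
    apply h
    rw [← hI.2]; simp

end Coefficients

/-! ### Bethe vector coefficients as determinants. -/

section BetheCoefficients

variable {n : ℕ} [NeZero n]

/-- The conjugate partition of a configuration: the number of particles at the sites
`j + 1, …, n`. -/
def conj (M : Fin n → ℤ) (j : ℕ) : ℤ := ∑ i : Fin n, if j ≤ i then M (i + 1) else 0

lemma conj_zero (M : Fin n → ℤ) : conj M 0 = ∑ i, M i := by
  simp only [conj, Nat.zero_le, if_true]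
  exact Fintype.sum_equiv (Equiv.addRight 1) _ _ fun i => rfl

lemma conj_eq_zero (M : Fin n → ℤ) {j : ℕ} (h : n ≤ j) : conj M j = 0 := by
  unfold conj
  refine Finset.sum_eq_zero fun i _ => if_neg ?_
  omega

lemma conj_eq_add (M : Fin n → ℤ) (j : Fin n) : conj M j = M (j + 1) + conj M (j + 1 : ℕ) := by
  have : M (j + 1) = ∑ i : Fin n, if j = i then M (i + 1) else 0 := by simp
  rw [this, conj, conj, ← Finset.sum_add_distrib]
  refine Finset.sum_congr rfl fun i _ => ?_
  have h3 : j = i ↔ (j : ℕ) = i := Fin.ext_iff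
  simp only [h3]
  split_ifs <;> omega

lemma conj_add_single (M : Fin n → ℤ) (r : Fin n) (c : ℤ) (j : ℕ) :
    conj (M + Pi.single (r + 1) c) j = conj M j + if j ≤ r then c else 0 := by
  simp only [conj, Pi.add_apply]
  have : ∀ i : Fin n, (if j ≤ (i : ℕ) then M (i + 1) + (Pi.single (r + 1) c : Fin n → ℤ) (i + 1)
      else 0) = (if j ≤ (i : ℕ) then M (i + 1) else 0) +
        if i = r then (if j ≤ (r : ℕ) then c else 0) else 0 := by
    intro i
    simp only [Pi.single_apply, add_left_inj]
    by_cases h : i = r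
    · subst h; simp; split_ifs <;> simp
    · simp [h]
  simp [this, Finset.sum_add_distrib]

section

variable {S : Type*} [CommRing S]

lemma zcoeff_genE_of_gt {k : ℕ} (y : Fin k → S) {r : ℤ} (hr : (k : ℤ) < r) :
    zcoeff (genE y) r = 0 := by
  induction k generalizing r with
  | zero =>
    rw [zcoeff]
    have : genE y = 1 := by simp [genE]
    rw [this, if_pos (by omega), PowerSeries.coeff_one, if_neg (by omega)]
  | succ k ih =>
    push_cast at hr
    rw [genE_castSucc, zcoeff_mul_one_add, ih _ (by omega), ih _ (by omega)]
    simp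

/-- Additivity of the determinant in one row. -/
lemma det_eq_add_mul_det {l : ℕ} (r : Fin l) (u : S) (A B C : Matrix (Fin l) (Fin l) S)
    (hB : ∀ i, i ≠ r → ∀ j, B i j = A i j) (hC : ∀ i, i ≠ r → ∀ j, C i j = A i j)
    (hr : ∀ j, A r j = B r j + u * C r j) : A.det = B.det + u * C.det := by
  have hA : A = A.updateRow r (B r + u • C r) := by
    ext i j
    by_cases h : i = r
    · subst h; simp [hr]
    · simp [h]
  have hB' : A.updateRow r (B r) = B := by
    ext i j
    by_cases h : i = r
    · subst h; simp
    · simp [h, hB]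
  have hC' : A.updateRow r (C r) = C := by
    ext i j
    by_cases h : i = r
    · subst h; simp
    · simp [h, hC]
  rw [hA, Matrix.det_updateRow_add, Matrix.det_updateRow_smul, hB', hC']

/-- The determinant with the first `r` rows taken from `P'` and shifted by `a`, the others taken
from `P`. -/
noncomputable def mixedDet (P' P : PowerSeries S) (r : ℕ) (a : ℤ) (M : Fin n → ℤ) : S :=
  (Matrix.of fun i j : Fin n => if (i : ℕ) < r then zcoeff P' (conj M i + a - (i : ℕ) + (j : ℕ))
    else zcoeff P (conj M i - (i : ℕ) + (j : ℕ))).det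

/-- Only row `r` passes from `P` to the new series, and it splits in two. The index shifts of rows
`0, …, r` are absorbed in the occupation of one site, since changing it by `c` changes `conj` by `c`
in exactly these rows. The cases `a = 0, 1` are the two rows of the Lax matrix. -/
lemma mixedDet_succ (P : PowerSeries S) (u : S) {r : ℕ} (hr : r < n) (a : ℤ) (M : Fin n → ℤ) :
    mixedDet (P * (1 + PowerSeries.C u * PowerSeries.X)) P (r + 1) a M =
      mixedDet (P * (1 + PowerSeries.C u * PowerSeries.X)) P r 0
        (M + Pi.single (⟨r, hr⟩ + 1) a) +
      u * mixedDet (P * (1 + PowerSeries.C u * PowerSeries.X)) P r 1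
        (M + Pi.single (⟨r, hr⟩ + 1) (a - 1)) := by
  refine det_eq_add_mul_det ⟨r, hr⟩ u _ _ _ ?_ ?_ ?_
  · intro i hi j
    have : (i : ℕ) ≠ r := fun h => hi (Fin.ext h)
    simp only [Matrix.of_apply, conj_add_single]
    rcases Nat.lt_or_gt_of_ne this with h | h
    · rw [if_pos h, if_pos h.le, if_pos (Nat.lt_succ_of_lt h)]
      ring_nf
    · rw [if_neg (by omega), if_neg (by omega), if_neg (by omega), add_zero]
  · intro i hi j
    have : (i : ℕ) ≠ r := fun h => hi (Fin.ext h)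
    simp only [Matrix.of_apply, conj_add_single]
    rcases Nat.lt_or_gt_of_ne this with h | h
    · rw [if_pos h, if_pos h.le, if_pos (Nat.lt_succ_of_lt h)]
      ring_nf
    · rw [if_neg (by omega), if_neg (by omega), if_neg (by omega), add_zero]
  · intro j
    simp only [Matrix.of_apply, conj_add_single, lt_irrefl, if_false, le_refl, if_true,
      Nat.lt_succ_self, zcoeff_mul_one_add]
    congr 2
    congr 1
    ring

/-- Row `r` then repeats row `r + 1`, or is zero if it is the last one. This reflects that creation
never produces an empty site. -/
lemma mixedDet_one_eq_zero (P' P : PowerSeries S) {r : ℕ} (hr : r < n) {M : Fin n → ℤ}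
    (h : M (⟨r, hr⟩ + 1) = -1) : mixedDet P' P r 1 M = 0 := by
  have h1 := conj_eq_add M ⟨r, hr⟩
  simp only [h] at h1
  rcases Nat.lt_or_ge (r + 1) n with h2 | h2
  · refine Matrix.det_zero_of_row_eq (i := ⟨r, hr⟩) (j := ⟨r + 1, h2⟩) ?_ ?_
    · simp
    · ext j
      simp only [Matrix.of_apply, lt_irrefl, if_false, h1, Nat.not_succ_lt_self]
      congr 1
      push_cast; ring
  · refine Matrix.det_eq_zero_of_row_eq_zero ⟨r, hr⟩ fun j => ?_
    simp only [Matrix.of_apply, lt_irrefl, if_false, h1]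
    rw [conj_eq_zero M h2]
    apply zcoeff_of_neg
    omega

end

/-- The product of the first `r` Lax matrices. -/
noncomputable def partialMonodromy (n : ℕ) [NeZero n] (u : Scalars) (r : ℕ) :
    Matrix (Fin 2) (Fin 2) (Module.End Scalars (States n)) :=
  ((List.ofFn fun j : Fin n => lax u (j + 1)).take r).reverse.prod

lemma partialMonodromy_succ (u : Scalars) {r : ℕ} (hr : r < n) :
    partialMonodromy n u (r + 1) = lax u (⟨r, hr⟩ + 1) * partialMonodromy n u r := by
  unfold partialMonodromy
  rw [List.take_add_one, List.getElem?_eq_getElem (by simpa using hr), Option.toList_some,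
    List.reverse_append, List.reverse_singleton, List.singleton_append, List.prod_cons,
    List.getElem_ofFn]

lemma partialMonodromy_self (u : Scalars) : partialMonodromy n u n = monodromy n u := by
  rw [partialMonodromy, List.take_of_length_le (by simp), monodromy]

/-- The state of level `k` with coefficients `det (P_{λ'_i - i + j})`. -/
def HasDetCoeff (f : States n) (k : ℕ) (P : PowerSeries Scalars) : Prop :=
  ∀ m : Fin n → ℕ, f m = if ∑ i, m i = k then
    (toeplitz P fun i : Fin n => conj (fun j => (m j : ℤ)) i - (i : ℕ)).det else 0

/-- Each Lax factor replaces one more row of the determinant, by `mixedDet_succ`. The vanishing of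
`P` above degree `k` is needed at the start: the identity matrix has upper right entry zero, and
there row `0` begins at index `k + 1`. -/
lemma partialMonodromy_apply {f : States n} {k : ℕ} {P : PowerSeries Scalars}
    (hf : HasDetCoeff f k P) (hP : ∀ r : ℤ, k < r → zcoeff P r = 0) (u : Scalars) (r : ℕ)
    (hr : r ≤ n) (a : Fin 2) (m : Fin n → ℕ) :
    partialMonodromy n u r a 1 f m = if (∑ i, (m i : ℤ)) + (a : ℕ) = k + 1 then
      mixedDet (P * (1 + PowerSeries.C u * PowerSeries.X)) P r (a : ℕ) (fun j => (m j : ℤ))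
      else 0 := by
  induction r generalizing a m with
  | zero =>
    have h1 : partialMonodromy n u 0 = 1 := by simp [partialMonodromy]
    rw [h1]
    fin_cases a
    · simp only [Fin.zero_eta, Matrix.one_apply, Fin.isValue]
      rw [if_neg (by decide), LinearMap.zero_apply, Finsupp.zero_apply]
      split_ifs with h
      · symm
        refine Matrix.det_eq_zero_of_row_eq_zero 0 fun j => ?_
        simp only [Matrix.of_apply, Fin.val_zero, conj_zero]
        simp only [Nat.cast_zero, add_zero] at h
        rw [if_neg (lt_irrefl _), h]
        apply hP
        push_cast; omega
      · rfl
    · simp only [Fin.mk_one, Matrix.one_apply, Fin.isValue, if_true]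
      rw [Module.End.one_apply, hf m]
      have h2 : (∑ i, (m i : ℤ)) + ((1 : Fin 2) : ℕ) = k + 1 ↔ ∑ i, m i = k := by
        simp only [Fin.val_one, Nat.cast_one, add_left_inj]
        exact_mod_cast Iff.rfl
      refine if_congr h2.symm ?_ rfl
      simp only [mixedDet, Nat.not_lt_zero, if_false]
      rfl
  | succ r ih =>
    have hr' : r < n := hr
    set Q := partialMonodromy n u r with hQ
    have ihx : ∀ (c : Fin 2) (M : Fin n → ℤ), (∀ j, 0 ≤ M j) →
        extCoeff (Q c 1 f) M = if (∑ i, M i) + (c : ℕ) = k + 1 then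
          mixedDet (P * (1 + PowerSeries.C u * PowerSeries.X)) P r (c : ℕ) M else 0 := by
      intro c M hM
      obtain ⟨m', rfl⟩ := exists_natCast_eq hM
      rw [extCoeff_natCast, ih hr'.le]
    have hsum : ∀ (M : Fin n → ℤ) (c : ℤ),
        ∑ i, (M + Pi.single (⟨r, hr'⟩ + 1) c : Fin n → ℤ) i = (∑ i, M i) + c := by
      intro M c
      simp [Finset.sum_add_distrib]
    rw [partialMonodromy_succ u hr', Matrix.mul_apply, Fin.sum_univ_two, LinearMap.add_apply,
      Finsupp.add_apply, mixedDet_succ P u hr']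
    have hm : ∀ j, 0 ≤ (fun j => (m j : ℤ)) j := fun j => Int.natCast_nonneg _
    fin_cases a
    · have e0 : (lax u (⟨r, hr'⟩ + 1) 0 0 * Q 0 1) f m =
          extCoeff (Q 0 1 f) (fun j => (m j : ℤ)) := by
        rw [extCoeff_natCast]; simp [lax]
      have e1 : (lax u (⟨r, hr'⟩ + 1) 0 1 * Q 1 1) f m =
          u * extCoeff (Q 1 1 f) ((fun j => (m j : ℤ)) + Pi.single (⟨r, hr'⟩ + 1) (-1)) := by
        rw [Pi.single_neg, ← sub_eq_add_neg, ← extCoeff_creation, extCoeff_natCast]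
        simp [lax]
      have e2 : extCoeff (Q 1 1 f) ((fun j => (m j : ℤ)) + Pi.single (⟨r, hr'⟩ + 1) (-1)) =
          if ∑ i, (m i : ℤ) = k + 1 then
            mixedDet (P * (1 + PowerSeries.C u * PowerSeries.X)) P r 1
              ((fun j => (m j : ℤ)) + Pi.single (⟨r, hr'⟩ + 1) (-1)) else 0 := by
        rcases Nat.eq_zero_or_pos (m (⟨r, hr'⟩ + 1)) with h | h
        · rw [extCoeff_of_neg (i := ⟨r, hr'⟩ + 1) _ (by simp [h]),
            mixedDet_one_eq_zero _ _ hr' (by simp [h]), ite_self]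
        · rw [ihx, hsum]
          · simp
          · intro j
            by_cases hj : j = ⟨r, hr'⟩ + 1
            · subst hj; simp; omega
            · simp [hj]
      simp only [Fin.zero_eta, Fin.isValue]
      rw [e0, e1, e2, ihx 0 _ hm]
      simp only [Fin.isValue, Fin.val_zero, Nat.cast_zero, add_zero, zero_sub, Pi.single_zero]
      split_ifs <;> simp
    · have e0 : (lax u (⟨r, hr'⟩ + 1) 1 0 * Q 0 1) f m =
          extCoeff (Q 0 1 f) ((fun j => (m j : ℤ)) + Pi.single (⟨r, hr'⟩ + 1) 1) := by
        rw [← extCoeff_annihilation _ _ hm, extCoeff_natCast]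
        simp [lax]
      have e1 : (lax u (⟨r, hr'⟩ + 1) 1 1 * Q 1 1) f m =
          u * extCoeff (Q 1 1 f) (fun j => (m j : ℤ)) := by
        rw [extCoeff_natCast]
        simp [lax]
      simp only [Fin.mk_one, Fin.isValue]
      rw [e0, e1, ihx 1 _ hm, ihx 0, hsum]
      · simp only [Fin.isValue, Fin.val_zero, Fin.val_one, Nat.cast_zero, Nat.cast_one, add_zero,
          sub_self, Pi.single_zero]
        split_ifs <;> simp
      · intro j
        by_cases hj : j = ⟨r, hr'⟩ + 1
        · subst hj; simp; omega
        · simp [hj]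

lemma hasDetCoeff_opB {f : States n} {k : ℕ} {P : PowerSeries Scalars}
    (hf : HasDetCoeff f k P) (hP : ∀ r : ℤ, k < r → zcoeff P r = 0) (u : Scalars) :
    HasDetCoeff (opB n u f) (k + 1) (P * (1 + PowerSeries.C u * PowerSeries.X)) := by
  intro m
  rw [opB, ← partialMonodromy_self, partialMonodromy_apply hf hP u n le_rfl]
  simp only [Fin.isValue, Fin.val_zero, Nat.cast_zero, add_zero, mixedDet, Fin.is_lt, if_true]
  have h2 : (∑ i, (m i : ℤ)) = k + 1 ↔ ∑ i, m i = k + 1 := by exact_mod_cast Iff.rfl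
  simp only [h2]
  rfl

lemma hasDetCoeff_vacuum : HasDetCoeff (vacuum n) 0 1 := by
  intro m
  rw [vacuum, Finsupp.single_apply]
  have h0 : ∑ i, m i = 0 ↔ 0 = m := by
    rw [Finset.sum_eq_zero_iff, eq_comm, funext_iff]
    simp
  simp only [h0]
  split_ifs with h
  · subst h
    have : ∀ i : ℕ, conj (fun j => (((0 : Fin n → ℕ) j : ℕ) : ℤ)) i = 0 := by
      intro i; simp [conj]
    simp only [this]
    exact (det_toeplitz_one (S := Scalars) (fun _ => 0) fun _ => rfl).symm
  · rfl

/-- The coefficients of the Bethe vectors. -/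
lemma hasDetCoeff_betheVector {k : ℕ} (x : Fin k → Scalarsˣ) :
    HasDetCoeff (betheVector n x) k (genE fun i => (((x i)⁻¹ : Scalarsˣ) : Scalars)) := by
  induction k with
  | zero =>
    have : betheVector n x = vacuum n := by simp [betheVector]
    rw [this]
    simpa [genE] using hasDetCoeff_vacuum (n := n)
  | succ k ih =>
    have h1 : betheVector n x = opB n (((x 0)⁻¹ : Scalarsˣ) : Scalars)
        (betheVector n fun i => x i.succ) := by
      simp [betheVector, List.ofFn_succ]
    have h2 : (genE fun i => (((x i)⁻¹ : Scalarsˣ) : Scalars)) =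
        (genE fun i : Fin k => (((x i.succ)⁻¹ : Scalarsˣ) : Scalars)) *
          (1 + PowerSeries.C (((x 0)⁻¹ : Scalarsˣ) : Scalars) * PowerSeries.X) := by
      rw [genE, Fin.prod_univ_succ, mul_comm, genE]
    rw [h1, h2]
    exact hasDetCoeff_opB (ih _) (fun r hr => zcoeff_genE_of_gt _ hr) _

end BetheCoefficients

/-! ### Bialternants and the Pieri rule. -/

section Alternants

variable {S : Type*} [CommRing S]

lemma coeff_prod_one_sub_eq_zero {ι : Type*} (s : Finset ι) (t : ι → S) {v : ℕ}
    (hv : s.card < v) :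
    PowerSeries.coeff v (∏ i ∈ s, (1 - PowerSeries.C (t i) * PowerSeries.X)) = 0 := by
  classical
  induction s using Finset.induction_on generalizing v with
  | empty =>
    rw [Finset.prod_empty, PowerSeries.coeff_one, if_neg (by simp at hv; omega)]
  | insert a s ha ih =>
    rw [Finset.card_insert_of_notMem ha] at hv
    obtain ⟨v, rfl⟩ : ∃ v', v = v' + 1 := ⟨v - 1, by omega⟩
    rw [Finset.prod_insert ha, sub_mul, one_mul, map_sub, ih (by omega), mul_assoc,
      PowerSeries.coeff_C_mul, mul_comm PowerSeries.X, PowerSeries.coeff_succ_mul_X, ih (by omega)]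
    simp

lemma coeff_mul_eq_sum_zcoeff (H p : PowerSeries S) {l : ℕ}
    (hp : ∀ v, l ≤ v → PowerSeries.coeff v p = 0) (r : ℕ) :
    PowerSeries.coeff r (H * p) =
      ∑ v : Fin l, zcoeff H (r - (v : ℕ)) * PowerSeries.coeff v p := by
  rw [Fin.sum_univ_eq_sum_range (fun v => zcoeff H (r - (v : ℕ)) * PowerSeries.coeff v p) l,
    PowerSeries.coeff_mul, Finset.Nat.sum_antidiagonal_eq_sum_range_succ
      (fun u v => PowerSeries.coeff u H * PowerSeries.coeff v p), ← Finset.sum_range_reflect]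
  have h1 : ∑ j ∈ Finset.range (r + 1), PowerSeries.coeff (r + 1 - 1 - j) H *
      PowerSeries.coeff (r - (r + 1 - 1 - j)) p =
      ∑ v ∈ Finset.range (r + 1), zcoeff H (r - (v : ℕ)) * PowerSeries.coeff v p := by
    refine Finset.sum_congr rfl fun v hv => ?_
    have hv' := Finset.mem_range.mp hv
    rw [show r - (r + 1 - 1 - v) = v by omega, show r + 1 - 1 - v = r - v by omega,
      ← zcoeff_natCast, Nat.cast_sub (by omega)]
  refine h1.trans ?_
  rcases le_total (r + 1) l with h | h
  · refine Finset.sum_subset (Finset.range_mono h) fun v _ hv => ?_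
    rw [Finset.mem_range] at hv
    rw [zcoeff_of_neg _ (by omega), zero_mul]
  · refine (Finset.sum_subset (Finset.range_mono h) fun v _ hv => ?_).symm
    rw [Finset.mem_range] at hv
    rw [hp v (by omega), mul_zero]

/-- The alternant `det (t_j ^ p_i)`. -/
noncomputable def alternant {l : ℕ} (t : Fin l → Sˣ) (p : Fin l → ℤ) : S :=
  (Matrix.of fun i j => ((t j ^ p i : Sˣ) : S)).det

/-- The bialternant formula. -/
lemma det_toeplitz_genH_mul {l : ℕ} (t : Fin l → Sˣ) (a : Fin l → ℤ)
    (ha : ∀ i, 0 ≤ a i + (l - 1)) :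
    (toeplitz (genH fun j => (t j : S)) a).det * alternant t (fun i => (l : ℤ) - 1 - (i : ℕ)) =
      alternant t fun i => a i + (l - 1) := by
  classical
  -- Multiplying the full series by the factors of all other variables leaves `1 / (1 - t_j u)`,
  -- whose coefficients are powers of `t_j`. So the coefficient matrix `E` of these products carries
  -- the Toeplitz matrix to the alternant matrix.
  let p : Fin l → PowerSeries S := fun j =>
    ∏ i ∈ Finset.univ.erase j, (1 - PowerSeries.C (t i : S) * PowerSeries.X)
  let E : Matrix (Fin l) (Fin l) S := Matrix.of fun s j => PowerSeries.coeff (s.rev : ℕ) (p j)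
  have hp : ∀ j, genH (fun j => (t j : S)) * p j = geomSeries (t j : S) := by
    intro j
    have h1 := genH_mul_prod fun j => (t j : S)
    rw [← Finset.mul_prod_erase _ _ (Finset.mem_univ j), mul_left_comm] at h1
    calc genH (fun j => (t j : S)) * p j
        = geomSeries (t j : S) * (1 - PowerSeries.C (t j : S) * PowerSeries.X) *
          (genH (fun j => (t j : S)) * p j) := by rw [geomSeries_mul, one_mul]
      _ = geomSeries (t j : S) * 1 := by rw [mul_assoc, h1]
      _ = _ := mul_one _
  have key : ∀ a : Fin l → ℤ, (∀ i, 0 ≤ a i + (l - 1)) →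
      toeplitz (genH fun j => (t j : S)) a * E =
        Matrix.of fun i j => ((t j ^ (a i + (l - 1)) : Sˣ) : S) := by
    intro a ha
    ext i j
    obtain ⟨r, hr⟩ := Int.eq_ofNat_of_zero_le (ha i)
    rw [Matrix.mul_apply, Matrix.of_apply, hr]
    have h1 := coeff_mul_eq_sum_zcoeff (genH fun j => (t j : S)) (p j) (l := l)
      (fun v hv => coeff_prod_one_sub_eq_zero _ _ (by
        rw [Finset.card_erase_of_mem (Finset.mem_univ j), Finset.card_fin]
        have := j.pos
        omega)) r
    rw [hp] at h1
    simp only [geomSeries, PowerSeries.coeff_mk] at h1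
    rw [zpow_natCast, Units.val_pow_eq_pow_val, h1,
      ← Equiv.sum_comp Fin.revPerm]
    refine Finset.sum_congr rfl fun s _ => ?_
    simp only [toeplitz, E, Matrix.of_apply, Fin.revPerm_apply, Fin.rev_rev]
    congr 2
    rw [Fin.val_rev]
    have := s.is_lt
    push_cast [Nat.cast_sub (show (s : ℕ) + 1 ≤ l from this)]
    linarith
  have hE : E.det = alternant t (fun i => (l : ℤ) - 1 - (i : ℕ)) := by
    -- For the empty partition the Toeplitz matrix is unitriangular, which identifies `det E`.
    have h1 := key (fun i => -(i : ℕ)) (fun i => by have := i.is_lt; omega)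
    have h2 : (toeplitz (genH fun j => (t j : S)) fun i : Fin l => -((i : ℕ) : ℤ)).det = 1 := by
      rw [Matrix.det_of_isUpperTriangular]
      · refine Finset.prod_eq_one fun i _ => ?_
        simp [toeplitz, zcoeff, genH, geomSeries, map_prod]
      · intro i j h
        have : (j : ℕ) < i := h
        simp only [toeplitz, Matrix.of_apply]
        exact zcoeff_of_neg _ (by omega)
    have h3 := congrArg Matrix.det h1
    rw [Matrix.det_mul, h2, one_mul] at h3
    rw [h3, alternant]
    congr 1
    ext i j
    rw [Matrix.of_apply, Matrix.of_apply]
    congr 2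
    ring
  rw [← hE, ← Matrix.det_mul, key a ha, alternant]

lemma alternant_add_const {l : ℕ} (t : Fin l → Sˣ) (p : Fin l → ℤ) (c : ℤ) :
    alternant t (fun i => p i + c) = (∏ j, ((t j ^ c : Sˣ) : S)) * alternant t p := by
  unfold alternant
  rw [← Matrix.det_mul_row]
  congr 1
  ext i j
  simp [zpow_add, mul_comm]

/-- The Pieri rule for alternants. -/
lemma sum_det_mul_ite {l : ℕ} (A : Matrix (Fin l) (Fin l) S) (w : Fin l → S) (r : ℕ) :
    ∑ I ∈ (Finset.univ : Finset (Fin l)).powersetCard r,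
      (Matrix.of fun i j => A i j * if i ∈ I then w j else 1).det =
      PowerSeries.coeff r (genE w) * A.det := by
  classical
  -- One determinant computed twice: factors pulled out of columns give `genE w`, while expansion by
  -- rows gives one term `X ^ |I|` for each set `I` of rows multiplied by `w`.
  have h1 : (Matrix.of fun i j => (1 + PowerSeries.C (w j) * PowerSeries.X) *
      PowerSeries.C (A i j) : Matrix (Fin l) (Fin l) (PowerSeries S)).det =
      genE w * PowerSeries.C A.det := by
    have := Matrix.det_mul_row (fun j => 1 + PowerSeries.C (w j) * PowerSeries.X)
      ((PowerSeries.C (R := S)).mapMatrix A)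
    rw [← RingHom.map_det] at this
    rw [genE, ← this]
    rfl
  have h2 : (Matrix.of fun i j => (1 + PowerSeries.C (w j) * PowerSeries.X) *
      PowerSeries.C (A i j) : Matrix (Fin l) (Fin l) (PowerSeries S)).det =
      ∑ I : Finset (Fin l), PowerSeries.X ^ I.card *
        PowerSeries.C (Matrix.of fun i j => A i j * if i ∈ I then w j else 1).det := by
    have h : (fun i j => (1 + PowerSeries.C (w j) * PowerSeries.X) *
        PowerSeries.C (A i j) : Fin l → Fin l → PowerSeries S) =
        (fun i (j : Fin l) => PowerSeries.X * PowerSeries.C (A i j * w j)) +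
          (fun i (j : Fin l) => PowerSeries.C (A i j)) := by
      funext i j
      simp only [Pi.add_apply, map_mul]
      ring
    refine (congrArg (Matrix.detRowAlternating (n := Fin l) (R := PowerSeries S)) h).trans ?_
    rw [AlternatingMap.map_add_univ]
    refine Finset.sum_congr rfl fun I _ => ?_
    have h3 : (I.piecewise (fun i j => PowerSeries.X * PowerSeries.C (A i j * w j))
        (fun i j => PowerSeries.C (A i j)) : Fin l → Fin l → PowerSeries S) =
        Matrix.of fun i j => (if i ∈ I then PowerSeries.X else 1) *
          (PowerSeries.C (R := S)).mapMatrix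
            (Matrix.of fun i j => A i j * if i ∈ I then w j else 1) i j := by
      funext i j
      by_cases hi : i ∈ I <;> simp [hi]
    rw [h3]
    refine (Matrix.det_mul_column _ _).trans ?_
    rw [Finset.prod_ite_mem, Finset.univ_inter, Finset.prod_const, RingHom.map_det]
  have h3 := congrArg (PowerSeries.coeff r) (h1.symm.trans h2)
  rw [mul_comm, PowerSeries.coeff_C_mul, map_sum] at h3
  rw [mul_comm, h3]
  simp only [PowerSeries.coeff_X_pow_mul', PowerSeries.coeff_C]
  rw [Finset.powersetCard_eq_filter, Finset.powerset_univ, Finset.sum_filter]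
  refine Finset.sum_congr rfl fun I _ => ?_
  by_cases h : I.card = r
  · simp [h]
  · rw [if_neg h]
    split_ifs <;> first | rfl | omega

end Alternants

/-! ### Products over all roots of unity. -/

section RootsOfUnity

variable {R : Type*} [CommRing R] [IsDomain R]

/-- By counting, `f` takes every value below `N` once, so this is the factorisation of `1 - Y ^ N`
at `Y = θ X`. -/
lemma prod_one_sub_root {ι : Type*} [Fintype ι] {N : ℕ} (hN : 0 < N) {ζ : R}
    (hζ : IsPrimitiveRoot ζ N) (θ : R) (f : ι → ℕ) (hf : Function.Injective f)
    (hlt : ∀ i, f i < N) (hcard : Fintype.card ι = N) :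
    ∏ i, (1 - PowerSeries.C (θ * ζ ^ f i) * PowerSeries.X) =
      1 - PowerSeries.C (θ ^ N) * PowerSeries.X ^ N := by
  classical
  have hbij : Function.Bijective (fun i => (⟨f i, hlt i⟩ : Fin N)) := by
    rw [Fintype.bijective_iff_injective_and_card]
    exact ⟨fun i j h => hf (by simpa using h), by simpa using hcard⟩
  have hC : IsPrimitiveRoot (PowerSeries.C ζ) N :=
    hζ.map_of_injective (PowerSeries.C_injective)
  have h1 := hC.pow_sub_pow_eq_prod_sub_mul 1 (PowerSeries.C θ * PowerSeries.X) hN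
  have h2 : Polynomial.nthRootsFinset N (1 : PowerSeries R) =
      Finset.univ.image fun i : Fin N => PowerSeries.C ζ ^ (i : ℕ) := by
    symm
    apply Finset.eq_of_subset_of_card_le
    · intro x hx
      obtain ⟨i, _, rfl⟩ := Finset.mem_image.mp hx
      rw [Polynomial.mem_nthRootsFinset hN, ← pow_mul, mul_comm, pow_mul, hC.pow_eq_one, one_pow]
    · rw [hC.card_nthRootsFinset, Finset.card_image_of_injective, Finset.card_fin]
      intro i j h
      exact Fin.ext (hC.pow_inj i.2 j.2 h)
  rw [h2, Finset.prod_image] at h1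
  · rw [one_pow, mul_pow, ← map_pow] at h1
    rw [h1, ← hbij.prod_comp (fun i : Fin N => 1 - PowerSeries.C ζ ^ (i : ℕ) *
      (PowerSeries.C θ * PowerSeries.X))]
    refine Finset.prod_congr rfl fun i _ => ?_
    simp only [map_mul, map_pow]
    ring
  · intro i _ j _ h
    exact Fin.ext (hC.pow_inj i.2 j.2 h)

end RootsOfUnity

/-! ### Bethe roots and dual roots. -/

section BetheRoots

lemma zetaPow_add (n k : ℕ) (a b : ℝ) : zetaPow n k (a + b) = zetaPow n k a * zetaPow n k b := by
  rw [zetaPow, zetaPow, zetaPow, ← Complex.exp_add]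
  congr 1
  push_cast
  ring

lemma zetaPow_zero (n k : ℕ) : zetaPow n k 0 = 1 := by simp [zetaPow]

lemma zetaPow_ne_zero (n k : ℕ) (a : ℝ) : zetaPow n k a ≠ 0 := Complex.exp_ne_zero _

lemma zetaPow_neg (n k : ℕ) (a : ℝ) : zetaPow n k (-a) = (zetaPow n k a)⁻¹ := by
  exact eq_inv_of_mul_eq_one_left (by rw [← zetaPow_add, neg_add_cancel, zetaPow_zero])

lemma zetaPow_natCast (n k m : ℕ) : zetaPow n k m = zetaPow n k 1 ^ m := by
  induction m with
  | zero => simp [zetaPow_zero]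
  | succ m ih => rw [Nat.cast_succ, zetaPow_add, ih, pow_succ]

lemma zetaPow_sum (n k : ℕ) {ι : Type*} (s : Finset ι) (f : ι → ℝ) :
    zetaPow n k (∑ i ∈ s, f i) = ∏ i ∈ s, zetaPow n k (f i) := by
  classical
  induction s using Finset.induction_on with
  | empty => simp [zetaPow_zero]
  | insert a s ha ih => rw [Finset.sum_insert ha, Finset.prod_insert ha, zetaPow_add, ih]

lemma norm_zetaPow (n k : ℕ) (a : ℝ) : ‖zetaPow n k a‖ = 1 := by
  have : zetaPow n k a = Complex.exp ((2 * Real.pi * a / (k + n) : ℝ) * Complex.I) := by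
    rw [zetaPow]; congr 1; push_cast; ring
  rw [this, Complex.norm_exp_ofReal_mul_I]

variable {n k : ℕ}

lemma isPrimitiveRoot_zetaPow (hn : 0 < n) : IsPrimitiveRoot (zetaPow n k 1) (n + k) := by
  have := Complex.isPrimitiveRoot_exp (n + k) (by omega)
  convert this using 1
  rw [zetaPow]
  congr 1
  push_cast
  ring

lemma zetaPow_half (hn : 0 < n) : zetaPow n k (((n : ℝ) + k) / 2) = -1 := by
  rw [zetaPow, ← Complex.exp_pi_mul_I]
  congr 1
  have : ((k : ℂ) + n) ≠ 0 := by
    have : (k + n : ℕ) ≠ 0 := by omega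
    exact_mod_cast this
  push_cast
  field_simp
  ring

/-- The root `z^{1/n} ζ^q`. -/
noncomputable def rootUnit (n k : ℕ) (q : ℝ) : Scalarsˣ :=
  monomialUnit (Units.mk0 (zetaPow n k q) (zetaPow_ne_zero n k q))

lemma rootUnit_val (n k : ℕ) (q : ℝ) :
    (rootUnit n k q : Scalars) = LaurentPolynomial.C (zetaPow n k q) * LaurentPolynomial.T 1 := rfl

lemma rootUnit_inv_val (n k : ℕ) (q : ℝ) :
    (((rootUnit n k q)⁻¹ : Scalarsˣ) : Scalars) =
      LaurentPolynomial.C (zetaPow n k q)⁻¹ * LaurentPolynomial.T (-1) := rfl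

/-- The constant root of unity `ζ`. -/
noncomputable def zetaUnit (n k : ℕ) : Scalarsˣ :=
  Units.map (LaurentPolynomial.C : ℂ →+* Scalars).toMonoidHom
    (Units.mk0 (zetaPow n k 1) (zetaPow_ne_zero n k 1))

lemma zetaUnit_val (n k : ℕ) : (zetaUnit n k : Scalars) = LaurentPolynomial.C (zetaPow n k 1) := rfl

lemma rootUnit_add_natCast (n k : ℕ) (q : ℝ) (m : ℕ) :
    rootUnit n k (q + m) = rootUnit n k q * zetaUnit n k ^ m := by
  apply Units.ext
  rw [Units.val_mul, Units.val_pow_eq_pow_val, rootUnit_val, rootUnit_val, zetaUnit_val, ← map_pow,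
    ← zetaPow_natCast, zetaPow_add, map_mul]
  ring

lemma isPrimitiveRoot_zetaUnit (hn : 0 < n) : IsPrimitiveRoot (zetaUnit n k) (n + k) := by
  rw [← IsPrimitiveRoot.coe_units_iff, zetaUnit_val]
  exact (isPrimitiveRoot_zetaPow hn).map_of_injective
    (f := (LaurentPolynomial.C : ℂ →+* Scalars)) (RingHom.injective _)

/-- The roots `w_j = z^{1/n} ζ^{ξ_j}`. -/
noncomputable def dualRoot (n k : ℕ) (σ : YoungDiagram) (j : Fin n) : Scalarsˣ :=
  rootUnit n k (xi n σ j)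

/-- The exponents of the Bethe roots and of the negatives of the dual roots. -/
def rootIndex (n k : ℕ) (σ : YoungDiagram) : Fin k ⊕ Fin n → ℕ :=
  Sum.elim (fun a => σ.colLen a.rev + k - 1 - a.rev) fun j => k + j - σ.rowLen j

variable {σ : YoungDiagram}

lemma rootIndex_lt (hn : 0 < n) (h1 : σ.colLen 0 ≤ n - 1) (a : Fin k ⊕ Fin n) :
    rootIndex n k σ a < n + k := by
  rcases a with a | j
  · have := σ.colLen_anti 0 a.rev (Nat.zero_le _)
    have := a.is_lt
    simp only [rootIndex, Sum.elim_inl]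
    omega
  · have := j.is_lt
    simp only [rootIndex, Sum.elim_inr]
    omega

/-- The two families label the horizontal and vertical steps of the boundary path of `σ`. A
coincidence between them would mean that `σ.rowLen j + σ.colLen b = j + b + 1`; the left side is at
least one larger if `(j, b)` is a cell, and at least one smaller otherwise. -/
lemma rootIndex_injective (h2 : σ.rowLen 0 ≤ k) : Function.Injective (rootIndex n k σ) := by
  have hmix : ∀ (a : Fin k) (j : Fin n),
      rootIndex n k σ (Sum.inl a) ≠ rootIndex n k σ (Sum.inr j) := by
    intro a j
    have h3 := σ.rowLen_anti 0 j (Nat.zero_le _)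
    have h4 : (a.rev : ℕ) < σ.rowLen j ↔ (j : ℕ) < σ.colLen a.rev := by
      rw [← YoungDiagram.mem_iff_lt_rowLen, ← YoungDiagram.mem_iff_lt_colLen]
    have h5 := a.rev.is_lt
    simp only [rootIndex, Sum.elim_inl, Sum.elim_inr]
    omega
  rintro (a | j) (b | i) h
  · congr 1
    by_contra hne
    have hne' : (a.rev : ℕ) ≠ b.rev := fun h' => hne (Fin.rev_injective (Fin.ext h'))
    have ha := a.rev.is_lt
    have hb := b.rev.is_lt
    simp only [rootIndex, Sum.elim_inl] at h
    rcases Nat.lt_or_gt_of_ne hne' with h' | h'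
    · have := σ.colLen_anti _ _ h'.le
      omega
    · have := σ.colLen_anti _ _ h'.le
      omega
  · exact absurd h (hmix a i)
  · exact absurd h.symm (hmix b j)
  · congr 1
    by_contra hne
    have hne' : (j : ℕ) ≠ i := fun h' => hne (Fin.ext h')
    have h3 := σ.rowLen_anti 0 j (Nat.zero_le _)
    have h4 := σ.rowLen_anti 0 i (Nat.zero_le _)
    simp only [rootIndex, Sum.elim_inr] at h
    rcases Nat.lt_or_gt_of_ne hne' with h' | h'
    · have := σ.rowLen_anti _ _ h'.le
      omega
    · have := σ.rowLen_anti _ _ h'.le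
      omega

/-- The common factor of the Bethe roots. -/
noncomputable def baseRoot (n k : ℕ) (σ : YoungDiagram) : Scalarsˣ :=
  rootUnit n k ((σ.card : ℝ) / n + ((k : ℝ) + 1) / 2 - k)

lemma betheRoot_eq (a : Fin k) : betheRoot n k σ a =
    baseRoot n k σ * zetaUnit n k ^ rootIndex n k σ (Sum.inl a) := by
  rw [baseRoot, ← rootUnit_add_natCast]
  apply Units.ext
  change LaurentPolynomial.C (zetaPow n k _ * zetaPow n k _) * _ = _
  rw [rootUnit_val, ← zetaPow_add]
  congr 3
  have ha := a.rev.is_lt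
  simp only [indexI, YoungDiagram.rowLen_transpose, rootIndex, Sum.elim_inl]
  rw [Nat.sub_sub, Nat.cast_sub (by omega)]
  push_cast
  ring

/-- The two centrings of the exponents differ by `(n + k) / 2`, half a period of `ζ`, whence the
sign. -/
lemma dualRoot_eq (hn : 0 < n) (h2 : σ.rowLen 0 ≤ k) (j : Fin n) : dualRoot n k σ j =
    -(baseRoot n k σ * zetaUnit n k ^ rootIndex n k σ (Sum.inr j)) := by
  rw [baseRoot, ← rootUnit_add_natCast, dualRoot]
  apply Units.ext
  have hj := σ.rowLen_anti 0 j (Nat.zero_le _)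
  have h : (σ.card : ℝ) / n + ((k : ℝ) + 1) / 2 - k + (rootIndex n k σ (Sum.inr j) : ℕ) =
      xi n σ j + ((n : ℝ) + k) / 2 := by
    simp only [xi, rootIndex, Sum.elim_inr]
    rw [Nat.cast_sub (by omega)]
    push_cast
    ring
  rw [Units.val_neg, rootUnit_val, rootUnit_val, h, zetaPow_add, zetaPow_half hn]
  simp

lemma dualRoot_injective (hn : 0 < n) (h1 : σ.colLen 0 ≤ n - 1) (h2 : σ.rowLen 0 ≤ k) :
    Function.Injective (dualRoot n k σ) := by
  intro i j h
  rw [dualRoot_eq hn h2, dualRoot_eq hn h2, neg_inj, mul_right_inj] at h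
  have := (isPrimitiveRoot_zetaUnit (k := k) hn).pow_inj (rootIndex_lt hn h1 _)
    (rootIndex_lt hn h1 _) h
  exact Sum.inr_injective (rootIndex_injective h2 this)

lemma exists_dualRoot_pow_eq (hn : 0 < n) (h2 : σ.rowLen 0 ≤ k) :
    ∃ τ : Scalarsˣ, ∀ j, (dualRoot n k σ j)⁻¹ ^ (n + k) = τ := by
  refine ⟨((-(baseRoot n k σ)) ^ (n + k))⁻¹, fun j => ?_⟩
  rw [inv_pow, dualRoot_eq hn h2, ← neg_mul, mul_pow, ← pow_mul, mul_comm (rootIndex n k σ _),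
    pow_mul, (isPrimitiveRoot_zetaUnit hn).pow_eq_one, one_pow, mul_one]

lemma sum_xi (hn : 0 < n) (h1 : σ.colLen 0 ≤ n - 1) : ∑ j, xi n σ j = 0 := by
  have hcard := card_eq_sum_rowLen σ (l := n) (by omega)
  have hc : (σ.card : ℝ) = ∑ j : Fin n, (σ.rowLen j : ℝ) := by rw [hcard]; push_cast; rfl
  have hn' : (n : ℝ) ≠ 0 := by exact_mod_cast hn.ne'
  have hs : ∑ j : Fin n, ((j : ℕ) : ℝ) = (n : ℝ) * (n - 1) / 2 := by
    have := Finset.sum_range_id_mul_two n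
    rw [Fin.sum_univ_eq_sum_range (fun j => (j : ℝ)) n, eq_div_iff two_ne_zero]
    have h3 : ((∑ i ∈ Finset.range n, i : ℕ) : ℝ) * 2 = n * ((n - 1 : ℕ) : ℝ) := by
      exact_mod_cast this
    rw [Nat.cast_sub hn] at h3
    push_cast at h3
    exact h3
  simp only [xi, Finset.sum_neg_distrib, Finset.sum_add_distrib, Finset.sum_sub_distrib,
    Finset.sum_const, Finset.card_fin, nsmul_eq_mul, ← hc, hs]
  field_simp
  ring

lemma prod_dualRoot (hn : 0 < n) (h1 : σ.colLen 0 ≤ n - 1) :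
    ∏ j, (dualRoot n k σ j : Scalars) = zVar n := by
  simp only [dualRoot, rootUnit_val]
  rw [Finset.prod_mul_distrib, ← map_prod, ← zetaPow_sum, sum_xi hn h1, zetaPow_zero, map_one,
    one_mul, Finset.prod_const, Finset.card_fin, LaurentPolynomial.T_pow, zVar]
  simp

lemma coeff_mul_one_sub_X_pow {S : Type*} [CommRing S] (P : PowerSeries S) (c : S) {N r : ℕ}
    (hr : r < N) : PowerSeries.coeff r (P * (1 - PowerSeries.C c * PowerSeries.X ^ N)) =
      PowerSeries.coeff r P := by
  rw [mul_sub, mul_one, map_sub, ← mul_assoc, PowerSeries.coeff_mul_X_pow', if_neg (by omega),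
    sub_zero]

/-- The product of `∏ (1 - x_a u)` and `∏ (1 + w_j u)` has no terms in degrees strictly between `0`
and `n + k`, so below degree `n + k` the second factor is the inverse of the first. -/
lemma zcoeff_genH_betheRoot (hn : 0 < n) (h1 : σ.colLen 0 ≤ n - 1) (h2 : σ.rowLen 0 ≤ k)
    {r : ℤ} (hr : r < n + k) :
    zcoeff (genH (betheRootVal n k σ)) r = zcoeff (genE fun j => (dualRoot n k σ j : Scalars)) r := by
  rcases lt_or_ge r 0 with h0 | h0
  · rw [zcoeff_of_neg _ h0, zcoeff_of_neg _ h0]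
  obtain ⟨r, rfl⟩ := Int.eq_ofNat_of_zero_le h0
  have hζ := IsPrimitiveRoot.coe_units_iff.mpr (isPrimitiveRoot_zetaUnit (k := k) hn)
  have h := prod_one_sub_root (by omega) hζ (baseRoot n k σ : Scalars) (rootIndex n k σ)
    (rootIndex_injective h2) (rootIndex_lt hn h1) (by simp [add_comm])
  rw [Fintype.prod_sum_type] at h
  have hx : ∏ a : Fin k, (1 - PowerSeries.C ((baseRoot n k σ : Scalars) *
      (zetaUnit n k : Scalars) ^ rootIndex n k σ (Sum.inl a)) * PowerSeries.X) =
      ∏ a, (1 - PowerSeries.C (betheRootVal n k σ a) * PowerSeries.X) := by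
    refine Finset.prod_congr rfl fun a _ => ?_
    rw [betheRootVal, betheRoot_eq, Units.val_mul, Units.val_pow_eq_pow_val]
  have hw : ∏ j : Fin n, (1 - PowerSeries.C ((baseRoot n k σ : Scalars) *
      (zetaUnit n k : Scalars) ^ rootIndex n k σ (Sum.inr j)) * PowerSeries.X) =
      genE fun j => (dualRoot n k σ j : Scalars) := by
    refine Finset.prod_congr rfl fun j _ => ?_
    beta_reduce
    rw [dualRoot_eq hn h2, Units.val_neg, Units.val_mul, Units.val_pow_eq_pow_val, map_neg]
    ring
  rw [hx, hw] at h
  have h3 := genH_mul_prod (betheRootVal n k σ)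
  have h4 : genE (fun j => (dualRoot n k σ j : Scalars)) = genH (betheRootVal n k σ) *
      (1 - PowerSeries.C ((baseRoot n k σ : Scalars) ^ (n + k)) * PowerSeries.X ^ (n + k)) := by
    rw [← h, ← mul_assoc, h3, one_mul]
  rw [h4, zcoeff_natCast, zcoeff_natCast, coeff_mul_one_sub_X_pow _ _ (by omega)]

/-- The same argument for the inverse roots, with a negated base so that the sign falls on the
`x_a⁻¹` instead of the `w_j⁻¹`. -/
lemma zcoeff_genE_betheRoot_inv (hn : 0 < n) (h1 : σ.colLen 0 ≤ n - 1) (h2 : σ.rowLen 0 ≤ k)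
    {r : ℤ} (hr : r < n + k) :
    zcoeff (genE fun a => (((betheRoot n k σ a)⁻¹ : Scalarsˣ) : Scalars)) r =
      zcoeff (genH fun j => (((dualRoot n k σ j)⁻¹ : Scalarsˣ) : Scalars)) r := by
  rcases lt_or_ge r 0 with h0 | h0
  · rw [zcoeff_of_neg _ h0, zcoeff_of_neg _ h0]
  obtain ⟨r, rfl⟩ := Int.eq_ofNat_of_zero_le h0
  have hζ := IsPrimitiveRoot.coe_units_iff.mpr (isPrimitiveRoot_zetaUnit (k := k) hn).inv
  have h := prod_one_sub_root (by omega) hζ (((-(baseRoot n k σ))⁻¹ : Scalarsˣ) : Scalars)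
    (rootIndex n k σ) (rootIndex_injective h2) (rootIndex_lt hn h1) (by simp [add_comm])
  rw [Fintype.prod_sum_type] at h
  have hx : ∏ a : Fin k, (1 - PowerSeries.C ((((-(baseRoot n k σ))⁻¹ : Scalarsˣ) : Scalars) *
      (((zetaUnit n k)⁻¹ : Scalarsˣ) : Scalars) ^ rootIndex n k σ (Sum.inl a)) * PowerSeries.X) =
      genE fun a => (((betheRoot n k σ a)⁻¹ : Scalarsˣ) : Scalars) := by
    refine Finset.prod_congr rfl fun a _ => ?_
    beta_reduce
    rw [betheRoot_eq, mul_inv, ← inv_pow, Units.val_mul, Units.val_pow_eq_pow_val, inv_neg,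
      Units.val_neg, neg_mul, map_neg]
    ring
  have hw : ∏ j : Fin n, (1 - PowerSeries.C ((((-(baseRoot n k σ))⁻¹ : Scalarsˣ) : Scalars) *
      (((zetaUnit n k)⁻¹ : Scalarsˣ) : Scalars) ^ rootIndex n k σ (Sum.inr j)) * PowerSeries.X) =
      ∏ j, (1 - PowerSeries.C (((dualRoot n k σ j)⁻¹ : Scalarsˣ) : Scalars) * PowerSeries.X) := by
    refine Finset.prod_congr rfl fun j _ => ?_
    rw [dualRoot_eq hn h2, ← neg_mul, mul_inv, ← inv_pow, Units.val_mul, Units.val_pow_eq_pow_val]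
  rw [hx, hw] at h
  have h3 := genH_mul_prod fun j => (((dualRoot n k σ j)⁻¹ : Scalarsˣ) : Scalars)
  have h4 := congrArg (fun P => (genH fun j => (((dualRoot n k σ j)⁻¹ : Scalarsˣ) : Scalars)) * P) h
  rw [mul_left_comm, h3, mul_one] at h4
  rw [h4, zcoeff_natCast, zcoeff_natCast, coeff_mul_one_sub_X_pow _ _ (by omega)]

end BetheRoots

/-! ### Bethe vectors as eigenvectors of `e_r(𝒜)`. -/

section Eigenvectors

variable {n : ℕ} [NeZero n]

lemma conj_sub (M M' : Fin n → ℤ) (j : ℕ) : conj (M - M') j = conj M j - conj M' j := by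
  simp only [conj, ← Finset.sum_sub_distrib]
  refine Finset.sum_congr rfl fun i _ => ?_
  split_ifs <;> simp

/-- The shift at site `j + 1` is a difference of indicators at `j` and `j + 1`, so its partial sums
telescope; the sum ends at site `n`, which is site `0`. -/
lemma conj_hopShift (I : Finset (Fin n)) (i : Fin n) :
    conj (hopShift I) i = (if i ∈ I then 1 else 0) - (if 0 ∈ I then 1 else 0) := by
  have key : ∀ (d : ℕ) (i : Fin n), (i : ℕ) + d + 1 = n →
      conj (hopShift I) i = (if i ∈ I then 1 else 0) - (if 0 ∈ I then 1 else 0) := by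
    intro d
    induction d with
    | zero =>
      intro i hi
      have h : i + 1 = 0 := by
        apply Fin.ext
        rw [Fin.val_add, Fin.val_one', Nat.add_mod_mod, show (i : ℕ) + 1 = n by omega,
          Nat.mod_self, Fin.val_zero]
      rw [conj_eq_add, hopShift_apply, conj_eq_zero _ (by omega), h, add_zero]
    | succ d ih =>
      intro i hi
      have h : ((i + 1 : Fin n) : ℕ) = i + 1 := Fin.val_add_one_of_lt' (by omega)
      rw [conj_eq_add, hopShift_apply, ← h, ih (i + 1) (by omega)]
      ring
  exact key (n - 1 - i) i (by have := i.is_lt; omega)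

lemma sum_hopShift (I : Finset (Fin n)) : ∑ i, hopShift I i = 0 := by
  rw [← conj_zero, ← Fin.val_zero n, conj_hopShift, sub_self]

lemma conj_nonneg {M : Fin n → ℤ} (hM : ∀ i, 0 ≤ M i) (j : ℕ) : 0 ≤ conj M j :=
  Finset.sum_nonneg fun i _ => by split_ifs <;> simp [hM]

lemma conj_le_sum {M : Fin n → ℤ} (hM : ∀ i, 0 ≤ M i) (j : ℕ) : conj M j ≤ ∑ i, M i := by
  rw [← conj_zero, conj, conj]
  refine Finset.sum_le_sum fun i _ => ?_
  simp only [Nat.zero_le, if_true]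
  split_ifs <;> simp [hM]

/-- The exponents `λ'_i + n - i` of a configuration. -/
def exponents (M : Fin n → ℤ) (i : Fin n) : ℤ := conj M i - (i : ℕ) + (n - 1)

/-- An occupation `-1` makes two consecutive exponents equal. At the last site the exponents `n + k
- 1` and `-1` of the first and last rows differ by a full period instead, and `ht` makes these rows
proportional. -/
lemma alternant_exponents_eq_zero {S : Type*} [CommRing S] {k : ℕ} {t : Fin n → Sˣ} {τ : Sˣ}
    (ht : ∀ j, t j ^ (n + k) = τ) {M : Fin n → ℤ} (hM : ∑ i, M i = k) {i : Fin n}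
    (hi : M (i + 1) = -1) : alternant t (exponents M) = 0 := by
  have h1 := conj_eq_add M i
  rcases Nat.lt_or_ge ((i : ℕ) + 1) n with h | h
  · refine Matrix.det_zero_of_row_eq (i := i) (j := ⟨i + 1, h⟩) ?_ ?_
    · intro he; have := congrArg Fin.val he; simp at this
    · ext j
      have : exponents M i = exponents M ⟨i + 1, h⟩ := by
        simp only [exponents]
        rw [h1, hi]
        push_cast
        ring
      simp only [Matrix.of_apply, this]
  · have hin : (i : ℕ) + 1 = n := by have := i.is_lt; omega
    have h0 : (0 : Fin n) ≠ i := by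
      intro h0
      have h2 : conj M i = k := by rw [← h0, Fin.val_zero, conj_zero, hM]
      rw [h1, hi, conj_eq_zero M h] at h2
      omega
    have e0 : exponents M 0 = ((n + k : ℕ) : ℤ) + (-1) := by
      rw [exponents, Fin.val_zero, conj_zero, hM]; push_cast; ring
    have ei : exponents M i = -1 := by
      rw [exponents, h1, hi, conj_eq_zero M h]
      have : (n : ℤ) = i + 1 := by exact_mod_cast hin.symm
      rw [this]; ring
    set A : Matrix (Fin n) (Fin n) S := Matrix.of fun i j => ((t j ^ exponents M i : Sˣ) : S)
      with hA
    have hup : A = A.updateRow 0 ((τ : S) • A i) := by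
      ext a j
      by_cases ha : a = 0
      · subst ha
        simp only [Matrix.updateRow_self, Pi.smul_apply, smul_eq_mul, hA, Matrix.of_apply, e0, ei]
        rw [zpow_add, zpow_natCast, ht, Units.val_mul]
      · rw [Matrix.updateRow_ne ha]
    change A.det = 0
    rw [hup, Matrix.det_updateRow_smul, Matrix.det_updateRow_eq_zero h0.symm, mul_zero]

omit [NeZero n] in
lemma alternant_eq_vandermonde {S : Type*} [CommRing S] (t : Fin n → Sˣ) :
    alternant t (fun i => (n : ℤ) - 1 - (i : ℕ)) =
      ((Equiv.Perm.sign (Fin.revPerm : Equiv.Perm (Fin n)) : ℤˣ) : ℤ) *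
        ∏ i : Fin n, ∏ j ∈ Finset.Ioi i, ((t j : S) - t i) := by
  rw [← Matrix.det_vandermonde, ← Matrix.det_transpose (Matrix.vandermonde _),
    ← Matrix.det_permute, alternant]
  congr 1
  ext i j
  have : (n : ℤ) - 1 - (i : ℕ) = ((i.rev : ℕ) : ℤ) := by
    rw [Fin.val_rev, Nat.cast_sub i.is_lt]; push_cast; ring
  rw [Matrix.of_apply, this, zpow_natCast, Units.val_pow_eq_pow_val]
  rfl

omit [NeZero n] in
lemma alternant_ne_zero {S : Type*} [CommRing S] [IsDomain S] (t : Fin n → Sˣ)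
    (ht : Function.Injective t) : alternant t (fun i => (n : ℤ) - 1 - (i : ℕ)) ≠ 0 := by
  rw [alternant_eq_vandermonde]
  refine mul_ne_zero ?_ ?_
  · rcases Int.units_eq_one_or (Equiv.Perm.sign (Fin.revPerm : Equiv.Perm (Fin n))) with h | h <;>
      simp [h]
  · refine Finset.prod_ne_zero_iff.mpr fun i _ => Finset.prod_ne_zero_iff.mpr fun j hj => ?_
    rw [sub_ne_zero]
    intro h
    exact (Finset.mem_Ioi.mp hj).ne' (ht (Units.ext h))

variable {k : ℕ} {σ : YoungDiagram}

/-- The Vandermonde determinant of the inverse dual roots. -/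
noncomputable def dualVandermonde (n k : ℕ) (σ : YoungDiagram) : Scalars :=
  alternant (fun j => (dualRoot n k σ j)⁻¹) fun i => (n : ℤ) - 1 - (i : ℕ)

lemma dualVandermonde_ne_zero (h1 : σ.colLen 0 ≤ n - 1) (h2 : σ.rowLen 0 ≤ k) :
    dualVandermonde n k σ ≠ 0 :=
  alternant_ne_zero _ fun _ _ h =>
    dualRoot_injective (NeZero.pos n) h1 h2 (inv_injective h)

/-- At level `k` all indices in the determinant are below `n + k`, so `e_r(x⁻¹)` may be replaced by
`h_r(w⁻¹)`, and the bialternant formula applies. -/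
lemma extCoeff_betheState_mul (h1 : σ.colLen 0 ≤ n - 1) (h2 : σ.rowLen 0 ≤ k) {M : Fin n → ℤ}
    (hM : ∀ i, 0 ≤ M i) :
    extCoeff (betheState n k σ) M * dualVandermonde n k σ =
      if ∑ i, M i = k then alternant (fun j => (dualRoot n k σ j)⁻¹) (exponents M) else 0 := by
  obtain ⟨m, rfl⟩ := exists_natCast_eq hM
  have hn := NeZero.pos n
  have hb : betheState n k σ m = _ := hasDetCoeff_betheVector (betheRoot n k σ) m
  rw [extCoeff_natCast, hb]
  have hsum : (∑ i, (m i : ℤ)) = k ↔ ∑ i, m i = k := by exact_mod_cast Iff.rfl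
  simp only [hsum]
  split_ifs with h
  · have hle : ∀ i, conj (fun j => (m j : ℤ)) i ≤ k := fun i =>
      (conj_le_sum hM i).trans_eq (hsum.mpr h)
    have htoep : toeplitz (genE fun i => (((betheRoot n k σ i)⁻¹ : Scalarsˣ) : Scalars))
        (fun i : Fin n => conj (fun j => (m j : ℤ)) i - (i : ℕ)) =
        toeplitz (genH fun j => (((dualRoot n k σ j)⁻¹ : Scalarsˣ) : Scalars))
        (fun i : Fin n => conj (fun j => (m j : ℤ)) i - (i : ℕ)) := by
      ext1 i j
      simp only [toeplitz, Matrix.of_apply]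
      refine zcoeff_genE_betheRoot_inv hn h1 h2 ?_
      have := hle i
      have := j.is_lt
      omega
    rw [htoep, dualVandermonde, det_toeplitz_genH_mul]
    · rfl
    · intro i
      have := conj_nonneg hM i
      have := i.is_lt
      omega
  · rw [zero_mul]

lemma elemA_natCast_betheState (h1 : σ.colLen 0 ≤ n - 1) (h2 : σ.rowLen 0 ≤ k) (r : ℕ) :
    elemA n r (betheState n k σ) =
      PowerSeries.coeff r (genE fun j => (dualRoot n k σ j : Scalars)) • betheState n k σ := by
  have hn := NeZero.pos n
  obtain ⟨τ, hτ⟩ := exists_dualRoot_pow_eq (k := k) hn h2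
  ext1 m
  have hm : ∀ j, 0 ≤ (fun j => (m j : ℤ)) j := fun j => Int.natCast_nonneg _
  refine mul_right_cancel₀ (dualVandermonde_ne_zero (n := n) (k := k) h1 h2) ?_
  rw [elemA_apply, Finsupp.smul_apply, smul_eq_mul, mul_assoc, ← extCoeff_natCast (betheState n k σ),
    extCoeff_betheState_mul h1 h2 hm, Finset.sum_mul]
  have hsum : ∀ I : Finset (Fin n),
      ∑ i, ((fun j => (m j : ℤ)) - hopShift I) i = ∑ i, (m i : ℤ) := by
    intro I
    simp only [Pi.sub_apply, Finset.sum_sub_distrib, sum_hopShift, sub_zero]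
  -- The alternant formula persists for shifted tuples with negative entries: such an entry is `-1`,
  -- and both sides vanish.
  have hterm : ∀ I : Finset (Fin n), extCoeff (betheState n k σ) ((fun j => (m j : ℤ)) - hopShift I)
      * dualVandermonde n k σ = if ∑ i, (m i : ℤ) = k then
        alternant (fun j => (dualRoot n k σ j)⁻¹) (exponents ((fun j => (m j : ℤ)) - hopShift I))
        else 0 := by
    intro I
    by_cases hI : ∀ i, 0 ≤ ((fun j => (m j : ℤ)) - hopShift I) i
    · rw [extCoeff_betheState_mul h1 h2 hI, hsum]
    · push Not at hI
      obtain ⟨i, hi⟩ := hI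
      rw [extCoeff_of_neg _ hi, zero_mul]
      obtain ⟨i, rfl⟩ := exists_add_one i
      split_ifs with hk
      · refine (alternant_exponents_eq_zero hτ ((hsum I).trans hk) (i := i) ?_).symm
        have := hm (i + 1)
        simp only [Pi.sub_apply, hopShift_apply] at hi this ⊢
        split_ifs at hi ⊢ <;> omega
      · rfl
  have hprod : (∏ j, (((dualRoot n k σ j)⁻¹ : Scalarsˣ) : Scalars)) * zVar n = 1 := by
    rw [← prod_dualRoot hn h1, ← Finset.prod_mul_distrib]
    exact Finset.prod_eq_one fun j _ => Units.inv_mul _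
  split_ifs with hk
  · rw [alternant, ← sum_det_mul_ite]
    refine Finset.sum_congr rfl fun I _ => ?_
    rw [mul_assoc, hterm, if_pos hk]
    -- If `0 ∈ I`, all exponents also rise by one. This extracts `∏ w_j⁻¹ = z⁻¹` and cancels the
    -- weight `z` of `a_0`; what is left is the Pieri sum.
    have hexp : exponents ((fun j => (m j : ℤ)) - hopShift I) = fun i =>
        (exponents (fun j => (m j : ℤ)) i - if i ∈ I then 1 else 0) + if 0 ∈ I then 1 else 0 := by
      funext i
      simp only [exponents, conj_sub, conj_hopShift]
      ring
    rw [hexp, alternant_add_const, ← mul_assoc]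
    have hz : (if 0 ∈ I then zVar n else 1) * ∏ j, ((((dualRoot n k σ j)⁻¹ : Scalarsˣ) ^
        (if 0 ∈ I then (1 : ℤ) else 0) : Scalarsˣ) : Scalars) = 1 := by
      split_ifs
      · simp only [zpow_one]
        rw [mul_comm]; exact hprod
      · simp
    rw [hz, one_mul, alternant]
    congr 1
    ext1 i j
    simp only [Matrix.of_apply]
    split_ifs
    · rw [zpow_sub, zpow_one, inv_inv, Units.val_mul]
    · simp
  · rw [mul_zero]
    refine Finset.sum_eq_zero fun I _ => ?_
    rw [mul_assoc, hterm, if_neg hk, mul_zero]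

/-- The Bethe vectors are eigenvectors of the elementary symmetric polynomials. -/
lemma elemA_betheState (h1 : σ.colLen 0 ≤ n - 1) (h2 : σ.rowLen 0 ≤ k) (r : ℤ) :
    elemA n r (betheState n k σ) =
      zcoeff (genE fun j => (dualRoot n k σ j : Scalars)) r • betheState n k σ := by
  rcases lt_or_ge r 0 with h0 | h0
  · rw [zcoeff_of_neg _ h0, elemA, if_pos h0, LinearMap.zero_apply, zero_smul]
  · obtain ⟨r, rfl⟩ := Int.eq_ofNat_of_zero_le h0
    rw [zcoeff_natCast]
    exact elemA_natCast_betheState h1 h2 r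

end Eigenvectors

/-! ### The scalar product and adjoints. -/

section ScalarProduct

lemma bar_C (c : ℂ) : bar (LaurentPolynomial.C c) = LaurentPolynomial.C (starRingEnd ℂ c) := by
  have : AddMonoidAlgebra.mapRingHom ℤ (starRingEnd ℂ) (LaurentPolynomial.C c) =
      LaurentPolynomial.C (starRingEnd ℂ c) := by
    exact AddMonoidAlgebra.mapRingHom_single _ _ _
  simp [bar, this]

lemma bar_T (m : ℤ) : bar (LaurentPolynomial.T m) = LaurentPolynomial.T (-m) := by
  have : AddMonoidAlgebra.mapRingHom ℤ (starRingEnd ℂ) (LaurentPolynomial.T m) =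
      LaurentPolynomial.T m := by
    exact (AddMonoidAlgebra.mapRingHom_single _ _ _).trans (by rw [map_one]; rfl)
  simp [bar, this]

lemma bar_rootUnit_inv (n k : ℕ) (q : ℝ) :
    bar (((rootUnit n k q)⁻¹ : Scalarsˣ) : Scalars) = (rootUnit n k q : Scalars) := by
  rw [rootUnit_val, rootUnit_inv_val, map_mul, bar_C, bar_T,
    Complex.inv_eq_conj (norm_zetaPow n k q), Complex.conj_conj, neg_neg]

variable {n : ℕ}

lemma bar_zVar : bar (zVar n) * zVar n = 1 := by
  rw [zVar, bar_T, ← LaurentPolynomial.T_add, neg_add_cancel, LaurentPolynomial.T_zero]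

lemma finite_support_extCoeff (f : States n) : (Function.support (extCoeff f)).Finite := by
  refine (f.support.finite_toSet.image fun m i => ((m i : ℕ) : ℤ)).subset ?_
  intro M hM
  by_cases h : ∀ i, 0 ≤ M i
  · obtain ⟨m, rfl⟩ := exists_natCast_eq h
    rw [Function.mem_support, extCoeff_natCast] at hM
    exact ⟨m, by simpa using hM, rfl⟩
  · push Not at h
    obtain ⟨i, hi⟩ := h
    exact absurd (extCoeff_of_neg f hi) hM

lemma natCast_injective : Function.Injective (fun (m : Fin n → ℕ) (i : Fin n) => (m i : ℤ)) := by
  intro m m' h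
  funext i
  exact Int.ofNat_inj.mp (congrFun h i)

/-- A sum over all integer tuples can be translated by a hop shift without boundary terms. -/
lemma scalarProd_eq_finsum (f g : States n) :
    scalarProd f g = ∑ᶠ M : Fin n → ℤ, bar (extCoeff f M) * extCoeff g M := by
  classical
  rw [finsum_eq_sum_of_support_subset (s := f.support.image fun m i => ((m i : ℕ) : ℤ)),
    Finset.sum_image natCast_injective.injOn, scalarProd, Finsupp.sum]
  · refine Finset.sum_congr rfl fun m _ => ?_
    rw [extCoeff_natCast, extCoeff_natCast]
  · intro M hM
    rw [Function.mem_support] at hM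
    have hf : extCoeff f M ≠ 0 := by
      intro h; rw [h, map_zero, zero_mul] at hM; exact hM rfl
    by_cases h : ∀ i, 0 ≤ M i
    · obtain ⟨m, rfl⟩ := exists_natCast_eq h
      rw [extCoeff_natCast] at hf
      simp only [Finset.coe_image]
      exact ⟨m, by simpa using hf, rfl⟩
    · push Not at h
      obtain ⟨i, hi⟩ := h
      exact absurd (extCoeff_of_neg f hi) hf

lemma scalarProd_eq_sum (f g : States n) (s : Finset (Fin n → ℕ)) (hs : f.support ⊆ s) :
    scalarProd f g = ∑ m ∈ s, bar (f m) * g m :=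
  Finsupp.sum_of_support_subset f hs _ fun m _ => by rw [map_zero, zero_mul]

lemma scalarProd_smul_left (c : Scalars) (f g : States n) :
    scalarProd (c • f) g = bar c * scalarProd f g := by
  rw [scalarProd_eq_sum (c • f) g f.support Finsupp.support_smul,
    scalarProd_eq_sum f g f.support le_rfl, Finset.mul_sum]
  refine Finset.sum_congr rfl fun m _ => ?_
  rw [Finsupp.smul_apply, smul_eq_mul, map_mul, mul_assoc]

lemma scalarProd_smul_right (c : Scalars) (f g : States n) :
    scalarProd f (c • g) = c * scalarProd f g := by
  rw [scalarProd_eq_sum f (c • g) f.support le_rfl,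
    scalarProd_eq_sum f g f.support le_rfl, Finset.mul_sum]
  refine Finset.sum_congr rfl fun m _ => ?_
  rw [Finsupp.smul_apply, smul_eq_mul, mul_left_comm]

variable [NeZero n]

/-- The adjoint of `e_r(𝒜)` is `z⁻¹ e_{n-r}(𝒜)`. -/
lemma zVar_mul_scalarProd_elemA {r : ℕ} (hr : r ≤ n) (f g : States n) :
    zVar n * scalarProd (elemA n r f) g = scalarProd f (elemA n (n - r : ℕ) g) := by
  classical
  have e1 : ∀ M : Fin n → ℤ, bar (extCoeff (elemA n r f) M) * extCoeff g M =
      ∑ I ∈ (Finset.univ : Finset (Fin n)).powersetCard r,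
        bar (if 0 ∈ I then zVar n else 1) * (bar (extCoeff f (M - hopShift I)) * extCoeff g M) := by
    intro M
    by_cases h : ∀ i, 0 ≤ M i
    · obtain ⟨m, rfl⟩ := exists_natCast_eq h
      rw [extCoeff_natCast (elemA n r f), elemA_apply, map_sum, Finset.sum_mul]
      refine Finset.sum_congr rfl fun I _ => ?_
      rw [map_mul, mul_assoc]
    · push Not at h
      obtain ⟨i, hi⟩ := h
      simp [extCoeff_of_neg g hi]
  have e2 : ∀ M : Fin n → ℤ, bar (extCoeff f M) * extCoeff (elemA n (n - r : ℕ) g) M =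
      ∑ I ∈ (Finset.univ : Finset (Fin n)).powersetCard (n - r),
        (if 0 ∈ I then zVar n else 1) * (bar (extCoeff f M) * extCoeff g (M - hopShift I)) := by
    intro M
    by_cases h : ∀ i, 0 ≤ M i
    · obtain ⟨m, rfl⟩ := exists_natCast_eq h
      rw [extCoeff_natCast (elemA n (n - r : ℕ) g), elemA_apply, Finset.mul_sum]
      refine Finset.sum_congr rfl fun I _ => ?_
      rw [mul_left_comm]
    · push Not at h
      obtain ⟨i, hi⟩ := h
      simp [extCoeff_of_neg f hi]
  rw [scalarProd_eq_finsum, scalarProd_eq_finsum, finsum_congr e1, finsum_congr e2,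
    finsum_sum_comm, finsum_sum_comm, Finset.mul_sum]
  -- The complementary set has the opposite shift, so translating the sum by `hopShift I` matches
  -- the terms. Exactly one of `I` and `Iᶜ` contains `0`, and `bar z * z = 1` balances the weights.
  · refine Finset.sum_bij' (fun I _ => Iᶜ) (fun I _ => Iᶜ) ?_ ?_ (by simp) (by simp) ?_
    · intro I hI
      rw [Finset.mem_powersetCard] at hI ⊢
      rw [Finset.card_compl, hI.2, Fintype.card_fin]
      exact ⟨Finset.subset_univ _, rfl⟩
    · intro I hI
      rw [Finset.mem_powersetCard] at hI ⊢
      rw [Finset.card_compl, hI.2, Fintype.card_fin]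
      exact ⟨Finset.subset_univ _, by omega⟩
    · intro I _
      rw [← mul_finsum, ← mul_finsum, ← mul_assoc]
      · congr 1
        · by_cases h : (0 : Fin n) ∈ I
          · simp [h, mul_comm (zVar n), bar_zVar]
          · simp [h]
        · rw [← finsum_comp_equiv (Equiv.addRight (hopShift I))]
          refine finsum_congr fun M => ?_
          simp [hopShift_compl]
  · intro I _
    exact ((finite_support_extCoeff f).subset fun M hM h => hM (by simp [h]))
  · intro I _
    exact ((finite_support_extCoeff g).subset fun M hM h => hM (by simp [h]))

end ScalarProduct

/-! ### Recovering the diagram from the dual roots. -/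

section Separation

lemma exists_eq_of_genE_eq {R : Type*} [CommRing R] [IsDomain R] {ι : Type*} [Fintype ι]
    {w v : ι → Rˣ} (h : genE (fun i => (w i : R)) = genE fun i => (v i : R)) (j : ι) :
    ∃ i, w j = v i := by
  have hpoly : ∀ u : ι → Rˣ, genE (fun i => (u i : R)) =
      ((∏ i, (1 + Polynomial.C (u i : R) * Polynomial.X) : Polynomial R) : PowerSeries R) := by
    intro u
    rw [← Polynomial.coeToPowerSeries.ringHom_apply, map_prod]
    simp [genE]
  rw [hpoly, hpoly, Polynomial.coe_inj] at h
  have h2 := congrArg (Polynomial.eval (-(((w j)⁻¹ : Rˣ) : R))) h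
  simp only [Polynomial.eval_prod, Polynomial.eval_add, Polynomial.eval_one, Polynomial.eval_mul,
    Polynomial.eval_C, Polynomial.eval_X] at h2
  rw [Finset.prod_eq_zero (Finset.mem_univ j) (by simp)] at h2
  obtain ⟨i, _, hi⟩ := Finset.prod_eq_zero_iff.mp h2.symm
  refine ⟨i, Units.ext ?_⟩
  have h3 : (v i : R) * (((w j)⁻¹ : Rˣ) : R) = 1 := by linear_combination -hi
  calc (w j : R) = (v i : R) * (((w j)⁻¹ : Rˣ) : R) * w j := by rw [h3, one_mul]
    _ = v i := by simp

variable {n k : ℕ}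

lemma exists_int_of_zetaPow_eq (hn : 0 < n) {a b : ℝ} (h : zetaPow n k a = zetaPow n k b) :
    ∃ q : ℤ, a = b + q * (n + k) := by
  rw [zetaPow, zetaPow, Complex.exp_eq_exp_iff_exists_int] at h
  obtain ⟨q, hq⟩ := h
  refine ⟨q, ?_⟩
  have h0 : ((k : ℂ) + n) ≠ 0 := by
    have : (k + n : ℕ) ≠ 0 := by omega
    exact_mod_cast this
  have : (a : ℂ) = b + q * (n + k) := by
    field_simp at hq
    linear_combination hq
  exact_mod_cast this

lemma rootUnit_eq_iff {a b : ℝ} : rootUnit n k a = rootUnit n k b ↔ zetaPow n k a = zetaPow n k b := by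
  refine ⟨fun h => ?_, fun h => Units.ext (by rw [rootUnit_val, rootUnit_val, h])⟩
  have h1 := congrArg (fun u : Scalarsˣ => (u : Scalars) * LaurentPolynomial.T (-1)) h
  simp only [rootUnit_val, mul_assoc, ← LaurentPolynomial.T_add] at h1
  exact RingHom.injective LaurentPolynomial.C (by simpa using h1)

/-- Equal root sets match the exponents up to a permutation and multiples `q j` of `n + k`. The size
bounds and the trace force all `q j` and the offset `D` to vanish, so the strictly decreasing
sequences `rowLen j - j` have the same range. -/
lemma eq_of_genE_dualRoot_eq_aux (hn : 0 < n) {σ τ : YoungDiagram} (hσ1 : σ.colLen 0 ≤ n - 1)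
    (hσ2 : σ.rowLen 0 ≤ k) (hτ1 : τ.colLen 0 ≤ n - 1)
    (hcard : τ.card ≤ σ.card)
    (h : (genE fun j => (dualRoot n k σ j : Scalars)) = genE fun j => (dualRoot n k τ j : Scalars)) :
    σ = τ := by
  choose π hπ using exists_eq_of_genE_eq h
  have hπinj : Function.Injective π := by
    intro i j hij
    apply dualRoot_injective hn hσ1 hσ2
    rw [hπ, hπ, hij]
  have hπbij : Function.Bijective π := hπinj.bijective_of_finite
  have hq : ∀ j, ∃ q : ℤ, xi n σ j = xi n τ (π j) + q * (n + k) := fun j =>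
    exists_int_of_zetaPow_eq hn (rootUnit_eq_iff.mp (hπ j))
  choose q hq using hq
  have hn' : (n : ℝ) ≠ 0 := by exact_mod_cast hn.ne'
  -- `D` is `(|σ| - |τ|) / n`; the relation at row `0` exhibits it as an integer.
  let D : ℤ := q ⟨0, hn⟩ * (n + k) + ((σ.rowLen 0 : ℤ) - 0) - (τ.rowLen (π ⟨0, hn⟩) - (π ⟨0, hn⟩ : ℕ))
  have hD : (D : ℝ) = ((σ.card : ℝ) - τ.card) / n := by
    have := hq ⟨0, hn⟩
    simp only [xi] at this
    simp only [D]
    push_cast at this ⊢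
    rw [sub_div]
    linarith
  have hrel : ∀ j : Fin n, (τ.rowLen (π j) : ℤ) - (π j : ℕ) - (σ.rowLen j - (j : ℕ)) + D =
      q j * (n + k) := by
    intro j
    have h1 := hq j
    simp only [xi] at h1
    have : ((τ.rowLen (π j) : ℤ) - (π j : ℕ) - (σ.rowLen j - (j : ℕ)) + D : ℝ) =
        q j * (n + k) := by
      rw [hD, sub_div]
      push_cast
      linarith
    exact_mod_cast this
  have hcardσ := card_eq_sum_rowLen σ (l := n) (by omega)
  have hcardτ := card_eq_sum_rowLen τ (l := n) (by omega)
  have hcσ : ∑ j : Fin n, (σ.rowLen j : ℤ) = σ.card := by rw [hcardσ]; push_cast; rfl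
  have hcτ : ∑ j : Fin n, (τ.rowLen j : ℤ) = τ.card := by rw [hcardτ]; push_cast; rfl
  have hDn : D * n = (σ.card : ℤ) - τ.card := by
    have : (D * n : ℝ) = (σ.card : ℝ) - τ.card := by rw [hD]; field_simp
    exact_mod_cast this
  have hD0 : 0 ≤ D := by
    by_contra! hneg
    have : D * n < 0 := mul_neg_of_neg_of_pos hneg (by exact_mod_cast hn)
    have : (τ.card : ℤ) ≤ σ.card := by exact_mod_cast hcard
    omega
  have hle : ∀ (ν : YoungDiagram), ν.rowLen 0 ≤ k → ∀ j : ℕ, ν.rowLen j ≤ k := fun ν hν j =>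
    (ν.rowLen_anti 0 j (Nat.zero_le _)).trans hν
  -- With `D ≥ 0` the left side of `hrel` is at least `-(n - 1) - k`, which exceeds `-(n + k)`.
  have hq0 : ∀ j, 0 ≤ q j := by
    intro j
    have h1 := hrel j
    have h2 := hle σ hσ2 j
    have h3 := (π j).is_lt
    by_contra! hneg
    have : q j * (n + k : ℤ) ≤ (-1) * (n + k) :=
      mul_le_mul_of_nonneg_right (by omega) (by omega)
    omega
  have hqsum : (∑ j, q j) * (n + k : ℤ) = 0 := by
    rw [Finset.sum_mul, ← Finset.sum_congr rfl fun j _ => hrel j]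
    simp only [Finset.sum_add_distrib, Finset.sum_sub_distrib, Finset.sum_const, Finset.card_fin,
      nsmul_eq_mul]
    rw [hπbij.sum_comp (fun j : Fin n => (τ.rowLen j : ℤ)),
      hπbij.sum_comp (fun j : Fin n => ((j : ℕ) : ℤ)), hcσ, hcτ]
    linarith
  have hqz : ∀ j, q j = 0 := by
    have : ∑ j, q j = 0 := by
      rcases mul_eq_zero.mp hqsum with h1 | h1
      · exact h1
      · omega
    intro j
    exact (Finset.sum_eq_zero_iff_of_nonneg fun j _ => hq0 j).mp this j (Finset.mem_univ j)
  -- The last row of `σ` is empty, and there `hrel` writes `D` as minus a sum of nonnegative terms.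
  have hlast : D = 0 := by
    have h1 := hrel ⟨n - 1, by omega⟩
    rw [hqz, zero_mul] at h1
    have h2 : σ.rowLen (n - 1) = 0 := rowLen_eq_zero _ hσ1
    have h3 := (π ⟨n - 1, by omega⟩).is_lt
    simp only at h1
    rw [h2] at h1
    omega
  have hanti : ∀ ν : YoungDiagram, StrictMono fun j : Fin n => -((ν.rowLen j : ℤ) - (j : ℕ)) := by
    intro ν i j hij
    have := ν.rowLen_anti i j (le_of_lt hij)
    have : (i : ℕ) < j := hij
    simp only
    omega
  have hrange := (hanti σ).range_inj (hanti τ)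
  have heq : (fun j : Fin n => -((σ.rowLen j : ℤ) - (j : ℕ))) =
      fun j : Fin n => -((τ.rowLen j : ℤ) - (j : ℕ)) := by
    rw [← hrange, ← hπbij.surjective.range_comp (fun j : Fin n => -((τ.rowLen j : ℤ) - (j : ℕ)))]
    congr 1
    funext j
    have := hrel j
    rw [hqz, hlast, zero_mul] at this
    simp only [Function.comp_apply]
    omega
  refine ext_rowLen fun i => ?_
  rcases Nat.lt_or_ge i n with hi | hi
  · have := congrFun heq ⟨i, hi⟩
    simp only at this
    omega
  · rw [rowLen_eq_zero σ (by omega), rowLen_eq_zero τ (by omega)]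

/-- The diagram is determined by the dual roots. -/
lemma eq_of_genE_dualRoot_eq (hn : 0 < n) {σ τ : YoungDiagram} (hσ1 : σ.colLen 0 ≤ n - 1)
    (hσ2 : σ.rowLen 0 ≤ k) (hτ1 : τ.colLen 0 ≤ n - 1) (hτ2 : τ.rowLen 0 ≤ k)
    (h : (genE fun j => (dualRoot n k σ j : Scalars)) = genE fun j => (dualRoot n k τ j : Scalars)) :
    σ = τ := by
  rcases le_total τ.card σ.card with hc | hc
  · exact eq_of_genE_dualRoot_eq_aux hn hσ1 hσ2 hτ1 hc h
  · exact (eq_of_genE_dualRoot_eq_aux hn hτ1 hτ2 hσ1 hc h.symm).symm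

end Separation

/-! ### The Cauchy–Binet expansion. -/

section CauchyBinet

variable {S : Type*} [CommRing S]

/-- Multilinearity in the rows picks one summation index per row. The choices are left ungrouped;
`sum_perm_prod_mul_det` collects those that permute one sequence. -/
lemma det_sum_mul_eq_sum {l : ℕ} (T W : Fin l → ℕ → S) (A : Finset ℕ) :
    (Matrix.of fun i j => ∑ a ∈ A, T i a * W j a).det =
      ∑ f ∈ Fintype.piFinset fun _ : Fin l => A,
        (∏ i, T i (f i)) * (Matrix.of fun i j => W j (f i)).det := by
  classical
  have h : (Matrix.of fun i j => ∑ a ∈ A, T i a * W j a : Matrix (Fin l) (Fin l) S) =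
      fun i => ∑ a ∈ A, fun j => T i a * W j a := by
    ext i j
    rw [Finset.sum_apply, Matrix.of_apply]
  rw [h]
  refine (MultilinearMap.map_sum_finset
    (Matrix.detRowAlternating (R := S) (n := Fin l)).toMultilinearMap
    (fun (i : Fin l) (a : ℕ) => fun j : Fin l => T i a * W j a) (fun _ => A)).trans ?_
  exact Finset.sum_congr rfl fun f _ => Matrix.det_mul_column (fun i => T i (f i))
    (Matrix.of fun i j => W j (f i))

lemma sum_perm_prod_mul_det {l : ℕ} (T W : Fin l → ℕ → S) (e : Fin l → ℕ) :
    ∑ π : Equiv.Perm (Fin l), (∏ i, T i (e (π i))) * (Matrix.of fun i j => W j (e (π i))).det =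
      (Matrix.of fun i j => T j (e i)).det * (Matrix.of fun i j => W j (e i)).det := by
  rw [Matrix.det_apply', Finset.sum_mul]
  refine Finset.sum_congr rfl fun π _ => ?_
  have := Matrix.det_permute π (Matrix.of fun i j => W j (e i))
  rw [show (Matrix.of fun i j => W j (e (π i)) : Matrix (Fin l) (Fin l) S) =
    (Matrix.of fun i j => W j (e i)).submatrix π id from rfl, this]
  simp only [Matrix.of_apply]
  ring

end CauchyBinet

/-! ### Configurations as exponent sets. -/

section LevelSets

variable {n : ℕ} [NeZero n]

lemma conj_eq_of_sub (M : Fin n → ℤ) (c : ℕ → ℤ) (hc : c n = 0)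
    (h : ∀ i : Fin n, M (i + 1) = c i - c (i + 1)) {i : ℕ} (hi : i ≤ n) : conj M i = c i := by
  induction hi using Nat.decreasingInduction with
  | self => rw [conj_eq_zero M le_rfl, hc]
  | of_succ i hi ih =>
    have := conj_eq_add M ⟨i, hi⟩
    simp only at this
    rw [this, ih, h]
    ring

lemma eq_of_conj_eq {M M' : Fin n → ℤ} (h : ∀ i : Fin n, conj M i = conj M' i) : M = M' := by
  have h' : ∀ i : ℕ, conj M i = conj M' i := fun i => by
    rcases Nat.lt_or_ge i n with hi | hi
    · exact h ⟨i, hi⟩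
    · rw [conj_eq_zero M hi, conj_eq_zero M' hi]
  funext j
  obtain ⟨j, rfl⟩ := exists_add_one j
  have h1 := conj_eq_add M j
  have h2 := conj_eq_add M' j
  rw [h', h'] at h1
  linarith

lemma exists_conj_eq (c : ℕ → ℤ) (hc : c n = 0) (h : ∀ i < n, c (i + 1) ≤ c i) :
    ∃ m : Fin n → ℕ, ∀ i ≤ n, conj (fun j => (m j : ℤ)) i = c i := by
  refine ⟨fun j => (c (j - 1 : Fin n) - c ((j - 1 : Fin n) + 1)).toNat, fun i hi =>
    conj_eq_of_sub _ c hc (fun i => ?_) hi⟩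
  simp only [add_sub_cancel_right]
  exact Int.toNat_of_nonneg (sub_nonneg.mpr (h i i.is_lt))

/-- The configurations of `k` particles. -/
def levelSet (n k : ℕ) : Finset (Fin n → ℕ) := Finset.piAntidiag Finset.univ k

omit [NeZero n] in
lemma mem_levelSet {k : ℕ} {m : Fin n → ℕ} : m ∈ levelSet n k ↔ ∑ i, m i = k := by
  simp [levelSet, Finset.mem_piAntidiag]

/-- The exponents of a configuration as natural numbers. -/
def natExponents (m : Fin n → ℕ) (i : Fin n) : ℕ := (exponents (fun j => (m j : ℤ)) i).toNat

lemma natExponents_cast (m : Fin n → ℕ) (i : Fin n) :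
    (natExponents m i : ℤ) = exponents (fun j => (m j : ℤ)) i := by
  rw [natExponents, Int.toNat_of_nonneg]
  have := conj_nonneg (M := fun j => (m j : ℤ)) (fun j => Int.natCast_nonneg _) i
  have := i.is_lt
  rw [exponents]
  omega

lemma natExponents_strictAnti (m : Fin n → ℕ) : StrictAnti (natExponents m) := by
  have h : ∀ i j : ℕ, i ≤ j → conj (fun j => (m j : ℤ)) j ≤ conj (fun j => (m j : ℤ)) i := by
    intro i j hij
    refine Finset.sum_le_sum fun a _ => ?_
    split_ifs <;> first | omega | simp
  intro i j hij
  have h1 := natExponents_cast m i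
  have h2 := natExponents_cast m j
  have h3 := h i j (le_of_lt hij)
  have h4 : (i : ℕ) < j := hij
  rw [exponents] at h1 h2
  omega

lemma natExponents_zero {k : ℕ} {m : Fin n → ℕ} (hm : m ∈ levelSet n k) :
    natExponents m 0 = n + k - 1 := by
  have h1 := natExponents_cast m 0
  have h2 : (∑ i, (m i : ℤ)) = k := by exact_mod_cast mem_levelSet.mp hm
  rw [exponents, Fin.val_zero, conj_zero, h2] at h1
  have := NeZero.pos n
  omega

lemma natExponents_injective : Function.Injective (natExponents : (Fin n → ℕ) → Fin n → ℕ) := by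
  intro m m' h
  refine natCast_injective (eq_of_conj_eq fun i => ?_)
  have h1 := natExponents_cast m i
  have h2 := natExponents_cast m' i
  rw [h, h2, exponents, exponents] at h1
  linarith

/-- Strict decrease of `g` says that the occupations are nonnegative; its leading value fixes the
level, because row `0` counts all particles. -/
lemma exists_natExponents_eq {k : ℕ} {g : Fin n → ℕ} (hg : StrictAnti g)
    (h0 : g 0 = n + k - 1) : ∃ m ∈ levelSet n k, natExponents m = g := by
  have hn := NeZero.pos n
  let c : ℕ → ℤ := fun i => if h : i < n then (g ⟨i, h⟩ : ℤ) - (n - 1) + i else 0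
  have hc : ∀ i (h : i < n), c i = (g ⟨i, h⟩ : ℤ) - (n - 1) + i := fun i h => by simp [c, h]
  obtain ⟨m, hm⟩ := exists_conj_eq (n := n) c (by simp [c]) (by
    intro i hi
    rcases Nat.lt_or_ge (i + 1) n with h | h
    · have := hg (show (⟨i, hi⟩ : Fin n) < ⟨i + 1, h⟩ from Nat.lt_succ_self i)
      rw [hc i hi, hc _ h]
      push_cast
      omega
    · rw [hc i hi]
      simp only [c, not_lt.mpr h, dif_neg, not_false_iff]
      omega)
  refine ⟨m, ?_, ?_⟩
  · rw [mem_levelSet]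
    have h1 := hm 0 (Nat.zero_le _)
    rw [conj_zero, hc 0 hn] at h1
    have h2 : g ⟨0, hn⟩ = n + k - 1 := h0
    rw [h2] at h1
    have h3 : (∑ i, (m i : ℤ)) = k := by rw [h1]; push_cast; omega
    exact_mod_cast h3
  · funext i
    have h1 := natExponents_cast m i
    rw [exponents, hm i i.is_lt.le, hc i i.is_lt] at h1
    simp only [Fin.eta] at h1
    omega

/-- An injective `f` with maximum `n + k - 1` is a permutation of the exponents of exactly one
configuration. The condition on the maximum is imposed by subtracting the functions with smaller
values. -/
lemma sum_levelSet_perm {S : Type*} [CommRing S] (k : ℕ) (F : (Fin n → ℕ) → S)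
    (hF : ∀ f, ¬ Function.Injective f → F f = 0) :
    ∑ m ∈ levelSet n k, ∑ π : Equiv.Perm (Fin n), F (natExponents m ∘ π) =
      ∑ f ∈ (Fintype.piFinset fun _ : Fin n => Finset.range (n + k)), F f -
        ∑ f ∈ (Fintype.piFinset fun _ : Fin n => Finset.range (n + k - 1)), F f := by
  classical
  have hn := NeZero.pos n
  have hsub : (Fintype.piFinset fun _ : Fin n => Finset.range (n + k - 1)) ⊆
      Fintype.piFinset fun _ : Fin n => Finset.range (n + k) :=
    Fintype.piFinset_subset _ _ fun _ => Finset.range_mono (by omega)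
  rw [← Finset.sum_sdiff hsub, add_sub_cancel_right, Finset.sum_sigma']
  have hmem : ∀ f : Fin n → ℕ, f ∈ (Fintype.piFinset fun _ : Fin n => Finset.range (n + k)) \
      (Fintype.piFinset fun _ : Fin n => Finset.range (n + k - 1)) ↔
      (∀ i, f i < n + k) ∧ ∃ i, f i = n + k - 1 := by
    intro f
    simp only [Finset.mem_sdiff, Fintype.mem_piFinset, Finset.mem_range]
    constructor
    · rintro ⟨h1, h2⟩
      push Not at h2
      obtain ⟨i, hi⟩ := h2
      exact ⟨h1, i, by have := h1 i; omega⟩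
    · rintro ⟨h1, i, hi⟩
      exact ⟨h1, fun h => by have := h i; omega⟩
  refine Finset.sum_of_injOn (fun p => natExponents p.1 ∘ p.2) ?_ ?_ ?_ ?_
  · rintro ⟨m, π⟩ _ ⟨m', π'⟩ _ h
    simp only at h
    have hr : Set.range (natExponents m) = Set.range (natExponents m') := by
      rw [← π.surjective.range_comp (natExponents m), h, π'.surjective.range_comp]
    have hm : natExponents m = natExponents m' := by
      have h1 : StrictMono fun i : Fin n => natExponents m i.rev := fun i j hij =>
        natExponents_strictAnti m (Fin.rev_lt_rev.mpr hij)
      have h2 : StrictMono fun i : Fin n => natExponents m' i.rev := fun i j hij =>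
        natExponents_strictAnti m' (Fin.rev_lt_rev.mpr hij)
      have h3 : (fun i : Fin n => natExponents m i.rev) = fun i : Fin n => natExponents m' i.rev := by
        refine (h1.range_inj h2).mp ?_
        have e1 := (Fin.rev_surjective (n := n)).range_comp (natExponents m)
        have e2 := (Fin.rev_surjective (n := n)).range_comp (natExponents m')
        exact e1.trans (hr.trans e2.symm)
      funext i
      simpa using congrFun h3 i.rev
    have hm' := natExponents_injective hm
    subst hm'
    congr 1
    ext i
    have := (natExponents_strictAnti m).injective (congrFun h i)
    rw [this]
  · rintro ⟨m, π⟩ hp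
    simp only [Finset.coe_sigma, Set.mem_sigma_iff, Finset.mem_coe, Finset.mem_univ,
      and_true] at hp
    rw [Finset.mem_coe, hmem]
    have h0 := natExponents_zero hp
    refine ⟨fun i => ?_, π.symm 0, by simpa using h0⟩
    have := (natExponents_strictAnti m).antitone (Fin.zero_le (π i))
    simp only [Function.comp_apply]
    omega
  · intro f hf hnot
    apply hF
    intro hinj
    apply hnot
    rw [hmem] at hf
    obtain ⟨hlt, i, hi⟩ := hf
    let π : Equiv.Perm (Fin n) := Fin.revPerm.trans (Tuple.sort f)
    have hg : StrictAnti (f ∘ π) := by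
      have h1 : StrictMono (f ∘ Tuple.sort f) :=
        (Tuple.monotone_sort f).strictMono_of_injective (hinj.comp (Tuple.sort f).injective)
      intro a b hab
      exact h1 (Fin.rev_lt_rev.mpr hab)
    have hg0 : (f ∘ π) 0 = n + k - 1 := by
      have h1 := hg.antitone (Fin.zero_le (π.symm i))
      have h2 := hlt (π 0)
      simp only [Function.comp_apply, Equiv.apply_symm_apply, hi] at h1 ⊢
      omega
    obtain ⟨m, hm, hme⟩ := exists_natExponents_eq hg hg0
    refine ⟨⟨m, π.symm⟩, by simpa using hm, ?_⟩
    funext a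
    simp [hme]
  · intro p _
    rfl

end LevelSets

/-! ### The norm of an alternant. -/

section Norm

variable {R : Type*} [CommRing R] [IsDomain R]

lemma sum_range_pow_eq_zero {N : ℕ} {q : R} (hq : q ^ N = 1) (h1 : q ≠ 1) :
    ∑ a ∈ Finset.range N, q ^ a = 0 := by
  have := mul_geom_sum q N
  rw [hq, sub_self] at this
  exact (mul_eq_zero.mp this).resolve_left (sub_ne_zero.mpr h1)

-- A scalar matrix minus a matrix of rank one, by the matrix determinant lemma. The inverse `c` of
-- `N` is an argument because the ring need not be a field.
omit [IsDomain R] in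
lemma det_scalar_sub_eq {n : ℕ} (N c : R) (hc : N * c = 1) (v u : Fin n → R)
    (huv : ∀ i, u i * v i = 1) :
    (Matrix.of fun i j => (if i = j then N else 0) - v i * u j).det = N ^ n - n * (N ^ n * c) := by
  have h : (Matrix.of fun i j => (if i = j then N else 0) - v i * u j : Matrix (Fin n) (Fin n) R) =
      N • (1 + Matrix.replicateCol Unit (fun i => -(c * v i)) * Matrix.replicateRow Unit u) := by
    ext i j
    simp only [Matrix.of_apply, Matrix.smul_apply, Matrix.add_apply, Matrix.one_apply,
      Matrix.mul_apply, Matrix.replicateCol_apply, Matrix.replicateRow_apply, Finset.univ_unique,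
      Finset.sum_singleton, smul_eq_mul]
    rw [mul_add, sub_eq_add_neg]
    congr 1
    · split_ifs <;> simp
    · linear_combination (v i * u j) * hc
  rw [h, Matrix.det_smul, Fintype.card_fin, Matrix.det_one_add_replicateCol_mul_replicateRow]
  have h2 : u ⬝ᵥ (fun i => -(c * v i)) = -(n * c) := by
    rw [dotProduct]
    have : ∀ i, u i * -(c * v i) = -c := fun i => by linear_combination (-c) * huv i
    simp only [this, Finset.sum_const, Finset.card_fin, nsmul_eq_mul]
    ring
  rw [h2]
  ring

/-- The norm of an alternant, summed over the configurations of `k` particles. -/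
lemma sum_alternant_mul_alternant {n : ℕ} [NeZero n] (k : ℕ) (t : Fin n → Rˣ)
    (ht : Function.Injective t) {τ : Rˣ} (hτ : ∀ j, t j ^ (n + k) = τ) (c : R)
    (hc : ((n + k : ℕ) : R) * c = 1) :
    ∑ m ∈ levelSet n k, alternant t (exponents fun j => (m j : ℤ)) *
        alternant (fun j => (t j)⁻¹) (exponents fun j => (m j : ℤ)) =
      n * (((n + k : ℕ) : R) ^ n * c) := by
  have hn := NeZero.pos n
  set T : Fin n → ℕ → R := fun i a => (t i : R) ^ a with hT
  set W : Fin n → ℕ → R := fun i a => (((t i)⁻¹ : Rˣ) : R) ^ a with hW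
  have h1 : ∀ m ∈ levelSet n k, alternant t (exponents fun j => (m j : ℤ)) *
        alternant (fun j => (t j)⁻¹) (exponents fun j => (m j : ℤ)) =
      ∑ π : Equiv.Perm (Fin n), (∏ i, T i ((natExponents m ∘ π) i)) *
        (Matrix.of fun i j => W j ((natExponents m ∘ π) i)).det := by
    intro m _
    refine Eq.trans ?_ (sum_perm_prod_mul_det T W (natExponents m)).symm
    simp only [alternant, ← natExponents_cast, zpow_natCast, Units.val_pow_eq_pow_val, hT, hW]
  rw [Finset.sum_congr rfl h1, sum_levelSet_perm k (fun f => (∏ i, T i (f i)) *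
    (Matrix.of fun i j => W j (f i)).det), ← det_sum_mul_eq_sum, ← det_sum_mul_eq_sum]
  · have hTW : ∀ i j a, T i a * W j a = ((t i * (t j)⁻¹ : Rˣ) : R) ^ a := by
      intro i j a
      simp only [hT, hW, Units.val_mul, mul_pow]
    -- Over a full period the Gram matrix is scalar: the ratios `t_i / t_j` are nontrivial
    -- `(n+k)`-th roots of unity for `i ≠ j`. Omitting the top exponent subtracts a matrix of rank
    -- one.
    have hG : ∀ i j, ∑ a ∈ Finset.range (n + k), T i a * W j a =
        if i = j then ((n + k : ℕ) : R) else 0 := by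
      intro i j
      simp only [hTW]
      split_ifs with h
      · subst h; simp
      · refine sum_range_pow_eq_zero ?_ ?_
        · rw [← Units.val_pow_eq_pow_val, mul_pow, inv_pow, hτ, hτ, mul_inv_cancel, Units.val_one]
        · intro h'
          exact h (ht (mul_inv_eq_one.mp (Units.ext h')))
    have hG' : ∀ i j, ∑ a ∈ Finset.range (n + k - 1), T i a * W j a =
        (if i = j then ((n + k : ℕ) : R) else 0) - T i (n + k - 1) * W j (n + k - 1) := by
      intro i j
      rw [← hG, eq_sub_iff_add_eq, ← Finset.sum_range_succ, Nat.sub_add_cancel (by omega)]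
    have huv : ∀ i, W i (n + k - 1) * T i (n + k - 1) = 1 := by
      intro i
      rw [mul_comm, hTW, mul_inv_cancel, Units.val_one, one_pow]
    simp only [hG, hG']
    rw [det_scalar_sub_eq _ c hc _ _ huv]
    have : (Matrix.of fun i j : Fin n => if i = j then ((n + k : ℕ) : R) else 0).det =
        ((n + k : ℕ) : R) ^ n := by
      have : (Matrix.of fun i j : Fin n => if i = j then ((n + k : ℕ) : R) else 0) =
          Matrix.diagonal fun _ => ((n + k : ℕ) : R) := by
        ext i j; simp [Matrix.diagonal_apply]
      rw [this, Matrix.det_diagonal, Finset.prod_const, Finset.card_fin]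
    rw [this]
    ring
  · intro f hf
    rw [Function.not_injective_iff] at hf
    obtain ⟨a, b, hab, hne⟩ := hf
    rw [Matrix.det_zero_of_row_eq hne, mul_zero]
    ext j
    simp only [Matrix.of_apply, hab]

end Norm

/-! ### Norms and orthogonality of Bethe vectors. -/

section BetheNorm

variable {n k : ℕ} [NeZero n] {σ : YoungDiagram}

lemma bar_alternant {l : ℕ} (t : Fin l → Scalarsˣ)
    (ht : ∀ j, bar (t j : Scalars) = (((t j)⁻¹ : Scalarsˣ) : Scalars)) (p : Fin l → ℤ) :
    bar (alternant t p) = alternant (fun j => (t j)⁻¹) p := by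
  have hu : ∀ j, Units.map bar.toMonoidHom (t j) = (t j)⁻¹ := fun j => Units.ext (ht j)
  rw [alternant, RingHom.map_det, alternant]
  congr 1
  ext1 i j
  simp only [RingHom.mapMatrix_apply, Matrix.map_apply, Matrix.of_apply]
  rw [← hu, ← map_zpow]
  rfl

omit [NeZero n] in
lemma bar_dualRoot_inv (j : Fin n) :
    bar (((dualRoot n k σ j)⁻¹ : Scalarsˣ) : Scalars) =
      ((((dualRoot n k σ j)⁻¹)⁻¹ : Scalarsˣ) : Scalars) := by
  rw [dualRoot, bar_rootUnit_inv, inv_inv]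

lemma bar_mul_self (a : ℂ) (m : ℤ) :
    bar (LaurentPolynomial.C a * LaurentPolynomial.T m) *
      (LaurentPolynomial.C a * LaurentPolynomial.T m) =
      LaurentPolynomial.C ((‖a‖ ^ 2 : ℝ) : ℂ) := by
  rw [map_mul, bar_C, bar_T, mul_mul_mul_comm, ← map_mul, ← LaurentPolynomial.T_add,
    neg_add_cancel, LaurentPolynomial.T_zero, mul_one, mul_comm, Complex.mul_conj]
  rw [Complex.normSq_eq_norm_sq]

lemma prod_Ioi_rev {M : Type*} [CommMonoid M] {l : ℕ} (F : Fin l → Fin l → M)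
    (hF : ∀ i j, F i j = F j i) :
    ∏ i : Fin l, ∏ j ∈ Finset.Ioi i, F i.rev j.rev = ∏ i : Fin l, ∏ j ∈ Finset.Ioi i, F i j := by
  rw [Finset.prod_sigma', Finset.prod_sigma']
  refine Finset.prod_bij' (fun p _ => ⟨p.2.rev, p.1.rev⟩) (fun p _ => ⟨p.2.rev, p.1.rev⟩)
    ?_ ?_ ?_ ?_ ?_
  · rintro ⟨i, j⟩ h; simpa using h
  · rintro ⟨i, j⟩ h; simpa using h
  · rintro ⟨i, j⟩ h; simp
  · rintro ⟨i, j⟩ h; simp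
  · rintro ⟨i, j⟩ h; exact hF _ _

-- The inverse dual roots are the numbers `ζ^{I_j(σ)}` in reverse order, times a common phase and
-- `z^{-1/n}`. Order, phase and power of `z` all drop out of the product with the conjugate.
omit [NeZero n] in
lemma bar_dualVandermonde_mul_self :
    bar (dualVandermonde n k σ) * dualVandermonde n k σ =
      LaurentPolynomial.C ((‖vandermonde n k σ‖ ^ 2 : ℝ) : ℂ) := by
  have hdiff : ∀ i j : Fin n, (((dualRoot n k σ j)⁻¹ : Scalarsˣ) : Scalars) -
      (((dualRoot n k σ i)⁻¹ : Scalarsˣ) : Scalars) =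
      LaurentPolynomial.C (zetaPow n k (-xi n σ j) - zetaPow n k (-xi n σ i)) *
        LaurentPolynomial.T (-1) := by
    intro i j
    rw [dualRoot, dualRoot, rootUnit_inv_val, rootUnit_inv_val, ← zetaPow_neg, ← zetaPow_neg,
      map_sub, sub_mul]
  have hxi : ∀ j : Fin n, -xi n σ j = -((σ.card : ℝ) / n) + indexI n σ j.rev := by
    intro j
    simp only [xi, indexI, Fin.rev_rev]
    ring
  have hnorm : ∀ i j : Fin n, ‖zetaPow n k (-xi n σ j) - zetaPow n k (-xi n σ i)‖ =
      ‖zetaPow n k (indexI n σ j.rev) - zetaPow n k (indexI n σ i.rev)‖ := by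
    intro i j
    rw [hxi, hxi, zetaPow_add, zetaPow_add, ← mul_sub, norm_mul, norm_zetaPow, one_mul]
  have hsign : ((Equiv.Perm.sign (Fin.revPerm : Equiv.Perm (Fin n)) : ℤˣ) : ℤ) *
      ((Equiv.Perm.sign (Fin.revPerm : Equiv.Perm (Fin n)) : ℤˣ) : ℤ) = 1 := by
    rw [← Units.val_mul, Int.units_mul_self, Units.val_one]
  have hsign' : (((Equiv.Perm.sign (Fin.revPerm : Equiv.Perm (Fin n)) : ℤˣ) : ℤ) : Scalars) *
      ((Equiv.Perm.sign (Fin.revPerm : Equiv.Perm (Fin n)) : ℤˣ) : ℤ) = 1 := by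
    rw [← Int.cast_mul, hsign, Int.cast_one]
  rw [dualVandermonde, alternant_eq_vandermonde, map_mul, map_intCast, mul_mul_mul_comm, hsign',
    one_mul, map_prod, ← Finset.prod_mul_distrib]
  have hterm : ∀ i : Fin n, bar (∏ j ∈ Finset.Ioi i, ((((dualRoot n k σ j)⁻¹ : Scalarsˣ) : Scalars) -
      (((dualRoot n k σ i)⁻¹ : Scalarsˣ) : Scalars))) *
      ∏ j ∈ Finset.Ioi i, ((((dualRoot n k σ j)⁻¹ : Scalarsˣ) : Scalars) -
      (((dualRoot n k σ i)⁻¹ : Scalarsˣ) : Scalars)) =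
      ∏ j ∈ Finset.Ioi i, LaurentPolynomial.C
        ((‖zetaPow n k (indexI n σ i.rev) - zetaPow n k (indexI n σ j.rev)‖ ^ 2 : ℝ) : ℂ) := by
    intro i
    rw [map_prod, ← Finset.prod_mul_distrib]
    refine Finset.prod_congr rfl fun j _ => ?_
    rw [hdiff, bar_mul_self, hnorm, norm_sub_rev]
  rw [Finset.prod_congr rfl fun i _ => hterm i,
    prod_Ioi_rev (fun i j => LaurentPolynomial.C
      ((‖zetaPow n k (indexI n σ i) - zetaPow n k (indexI n σ j)‖ ^ 2 : ℝ) : ℂ))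
      fun i j => by rw [norm_sub_rev]]
  simp only [← map_prod, vandermonde, norm_prod, ← Finset.prod_pow, Complex.ofReal_prod]

lemma vandermonde_ne_zero (h1 : σ.colLen 0 ≤ n - 1) (h2 : σ.rowLen 0 ≤ k) :
    vandermonde n k σ ≠ 0 := by
  intro h
  have h3 := bar_dualVandermonde_mul_self (n := n) (k := k) (σ := σ)
  rw [h] at h3
  simp only [norm_zero, ne_eq, OfNat.ofNat_ne_zero, not_false_eq_true, zero_pow,
    Complex.ofReal_zero, map_zero, mul_eq_zero, dualVandermonde_ne_zero h1 h2, or_false] at h3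
  rw [dualVandermonde, bar_alternant _ bar_dualRoot_inv] at h3
  simp only [inv_inv] at h3
  exact alternant_ne_zero _ (dualRoot_injective (NeZero.pos n) h1 h2) h3

lemma betheState_apply_of_ne {m : Fin n → ℕ} (hm : ∑ i, m i ≠ k) : betheState n k σ m = 0 := by
  have hb : betheState n k σ m = _ := hasDetCoeff_betheVector (betheRoot n k σ) m
  rw [hb, if_neg hm]

lemma support_betheState_subset : (betheState n k σ).support ⊆ levelSet n k := by
  intro m hm
  rw [mem_levelSet]
  by_contra h
  exact (Finsupp.mem_support_iff.mp hm) (betheState_apply_of_ne h)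

lemma scalarProd_betheState (τ : YoungDiagram) :
    scalarProd (betheState n k σ) (betheState n k τ) =
      ∑ m ∈ levelSet n k, bar (betheState n k σ m) * betheState n k τ m :=
  scalarProd_eq_sum _ _ _ support_betheState_subset

/-- The norms of the Bethe vectors. -/
lemma scalarProd_betheState_self (h1 : σ.colLen 0 ≤ n - 1) (h2 : σ.rowLen 0 ≤ k) :
    scalarProd (betheState n k σ) (betheState n k σ) =
      LaurentPolynomial.C
        (((n : ℝ) * ((n : ℝ) + k) ^ (n - 1) / ‖vandermonde n k σ‖ ^ 2 : ℝ) : ℂ) := by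
  have hn := NeZero.pos n
  obtain ⟨τ, hτ⟩ := exists_dualRoot_pow_eq (k := k) hn h2
  have hN : ((n + k : ℕ) : ℂ) ≠ 0 := by exact_mod_cast (by omega : n + k ≠ 0)
  have hc : ((n + k : ℕ) : Scalars) * LaurentPolynomial.C (((n + k : ℕ) : ℂ)⁻¹) = 1 := by
    rw [← map_natCast (LaurentPolynomial.C : ℂ →+* Scalars), ← map_mul, mul_inv_cancel₀ hN, map_one]
  have hsum := sum_alternant_mul_alternant k (fun j => (dualRoot n k σ j)⁻¹)
    (fun i j h => dualRoot_injective hn h1 h2 (inv_injective h)) hτ _ hc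
  have hV := bar_dualVandermonde_mul_self (n := n) (k := k) (σ := σ)
  have hV0 : ‖vandermonde n k σ‖ ≠ 0 := norm_ne_zero_iff.mpr (vandermonde_ne_zero h1 h2)
  have hkey : scalarProd (betheState n k σ) (betheState n k σ) *
      LaurentPolynomial.C ((‖vandermonde n k σ‖ ^ 2 : ℝ) : ℂ) =
      n * (((n + k : ℕ) : Scalars) ^ n * LaurentPolynomial.C (((n + k : ℕ) : ℂ)⁻¹)) := by
    rw [← hsum, ← hV, scalarProd_betheState, Finset.sum_mul]
    refine Finset.sum_congr rfl fun m hm => ?_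
    have hb := extCoeff_betheState_mul (n := n) (k := k) h1 h2 (M := fun j => (m j : ℤ))
      (fun j => Int.natCast_nonneg _)
    have hm' : (∑ i, (m i : ℤ)) = k := by exact_mod_cast mem_levelSet.mp hm
    rw [extCoeff_natCast, if_pos hm'] at hb
    rw [mul_mul_mul_comm, ← map_mul, hb, bar_alternant _ bar_dualRoot_inv, mul_comm]
  have hCne : LaurentPolynomial.C ((‖vandermonde n k σ‖ ^ 2 : ℝ) : ℂ) ≠ (0 : Scalars) := by
    rw [Ne, map_eq_zero_iff _ (RingHom.injective (LaurentPolynomial.C : ℂ →+* Scalars))]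
    exact_mod_cast pow_ne_zero 2 hV0
  refine mul_right_cancel₀ hCne (hkey.trans ?_)
  rw [← map_natCast (LaurentPolynomial.C : ℂ →+* Scalars) n,
    ← map_natCast (LaurentPolynomial.C : ℂ →+* Scalars) (n + k), ← map_pow, ← map_mul, ← map_mul,
    ← map_mul]
  congr 1
  have hV0' : ((‖vandermonde n k σ‖ : ℝ) : ℂ) ≠ 0 := by exact_mod_cast hV0
  have hpow : ((n + k : ℕ) : ℂ) ^ n * (((n + k : ℕ) : ℂ))⁻¹ = ((n + k : ℕ) : ℂ) ^ (n - 1) := by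
    rw [← pow_sub_one_mul hn.ne' ((n + k : ℕ) : ℂ), mul_assoc, mul_inv_cancel₀ hN, mul_one]
  rw [hpow]
  push_cast
  field_simp

lemma scalarProd_betheState_self_ne_zero (h1 : σ.colLen 0 ≤ n - 1) (h2 : σ.rowLen 0 ≤ k) :
    scalarProd (betheState n k σ) (betheState n k σ) ≠ 0 := by
  rw [scalarProd_betheState_self h1 h2, Ne,
    map_eq_zero_iff _ (RingHom.injective (LaurentPolynomial.C : ℂ →+* Scalars)),
    Complex.ofReal_eq_zero]
  have hn : (0 : ℝ) < n := by exact_mod_cast NeZero.pos n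
  have hV := norm_pos_iff.mpr (vandermonde_ne_zero (n := n) h1 h2)
  positivity

/-- Adjointness relates the conjugated eigenvalues of `b_σ` to the eigenvalues of any Bethe vector
that is not orthogonal to it. This applies to `b_σ` itself, whose norm is nonzero, so a second such
vector would have the same eigenvalues and hence the same diagram. -/
lemma scalarProd_betheState_ne {τ : YoungDiagram} (hσ1 : σ.colLen 0 ≤ n - 1)
    (hσ2 : σ.rowLen 0 ≤ k) (hτ1 : τ.colLen 0 ≤ n - 1) (hτ2 : τ.rowLen 0 ≤ k) (hne : σ ≠ τ) :
    scalarProd (betheState n k σ) (betheState n k τ) = 0 := by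
  have hadj : ∀ {ν : YoungDiagram}, ν.colLen 0 ≤ n - 1 → ν.rowLen 0 ≤ k → ∀ r ≤ n,
      zVar n * (bar (PowerSeries.coeff r (genE fun j => (dualRoot n k σ j : Scalars))) *
        scalarProd (betheState n k σ) (betheState n k ν)) =
      PowerSeries.coeff (n - r) (genE fun j => (dualRoot n k ν j : Scalars)) *
        scalarProd (betheState n k σ) (betheState n k ν) := by
    intro ν hν1 hν2 r hr
    have := zVar_mul_scalarProd_elemA hr (betheState n k σ) (betheState n k ν)
    rwa [elemA_natCast_betheState hσ1 hσ2, elemA_natCast_betheState hν1 hν2, scalarProd_smul_left,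
      scalarProd_smul_right] at this
  by_contra h0
  apply hne
  refine eq_of_genE_dualRoot_eq (NeZero.pos n) hσ1 hσ2 hτ1 hτ2 ?_
  ext r
  rcases le_or_gt r n with hr | hr
  · have e1 := hadj hσ1 hσ2 (n - r) (Nat.sub_le _ _)
    have e2 := hadj hτ1 hτ2 (n - r) (Nat.sub_le _ _)
    rw [← mul_assoc, Nat.sub_sub_self hr] at e1 e2
    rw [← mul_right_cancel₀ (scalarProd_betheState_self_ne_zero hσ1 hσ2) e1,
      ← mul_right_cancel₀ h0 e2]
  · rw [← zcoeff_natCast, ← zcoeff_natCast, zcoeff_genE_of_gt _ (by exact_mod_cast hr),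
      zcoeff_genE_of_gt _ (by exact_mod_cast hr)]

end BetheNorm

/-! ### The Bethe basis. -/

section Basis

variable {n k : ℕ} [NeZero n]

lemma exists_level_eq_rowLen {σ : YoungDiagram} (h1 : σ.colLen 0 ≤ n - 1) (h2 : σ.rowLen 0 ≤ k) :
    ∃ m ∈ levelSet n k, ∀ i < n, conj (fun j => (m j : ℤ)) (i + 1) = σ.rowLen i := by
  have hn := NeZero.pos n
  let c : ℕ → ℤ := fun i => if i = 0 then k else σ.rowLen (i - 1)
  obtain ⟨m, hm⟩ := exists_conj_eq (n := n) c
    (by simp [c, hn.ne', rowLen_eq_zero σ h1]) (by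
      intro i _
      rcases i with _ | i
      · simpa [c] using h2
      · simpa [c] using σ.rowLen_anti i (i + 1) (Nat.le_succ i))
  refine ⟨m, ?_, fun i hi => ?_⟩
  · rw [mem_levelSet]
    have := hm 0 (Nat.zero_le _)
    rw [conj_zero] at this
    simp only [c, if_true] at this
    exact_mod_cast this
  · rw [hm (i + 1) hi]
    simp [c]

lemma exists_diagram_eq_conj {m : Fin n → ℕ} (hm : m ∈ levelSet n k) :
    ∃ σ : PartitionsIn (n - 1) k, ∀ i : ℕ,
      (σ.1.rowLen i : ℤ) = conj (fun j => (m j : ℤ)) (i + 1) := by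
  have hn := NeZero.pos n
  have hnn : ∀ j, 0 ≤ (fun j => (m j : ℤ)) j := fun j => Int.natCast_nonneg _
  have hanti : Antitone fun i : ℕ => (conj (fun j => (m j : ℤ)) (i + 1)).toNat := by
    refine antitone_nat_of_succ_le fun i => Int.toNat_le_toNat ?_
    refine Finset.sum_le_sum fun a _ => ?_
    split_ifs <;> first | omega | simp
  have h0 : (conj (fun j => (m j : ℤ)) (n - 1 + 1)).toNat = 0 := by
    rw [conj_eq_zero _ (by omega)]; rfl
  obtain ⟨σ, hσ⟩ := exists_rowLen_eq _ hanti (n - 1) h0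
  have hrow : ∀ i : ℕ, (σ.rowLen i : ℤ) = conj (fun j => (m j : ℤ)) (i + 1) := by
    intro i
    rw [hσ, Int.toNat_of_nonneg (conj_nonneg hnn _)]
  refine ⟨⟨σ, ?_, ?_⟩, hrow⟩
  · by_contra! hlt
    have h3 : (n - 1, 0) ∈ σ := YoungDiagram.mem_iff_lt_colLen.mpr hlt
    rw [YoungDiagram.mem_iff_lt_rowLen, hσ, h0] at h3
    exact lt_irrefl _ h3
  · have h3 := hrow 0
    have h4 := conj_le_sum hnn (0 + 1)
    have h5 : (∑ i, (m i : ℤ)) = k := by exact_mod_cast mem_levelSet.mp hm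
    rw [h5, ← h3] at h4
    exact_mod_cast h4

/-- The values `conj 1, conj 2, …` are the rows of the diagram; the omitted `conj 0` is always `k`.
-/
lemma exists_equiv_levelSet : Nonempty (levelSet n k ≃ PartitionsIn (n - 1) k) := by
  choose Φ hΦ using fun m : levelSet n k => exists_diagram_eq_conj m.2
  refine ⟨Equiv.ofBijective Φ ⟨fun m m' h => ?_, fun σ => ?_⟩⟩
  · apply Subtype.ext
    refine natCast_injective (eq_of_conj_eq fun i => ?_)
    rcases i with ⟨_ | i, hi⟩
    · have e1 : (∑ i, (m.1 i : ℤ)) = k := by exact_mod_cast mem_levelSet.mp m.2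
      have e2 : (∑ i, (m'.1 i : ℤ)) = k := by exact_mod_cast mem_levelSet.mp m'.2
      simp only [conj_zero, e1, e2]
    · have e1 := hΦ m i
      have e2 := hΦ m' i
      rw [h] at e1
      exact e1.symm.trans e2
  · obtain ⟨m, hm, hrow⟩ := exists_level_eq_rowLen σ.2.1 σ.2.2
    refine ⟨⟨m, hm⟩, Subtype.ext (ext_rowLen fun i => ?_)⟩
    rcases Nat.lt_or_ge i n with hi | hi
    · have := (hΦ ⟨m, hm⟩ i).trans (hrow i hi)
      exact_mod_cast this
    · rw [rowLen_eq_zero _ ((Φ ⟨m, hm⟩).2.1.trans (by omega)),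
        rowLen_eq_zero _ (σ.2.1.trans (by omega))]

open Classical in
/-- The dual coefficients: the conjugated coefficients divided by the norm. -/
lemma exists_dual_coefficients : ∃ d : PartitionsIn (n - 1) k → (Fin n → ℕ) → Scalars,
    (∀ σ τ : PartitionsIn (n - 1) k,
      ∑ m ∈ levelSet n k, betheState n k σ.1 m * d τ m = if σ = τ then 1 else 0) := by
  -- The norms are nonzero constants, hence units in the Laurent polynomials; being nonzero alone
  -- would not give a spanning set over this ring.
  have hinv : ∀ τ : PartitionsIn (n - 1) k, ∃ c : Scalars,
      scalarProd (betheState n k τ.1) (betheState n k τ.1) * c = 1 := by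
    intro τ
    rw [scalarProd_betheState_self τ.2.1 τ.2.2]
    refine ⟨LaurentPolynomial.C
      (((n : ℝ) * ((n : ℝ) + k) ^ (n - 1) / ‖vandermonde n k τ.1‖ ^ 2 : ℝ) : ℂ)⁻¹, ?_⟩
    rw [← map_mul, mul_inv_cancel₀, map_one]
    intro h
    apply scalarProd_betheState_self_ne_zero (n := n) (k := k) τ.2.1 τ.2.2
    rw [scalarProd_betheState_self τ.2.1 τ.2.2, h, map_zero]
  choose c hc using hinv
  refine ⟨fun τ m => bar (betheState n k τ.1 m) * c τ, fun σ τ => ?_⟩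
  have : ∑ m ∈ levelSet n k, betheState n k σ.1 m * (bar (betheState n k τ.1 m) * c τ) =
      scalarProd (betheState n k τ.1) (betheState n k σ.1) * c τ := by
    rw [scalarProd_betheState, Finset.sum_mul]
    exact Finset.sum_congr rfl fun m _ => by ring
  rw [this]
  split_ifs with h
  · rw [h, hc]
  · rw [scalarProd_betheState_ne τ.2.1 τ.2.2 σ.2.1 σ.2.2 fun h' => h (Subtype.ext h'.symm),
      zero_mul]

lemma linearIndependent_betheState :
    LinearIndependent Scalars fun σ : PartitionsIn (n - 1) k => betheState n k σ.1 := by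
  obtain ⟨d, hd⟩ := exists_dual_coefficients (n := n) (k := k)
  classical
  rw [linearIndependent_iff']
  intro s g hg τ hτ
  have h : ∀ m, ∑ σ ∈ s, g σ * betheState n k σ.1 m = 0 := by
    intro m
    have := DFunLike.congr_fun hg m
    simpa [Finsupp.finsetSum_apply] using this
  calc g τ = ∑ σ ∈ s, g σ * (if σ = τ then 1 else 0) := by simp [hτ]
    _ = ∑ σ ∈ s, g σ * ∑ m ∈ levelSet n k, betheState n k σ.1 m * d τ m := by simp only [hd]
    _ = ∑ m ∈ levelSet n k, (∑ σ ∈ s, g σ * betheState n k σ.1 m) * d τ m := by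
        simp only [Finset.mul_sum, Finset.sum_mul]
        rw [Finset.sum_comm]
        simp only [mul_assoc]
    _ = 0 := by simp [h]

lemma span_betheState : Submodule.span Scalars
    (Set.range fun σ : PartitionsIn (n - 1) k => betheState n k σ.1) = level n k := by
  classical
  apply le_antisymm
  · rw [Submodule.span_le]
    rintro _ ⟨σ, rfl⟩
    rw [SetLike.mem_coe, level, Finsupp.mem_supported]
    intro m hm
    exact mem_levelSet.mp (support_betheState_subset hm)
  · obtain ⟨d, hd⟩ := exists_dual_coefficients (n := n) (k := k)
    obtain ⟨e⟩ := exists_equiv_levelSet (n := n) (k := k)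
    have : Fintype (PartitionsIn (n - 1) k) := Fintype.ofEquiv _ e
    let A : Matrix (PartitionsIn (n - 1) k) (levelSet n k) Scalars :=
      Matrix.of fun σ m => betheState n k σ.1 m.1
    let B : Matrix (levelSet n k) (PartitionsIn (n - 1) k) Scalars :=
      Matrix.of fun m σ => d σ m.1
    have hAB : A * B = 1 := by
      ext1 σ τ
      rw [Matrix.mul_apply, Matrix.one_apply, ← hd σ τ, ← Finset.sum_coe_sort (levelSet n k)]
      rfl
    -- The matrices are square up to the bijection, so duality in one order gives it in the other;
    -- the rows of this identity expand the weights in Bethe vectors.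
    have hBA : B * A = 1 := (Matrix.mul_eq_one_comm_of_equiv e.symm).mp hAB
    rw [level, Finsupp.supported_eq_span_single, Submodule.span_le]
    rintro _ ⟨m, hm, rfl⟩
    have hm' : m ∈ levelSet n k := mem_levelSet.mpr hm
    have hsum : Finsupp.single m (1 : Scalars) =
        ∑ σ : PartitionsIn (n - 1) k, d σ m • betheState n k σ.1 := by
      ext1 m'
      rw [Finsupp.finsetSum_apply, Finsupp.single_apply]
      by_cases h' : m' ∈ levelSet n k
      · have := congrFun (congrFun hBA ⟨m, hm'⟩) ⟨m', h'⟩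
        rw [Matrix.mul_apply, Matrix.one_apply] at this
        simp only [A, B, Matrix.of_apply, Subtype.mk.injEq] at this
        rw [← this]
        rfl
      · rw [if_neg (by rintro rfl; exact h' hm')]
        refine (Finset.sum_eq_zero fun σ _ => ?_).symm
        rw [Finsupp.smul_apply, betheState_apply_of_ne (fun h => h' (mem_levelSet.mpr h)),
          smul_zero]
    simp only [SetLike.mem_coe]
    rw [hsum]
    exact Submodule.sum_mem _ fun σ _ => Submodule.smul_mem _ _ (Submodule.subset_span ⟨σ, rfl⟩)

end Basis

/-! ### Noncommutative Schur polynomials. -/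

section SchurEigenvalues

variable {n k : ℕ} [NeZero n] {σ : YoungDiagram}

lemma symA_betheState (h1 : σ.colLen 0 ≤ n - 1) (h2 : σ.rowLen 0 ≤ k)
    {X : Module.End Scalars (States n)} (hX : X ∈ symA n) :
    ∃ c : Scalars, X (betheState n k σ) = c • betheState n k σ := by
  induction hX using Algebra.adjoin_induction with
  | mem X hX =>
    obtain ⟨r, rfl⟩ := hX
    exact ⟨_, elemA_betheState h1 h2 _⟩
  | algebraMap c => exact ⟨c, by rw [Module.algebraMap_end_apply]⟩
  | add X Y _ _ hX hY =>
    obtain ⟨a, ha⟩ := hX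
    obtain ⟨b, hb⟩ := hY
    exact ⟨a + b, by rw [LinearMap.add_apply, ha, hb, add_smul]⟩
  | mul X Y _ _ hX hY =>
    obtain ⟨a, ha⟩ := hX
    obtain ⟨b, hb⟩ := hY
    exact ⟨b * a, by rw [Module.End.mul_apply, hb, map_smul, ha, smul_smul]⟩

lemma list_prod_apply_of_eigen {R M : Type*} [CommRing R] [AddCommGroup M] [Module R M] (v : M)
    {l : ℕ} (X : Fin l → Module.End R M) (c : Fin l → R) (h : ∀ i, X i v = c i • v) :
    (List.ofFn X).prod v = (∏ i, c i) • v := by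
  induction l with
  | zero => simp
  | succ l ih =>
    rw [List.ofFn_succ, List.prod_cons, Module.End.mul_apply, ih _ (fun i => c i.succ)
      (fun i => h i.succ), map_smul, h, smul_smul, Fin.prod_univ_succ, mul_comm]

/-- Every factor in the Leibniz expansion acts on `b_σ` by a scalar, so the order of factors is
irrelevant and the dual Jacobi–Trudi determinant in `w` results, for every `lam`. -/
lemma schurA_betheState (h1 : σ.colLen 0 ≤ n - 1) (h2 : σ.rowLen 0 ≤ k) (lam : YoungDiagram) :
    schurA n lam (betheState n k σ) =
      schur lam (fun j => (dualRoot n k σ j : Scalars)) • betheState n k σ := by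
  rw [schur_eq_det_genE lam _ le_rfl, schurA, LinearMap.sum_apply, ← Matrix.det_transpose,
    Matrix.det_apply', Finset.sum_smul]
  refine Finset.sum_congr rfl fun π _ => ?_
  rw [LinearMap.smul_apply, list_prod_apply_of_eigen _ _ _ (fun i => elemA_betheState h1 h2 _),
    ← Int.cast_smul_eq_zsmul Scalars, smul_smul]
  rfl

/-- The indices in the Jacobi–Trudi matrix are at most `lam.colLen 0 + lam.rowLen 0 - 1`, so `hlam`
is what permits replacing each `h_r(x)` by `e_r(w)`. -/
lemma schur_transpose_betheRootVal (h1 : σ.colLen 0 ≤ n - 1) (h2 : σ.rowLen 0 ≤ k)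
    {lam : YoungDiagram} (hlam : lam.rowLen 0 + lam.colLen 0 ≤ n + k) :
    schur lam.transpose (betheRootVal n k σ) =
      schur lam fun j => (dualRoot n k σ j : Scalars) := by
  rw [schur_eq_det_genH lam.transpose _ (l := lam.rowLen 0) (by simp),
    schur_eq_det_genE lam _ le_rfl]
  congr 1
  ext1 i j
  simp only [toeplitz, Matrix.of_apply, YoungDiagram.rowLen_transpose]
  refine zcoeff_genH_betheRoot (NeZero.pos n) h1 h2 ?_
  have := lam.colLen_anti 0 i (Nat.zero_le _)
  have := j.is_lt
  omega

omit [NeZero n] in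
lemma schur_dualRoot (lam : YoungDiagram) :
    schur lam (fun j => (dualRoot n k σ j : Scalars)) =
      LaurentPolynomial.T (lam.card : ℤ) * LaurentPolynomial.C (chi n k lam (xi n σ)) := by
  classical
  rw [chi, schur, schur, map_sum, Finset.mul_sum]
  refine Finset.sum_congr rfl fun t _ => ?_
  simp only [dualRoot, rootUnit_val, Finset.prod_mul_distrib, Finset.prod_const, map_prod]
  rw [LaurentPolynomial.T_pow, mul_comm, mul_one, Finset.card_univ, Fintype.card_coe]

end SchurEigenvalues

end PhaseModel

theorem theorem5p4 (n k : ℕ) [NeZero n] :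
    -- the Bethe vectors form a basis of the level `k` subspace
    (LinearIndependent Scalars (fun σ : PartitionsIn (n - 1) k => betheState n k σ.1) ∧
      Submodule.span Scalars
        (Set.range fun σ : PartitionsIn (n - 1) k => betheState n k σ.1) = level n k) ∧
    -- they are pairwise orthogonal
    (∀ σ τ : PartitionsIn (n - 1) k, σ ≠ τ →
      scalarProd (betheState n k σ.1) (betheState n k τ.1) = 0) ∧
    -- they are eigenvectors of every cyclic noncommutative symmetric function
    (∀ σ : PartitionsIn (n - 1) k, ∀ X ∈ symA n, ∃ c : Scalars,
      X (betheState n k σ.1) = c • betheState n k σ.1) ∧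
    -- eigenvalues of the elementary symmetric polynomials
    (∀ σ : PartitionsIn (n - 1) k,
      (∀ r : ℕ, r < n → elemA n r (betheState n k σ.1) =
        hSym r (betheRootVal n k σ.1) • betheState n k σ.1) ∧
      elemA n n (betheState n k σ.1) = zVar n • betheState n k σ.1 ∧
      (0 < k → hSym n (betheRootVal n k σ.1) = zVar n)) ∧
    -- eigenvalues of the Schur polynomials
    (∀ σ : PartitionsIn (n - 1) k, ∀ lam : YoungDiagram, lam.rowLen 0 + lam.colLen 0 ≤ n + k →
      schurA n lam (betheState n k σ.1) =
        schur lam.transpose (betheRootVal n k σ.1) • betheState n k σ.1 ∧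
      schur lam.transpose (betheRootVal n k σ.1) =
        LaurentPolynomial.T (lam.card : ℤ) * LaurentPolynomial.C (chi n k lam (xi n σ.1))) ∧
    -- norms
    (∀ σ : PartitionsIn (n - 1) k, vandermonde n k σ.1 ≠ 0 ∧
      scalarProd (betheState n k σ.1) (betheState n k σ.1) =
        LaurentPolynomial.C
          (((n : ℝ) * ((n : ℝ) + k) ^ (n - 1) / ‖vandermonde n k σ.1‖ ^ 2 : ℝ) : ℂ)) := by
  have hn := NeZero.pos n
  have hh : ∀ (σ : PartitionsIn (n - 1) k) (r : ℕ), r < n + k →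
      hSym r (betheRootVal n k σ.1) =
        zcoeff (genE fun j => (dualRoot n k σ.1 j : Scalars)) r := by
    intro σ r hr
    rw [hSym_eq_coeff, ← zcoeff_natCast,
      zcoeff_genH_betheRoot hn σ.2.1 σ.2.2 (by exact_mod_cast hr)]
  have he : ∀ σ : PartitionsIn (n - 1) k,
      elemA n n (betheState n k σ.1) = zVar n • betheState n k σ.1 := by
    intro σ
    rw [elemA, if_neg (by omega), if_pos rfl, LinearMap.smul_apply, Module.End.one_apply]
  refine ⟨⟨linearIndependent_betheState, span_betheState⟩, fun σ τ h => ?_, fun σ X hX => ?_,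
    fun σ => ⟨fun r hr => ?_, he σ, fun hk => ?_⟩, fun σ lam hlam => ⟨?_, ?_⟩,
    fun σ => ⟨vandermonde_ne_zero σ.2.1 σ.2.2, scalarProd_betheState_self σ.2.1 σ.2.2⟩⟩
  · exact scalarProd_betheState_ne σ.2.1 σ.2.2 τ.2.1 τ.2.2 fun h' => h (Subtype.ext h')
  · exact symA_betheState σ.2.1 σ.2.2 hX
  · rw [hh σ r (by omega)]
    exact elemA_betheState σ.2.1 σ.2.2 r
  -- For `k > 0` the degree `n` is still below `n + k`, so `h_n(x)` and `z` are both eigenvalues of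
  -- `e_n(𝒜)` on `b_σ`; pairing with `b_σ` lets them be compared.
  · have h1 := elemA_betheState σ.2.1 σ.2.2 n
    rw [he σ, ← hh σ n (by omega)] at h1
    have h2 := scalarProd_betheState_self_ne_zero (n := n) σ.2.1 σ.2.2
    have h3 := congrArg (scalarProd (betheState n k σ.1)) h1
    rw [scalarProd_smul_right, scalarProd_smul_right] at h3
    exact (mul_right_cancel₀ h2 h3).symm
  · rw [schur_transpose_betheRootVal σ.2.1 σ.2.2 hlam]
    exact schurA_betheState σ.2.1 σ.2.2 lam
  · rw [schur_transpose_betheRootVal σ.2.1 σ.2.2 hlam, schur_dualRoot]
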